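/- Let $G=(V,E)$ be a finite simple graph, $n=|V|$, $m=|E|$, with minimum degree $\delta(G)$ and vertex weights $w:V\to\mathbb N\cup\{\infty\}$. An efficient dominating set (e.d.) of $G$ is a set $D\subseteq V$ such that every vertex $x$ has exactly one $d\in D$ with $d=x$ or $dx\in E$; its weight is $\sum_{d\in D}w(d)$. $G$ is $P_6$-free if it has no induced path on six vertices. A vertex $b$ contacts a set $K$ if it has a neighbour in $K$, distinguishes $K$ if it has a neighbour and a non-neighbour in $K$, and has a join to $K$ if it is adjacent to all of $K$. **Join-reduction** of $(A,B,w)$, $A,B\subseteq V$ disjoint, $w=\infty$ on $B$, where $A_1,\dots,A_k$ are the components of $G[A]$: stop if some $b\in B$ has a join to two of the $A_i$, or if some $A_i$ to which a $b\in B$ has a join has no vertex universal for $A_i$. Otherwise replace each $A_i$ to which some $b\in B$ has a join by its set of universal vertices; for every $b\in B$ with a join to $A_i$ give weight $\infty$ to all neighbours of $b$ in $A\setminus A_i$; delete from $B$ all vertices that have a join to some $A_i$. **Component-reduction** for $b^*$ and $q^*\in A\cap N(b^*)$: in the non-clique components of $G[A]$ discard all neighbours of $b^*$ and of $q^*$;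 replace every component of what remains by its universal vertices, stopping if there are none; replace the component of $q^*$, if it is a clique, by $\{q^*\}$, and otherwise keep $q^*$ in addition; keep the other clique components; discarded vertices get weight $\infty$. **Unipolar algorithm** for $(A,B,w)$, where the components of $G[A]$ are cliques, $B$ is regarded as a clique and $w=\infty$ on $B$. Apply join-reduction. For $b_1,b_2\in B$ write $b_1\to b_2$ if for at least three components $K$ of $G[A]$ the vertex $b_2$ distinguishes an edge of $G[K\setminus N(b_1)]$. If $B\neq\emptyset$, choose $b^*\in B$ with $b^*\not\to b$ for all $b\in B\setminus\{b^*\}$ (if there is none, report failure), and for every finite-weight $a^*\in A\cap N(b^*)$ replace the component of $a^*$ by $\{a^*\}$, delete the other neighbours of $b^*$ from $A$, and apply join-reduction again. In the graph so obtained form all sets consisting of one minimum-weight vertex from each component not distinguished by any vertex of $B$ and one finite-weight vertex from each other component. (If $B=\emptyset$, form these sets at once.) Return a cheapest one among those that are a finite-weight e.d. of the graph obtained by the first join-reduction, or report that there is none. **Algorithm WED.** Determine a vertex $v_0$ of minimum degree. For every $v\in N[v_0]$: (a) determine the distance levels $N_1(v),\dots,N_4(v)$; (b) set $B=N_2(v)$,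 $A=N_3(v)\cup N_4(v)$, $w=\infty$ on $B$, and apply join-reduction; (c) if all components of $G[A]$ are now cliques, apply the unipolar algorithm; otherwise determine a vertex $b^*\in N_2(v)$ contacting every non-clique component and, for every finite-weight $q^*\in N(b^*)\cap A$, apply component-reduction and then the unipolar algorithm; (d) add $v$ to every resulting set and check whether it is a finite-weight e.d. of $G$. Output a cheapest set found, or report that there is none. **Theorem.** Algorithm WED is correct for connected $P_6$-free graphs: for every connected $P_6$-free graph $G$ and all weights $w$, it either outputs an e.d. of $G$ of finite weight that is of minimum weight among all e.d.s of $G$, or it reports that there is none and then $G$ has no e.d. of finite weight. Moreover its running time on connected $P_6$-free graphs with $n\ge2$ vertices is $O(\delta(G)\,n^5m)\subseteq O(n^6m)$. Here time is the number of elementary steps (adjacency and weight queries, array and list accesses, comparisons and additions of numbers, logical operations, loop control) at unit cost. -/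

import Mathlib

open scoped BigOperators

namespace WED

/-! ## Efficient dominating sets -/

/-- `D` is an efficient dominating set (e.d.) of `G`: every vertex is dominated by exactly one
member of `D`, where a vertex dominates itself and its neighbours. -/
def IsEfficientDominating {V : Type} (G : SimpleGraph V) (D : Finset V) : Prop :=
  ∀ x : V, ∃! d : V, d ∈ D ∧ (d = x ∨ G.Adj d x)

/-- The total weight of a vertex set. -/
def setWeight {V : Type} (w : V → ℕ∞) (D : Finset V) : ℕ∞ := ∑ x ∈ D, w x

/-- `G` has no induced path on six vertices. -/
def P6Free {V : Type} (G : SimpleGraph V) : Prop :=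
  ¬ (SimpleGraph.pathGraph 6).IsIndContained G

/-- `r` is a correct answer to the weighted efficient domination problem for `(G, w)`:
either `r = some D` and `D` is (the indicator function of) an e.d. of finite weight which is
minimum among all e.d.s, or `r = none` and there is no e.d. of finite weight. -/
def IsWEDAnswer {n : ℕ} (G : SimpleGraph (Fin n)) (w : Fin n → ℕ∞) :
    Option (Fin n → Bool) → Prop
  | none => ∀ D : Finset (Fin n), IsEfficientDominating G D → setWeight w D = ⊤
  | some r =>
      IsEfficientDominating G (Finset.univ.filter fun x => r x = true) ∧
      setWeight w (Finset.univ.filter fun x => r x = true) < ⊤ ∧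
      ∀ D : Finset (Fin n), IsEfficientDominating G D →
        setWeight w (Finset.univ.filter fun x => r x = true) ≤ setWeight w D

/-! ## The programming language and its step count

Algorithms are closed terms of a small first-order language with bounded loops. A program is one
syntactic object, fixed for all inputs; every syntactic node that is executed and every loop
iteration is charged one unit of time. There is no operation beyond those listed, so no
computation is free. -/

/-- Data types: truth values, vertices, numbers in `ℕ ∪ {∞}`, pairs, optional values, arrays
indexed by the vertices, linked lists. -/
inductive Ty : Type
  | bool : Ty
  | vert : Ty
  | num : Ty
  | prod : Ty → Ty → Ty
  | opt : Ty → Ty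
  | arr : Ty → Ty
  | list : Ty → Ty

/-- The values of a data type, for inputs with `n` vertices. -/
@[reducible] def Ty.den (n : ℕ) : Ty → Type
  | .bool => Bool
  | .vert => Fin n
  | .num => ℕ∞
  | .prod σ τ => Ty.den n σ × Ty.den n τ
  | .opt τ => Option (Ty.den n τ)
  | .arr τ => Fin n → Ty.den n τ
  | .list τ => List (Ty.den n τ)

/-- Vertex sets, given by their characteristic array. -/
abbrev Ty.set : Ty := .arr .bool

/-- Boolean matrices (binary relations on the vertices). -/
abbrev Ty.mat : Ty := .arr .set

/-- Weight functions. -/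
abbrev Ty.wts : Ty := .arr .num

/-- Triples `(A, B, w)`: the induced subgraph `G[A ∪ B]` with its partition and weights. -/
abbrev Ty.inst : Ty := .prod .set (.prod .set .wts)

/-- Terms. Variables are taken from `rep`; a program is a term that is polymorphic in `rep`, so it
can inspect its data only through the operations of the language. -/
inductive Tm (rep : Ty → Type) : Ty → Type
  /-- a variable -/
  | var {τ : Ty} : rep τ → Tm rep τ
  /-- compute a value and store it in a new variable -/
  | lett {σ τ : Ty} : Tm rep σ → (rep σ → Tm rep τ) → Tm rep τ
  | tt : Tm rep .bool
  | ff : Tm rep .bool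
  | not : Tm rep .bool → Tm rep .bool
  | and : Tm rep .bool → Tm rep .bool → Tm rep .bool
  | or : Tm rep .bool → Tm rep .bool → Tm rep .bool
  | ite {τ : Ty} : Tm rep .bool → Tm rep τ → Tm rep τ → Tm rep τ
  /-- are two vertices equal? -/
  | eqv : Tm rep .vert → Tm rep .vert → Tm rep .bool
  /-- are two vertices of the input graph adjacent? -/
  | adj : Tm rep .vert → Tm rep .vert → Tm rep .bool
  /-- the weight of a vertex in the input -/
  | wt : Tm rep .vert → Tm rep .num
  | const : ℕ∞ → Tm rep .num
  | add : Tm rep .num → Tm rep .num → Tm rep .num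
  | le : Tm rep .num → Tm rep .num → Tm rep .bool
  | pair {σ τ : Ty} : Tm rep σ → Tm rep τ → Tm rep (.prod σ τ)
  | fst {σ τ : Ty} : Tm rep (.prod σ τ) → Tm rep σ
  | snd {σ τ : Ty} : Tm rep (.prod σ τ) → Tm rep τ
  | none {τ : Ty} : Tm rep (.opt τ)
  | some {τ : Ty} : Tm rep τ → Tm rep (.opt τ)
  /-- case distinction on an optional value -/
  | elim {σ τ : Ty} : Tm rep (.opt σ) → Tm rep τ → (rep σ → Tm rep τ) → Tm rep τ
  /-- fill a new array, computing its entries one after the other -/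
  | tab {τ : Ty} : (rep .vert → Tm rep τ) → Tm rep (.arr τ)
  /-- read one array entry -/
  | get {τ : Ty} : Tm rep (.arr τ) → Tm rep .vert → Tm rep τ
  | nil {τ : Ty} : Tm rep (.list τ)
  | cons {τ : Ty} : Tm rep τ → Tm rep (.list τ) → Tm rep (.list τ)
  /-- loop over all vertices, updating a state -/
  | loop {σ : Ty} : Tm rep σ → (rep .vert → rep σ → Tm rep σ) → Tm rep σ
  /-- loop over the entries of a list, updating a state -/
  | each {τ σ : Ty} : Tm rep (.list τ) → Tm rep σ → (rep τ → rep σ → Tm rep σ) → Tm rep σ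

/-- The number of steps of a loop over `l` that starts in state `s`, where an iteration for `a` in
state `s` leads to state `step a s` and takes `c a s` steps, plus one for loop control. -/
def loopCost {α σ : Type} (step : α → σ → σ) (c : α → σ → ℕ) : List α → σ → ℕ
  | [], _ => 0
  | a :: l, s => 1 + c a s + loopCost step c l (step a s)

namespace Tm

/-- The value computed by a term on the input graph with adjacency matrix `g` and weights `w`. -/
def val {n : ℕ} (g : Fin n → Fin n → Bool) (w : Fin n → ℕ∞) :
    {τ : Ty} → Tm (Ty.den n) τ → Ty.den n τ
  | _, .var x => x
  | _, .lett t k => val g w (k (val g w t))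
  | _, .tt => true
  | _, .ff => false
  | _, .not t => !(val g w t)
  | _, .and s t => val g w s && val g w t
  | _, .or s t => val g w s || val g w t
  | _, .ite c s t => if val g w c = true then val g w s else val g w t
  | _, .eqv s t => decide (val g w s = val g w t)
  | _, .adj s t => g (val g w s) (val g w t)
  | _, .wt t => w (val g w t)
  | _, .const c => c
  | _, .add s t => val g w s + val g w t
  | _, .le s t => decide (val g w s ≤ val g w t)
  | _, .pair s t => (val g w s, val g w t)
  | _, .fst t => (val g w t).1
  | _, .snd t => (val g w t).2
  | _, .none => Option.none
  | _, .some t => Option.some (val g w t)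
  | _, .elim t d k => Option.elim (val g w t) (val g w d) (fun x => val g w (k x))
  | _, .tab f => fun x => val g w (f x)
  | _, .get a t => val g w a (val g w t)
  | _, .nil => []
  | _, .cons s t => val g w s :: val g w t
  | _, .loop i k => (List.finRange n).foldl (fun s x => val g w (k x s)) (val g w i)
  | _, .each l i k => (val g w l).foldl (fun s x => val g w (k x s)) (val g w i)

/-- The number of steps executed by a term on the input graph with adjacency matrix `g` and
weights `w`. -/
def cost {n : ℕ} (g : Fin n → Fin n → Bool) (w : Fin n → ℕ∞) :
    {τ : Ty} → Tm (Ty.den n) τ → ℕ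
  | _, .var _ => 1
  | _, .lett t k => 1 + cost g w t + cost g w (k (val g w t))
  | _, .tt => 1
  | _, .ff => 1
  | _, .not t => 1 + cost g w t
  | _, .and s t => 1 + cost g w s + cost g w t
  | _, .or s t => 1 + cost g w s + cost g w t
  | _, .ite c s t => 1 + cost g w c + if val g w c = true then cost g w s else cost g w t
  | _, .eqv s t => 1 + cost g w s + cost g w t
  | _, .adj s t => 1 + cost g w s + cost g w t
  | _, .wt t => 1 + cost g w t
  | _, .const _ => 1
  | _, .add s t => 1 + cost g w s + cost g w t
  | _, .le s t => 1 + cost g w s + cost g w t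
  | _, .pair s t => 1 + cost g w s + cost g w t
  | _, .fst t => 1 + cost g w t
  | _, .snd t => 1 + cost g w t
  | _, .none => 1
  | _, .some t => 1 + cost g w t
  | _, .elim t d k =>
      1 + cost g w t + Option.elim (val g w t) (cost g w d) (fun x => cost g w (k x))
  | _, .tab f => 1 + ∑ x : Fin n, (1 + cost g w (f x))
  | _, .get a t => 1 + cost g w a + cost g w t
  | _, .nil => 1
  | _, .cons s t => 1 + cost g w s + cost g w t
  | _, .loop i k =>
      1 + cost g w i +
        loopCost (fun x s => val g w (k x s)) (fun x s => cost g w (k x s))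
          (List.finRange n) (val g w i)
  | _, .each l i k =>
      1 + cost g w l + cost g w i +
        loopCost (fun x s => val g w (k x s)) (fun x s => cost g w (k x s))
          (val g w l) (val g w i)

end Tm

/-! ## Elementary subroutines -/

prefix:max "♯" => Tm.var
prefix:max "∼ₜ" => Tm.not
infixr:35 " &ₜ " => Tm.and
infixr:30 " |ₜ " => Tm.or

section Programs

variable {rep : Ty → Type}

def imp (s t : Tm rep .bool) : Tm rep .bool := ∼ₜ s |ₜ t

def any (p : rep .vert → Tm rep .bool) : Tm rep .bool :=
  .loop .ff fun x s => ♯s |ₜ p x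

def all (p : rep .vert → Tm rep .bool) : Tm rep .bool :=
  .loop .tt fun x s => ♯s &ₜ p x

def count (p : rep .vert → Tm rep .bool) : Tm rep .num :=
  .loop (.const 0) fun x s => .ite (p x) (.add ♯s (.const 1)) ♯s

/-- Some vertex satisfying `p`, if there is one. -/
def find (p : rep .vert → Tm rep .bool) : Tm rep (.opt .vert) :=
  .loop .none fun x s => .ite (p x) (.some ♯x) ♯s

def eqNum (s t : Tm rep .num) : Tm rep .bool :=
  .lett s fun x => .lett t fun y => .le ♯x ♯y &ₜ .le ♯y ♯x

def isFinite (t : Tm rep .num) : Tm rep .bool := ∼ₜ (.le (.const ⊤) t)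

/-- `x ∈ A` -/
def mem (A : rep .set) (x : rep .vert) : Tm rep .bool := .get ♯A ♯x

/-- the matrix entry `M x y` -/
def entry (M : rep .mat) (x y : rep .vert) : Tm rep .bool := .get (.get ♯M ♯x) ♯y

/-- adjacency of two vertices stored in variables -/
def nb (x y : rep .vert) : Tm rep .bool := .adj ♯x ♯y

/-- `x ∈ N[y]` -/
def clnb (x y : rep .vert) : Tm rep .bool := .eqv ♯x ♯y |ₜ .adj ♯x ♯y

/-- `D ∪ {x}` -/
def insertVert (D : rep .set) (x : rep .vert) : Tm rep .set :=
  .tab fun y => mem D y |ₜ .eqv ♯y ♯x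

/-- The connected components of `G[A]`, as the relation "`x`, `y ∈ A` lie in the same component"
(computed as a transitive closure). -/
def components (A : rep .set) : Tm rep .mat :=
  .loop (.tab fun x => .tab fun y => mem A x &ₜ mem A y &ₜ clnb x y) fun k R =>
    .tab fun x => .tab fun y => entry R x y |ₜ (entry R x k &ₜ entry R k y)

/-- The vertices of `A` which are universal for their component; `C` is the component relation. -/
def universalVerts (A : rep .set) (C : rep .mat) : Tm rep .set :=
  .tab fun u => mem A u &ₜ all fun y => imp (entry C u y) (clnb y u)

/-- One vertex from each component that meets `P`, for `P` inside the field of the component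
relation `C`. -/
def representatives (P : rep .set) (C : rep .mat) : Tm rep (.list .vert) :=
  .loop .nil fun x l =>
    .ite (mem P x &ₜ ∼ₜ (.each ♯l .ff fun r s => ♯s |ₜ entry C r x)) (.cons ♯x ♯l) ♯l

/-- Is `D` an e.d. of the induced subgraph `G[S]`? -/
def isED (S D : rep .set) : Tm rep .bool :=
  (all fun d => imp (mem D d) (mem S d)) &ₜ
  all fun x => imp (mem S x) (eqNum (count fun d => mem D d &ₜ clnb d x) (.const 1))

def weightOf (w : rep .wts) (D : rep .set) : Tm rep .num :=
  .loop (.const 0) fun x s => .ite (mem D x) (.add ♯s (.get ♯w ♯x)) ♯s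

/-- If `D` is a finite weight e.d. of `G[S]` and cheaper than the best solution found so far
(stored with its weight), replace the latter by `D`. -/
def improve (S : rep .set) (w : rep .wts) (D : rep .set) (best : rep (.opt (.prod .num .set))) :
    Tm rep (.opt (.prod .num .set)) :=
  .ite (isED S D)
    (.lett (weightOf w D) fun c =>
      .ite (isFinite ♯c)
        (.elim ♯best (.some (.pair ♯c ♯D)) fun p =>
          .ite (.le (.fst ♯p) ♯c) ♯best (.some (.pair ♯c ♯D)))
        ♯best)
    ♯best

/-! ## Join-reduction -/

/-- The Join-Reduction Algorithm for `G[A ∪ B]` with weights `w` (where `w = ∞` on `B`); the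
answer `none` means "STOP, there is no e.d. of finite weight". Below `A_a` is the component
of `a` in `G[A]`, and `J b a` says that `b ∈ B` has a join to `A_a`. -/
def joinReduction (A B : rep .set) (w : rep .wts) : Tm rep (.opt .inst) :=
  .lett (components A) fun C =>
  .lett (.tab fun b => .tab fun a =>
    mem B b &ₜ mem A a &ₜ all fun y => imp (entry C a y) (nb b y)) fun J =>
  .lett (.tab fun b => any fun a => entry J b a) fun Bjoin =>
  .lett (.tab fun a => any fun b => entry J b a) fun Ajoin =>
  -- some `b` has a join to two distinct components
  .ite (any fun b => any fun a₁ => any fun a₂ =>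
      entry J b a₁ &ₜ entry J b a₂ &ₜ ∼ₜ (entry C a₁ a₂)) .none <|
  .lett (universalVerts A C) fun U =>
  -- some joined component has no universal vertex
  .ite (any fun a => mem Ajoin a &ₜ ∼ₜ (any fun u => entry C a u &ₜ mem U u)) .none <|
  .some <|
    .pair (.tab fun a => mem A a &ₜ imp (mem Ajoin a) (mem U a)) <|
    .pair (.tab fun b => mem B b &ₜ ∼ₜ (mem Bjoin b)) <|
    .tab fun y =>
      .ite (mem A y &ₜ any fun b => any fun a => entry J b a &ₜ ∼ₜ (entry C a y) &ₜ nb b y)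
        (.const ⊤) (.get ♯w ♯y)

/-! ## The algorithm for unipolar graphs -/

/-- `b₁ → b₂`: for at least three components of `G[A]`, `b₂` overtakes `b₁`, i.e. `b₂`
distinguishes an edge of the component whose ends are not adjacent to `b₁`. -/
def arrow (A : rep .set) (C : rep .mat) (b₁ b₂ : rep .vert) : Tm rep .bool :=
  .lett (.tab fun x => mem A x &ₜ any fun y =>
    entry C x y &ₜ nb x y &ₜ ∼ₜ (nb b₁ x) &ₜ ∼ₜ (nb b₁ y) &ₜ nb b₂ x &ₜ ∼ₜ (nb b₂ y)) fun P =>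
  .le (.const 3) (.each (representatives P C) (.const 0) fun _ s => .add ♯s (.const 1))

/-- The candidate sets in a join-reduced `G[A ∪ B]` whose components in `A` are cliques: a vertex
of minimum weight from each component that no vertex of `B` distinguishes, together with all
choices of one finite weight vertex from each of the remaining components. -/
def candidates (A B : rep .set) (w : rep .wts) : Tm rep (.list .set) :=
  .lett (components A) fun C =>
  .lett (.tab fun a => mem A a &ₜ any fun b => mem B b &ₜ
    (any fun y => entry C a y &ₜ nb b y) &ₜ
    (any fun y => entry C a y &ₜ ∼ₜ (nb b y))) fun C₂ =>
  .lett (.tab fun a => mem A a &ₜ ∼ₜ (mem C₂ a)) fun C₁ =>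
  .lett (.each (representatives C₁ C) (.tab fun _ => .ff) fun r D =>
    .lett (.loop ♯r fun x m =>
      .ite (entry C r x &ₜ ∼ₜ (.le (.get ♯w ♯m) (.get ♯w ♯x))) ♯x ♯m) fun x =>
    insertVert D x) fun D₁ =>
  .each (representatives C₂ C) (.cons ♯D₁ .nil) fun r L =>
    .each ♯L .nil fun D L₁ =>
      .loop ♯L₁ fun x L₂ =>
        .ite (entry C r x &ₜ isFinite (.get ♯w ♯x)) (.cons (insertVert D x) ♯L₂) ♯L₂

/-- Algorithm WED for `P₆`-free unipolar graphs `G[A ∪ B]` with `w = ∞` on `B`: the components of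
`G[A]` are cliques, and `B` is regarded as a clique (edges inside `B` are never inspected). If
join-reduction leaves no vertex in `B`, there is no good vertex to be chosen, and the single
candidate set is tested directly. -/
def unipolarWED (A B : rep .set) (w : rep .wts) : Tm rep (.opt .set) :=
  -- (a) join-reduction
  .elim (joinReduction A B w) .none fun I =>
  .lett (.fst ♯I) fun A₁ =>
  .lett (.fst (.snd ♯I)) fun B₁ =>
  .lett (.snd (.snd ♯I)) fun w₁ =>
  .lett (.tab fun x => mem A₁ x |ₜ mem B₁ x) fun S =>
  .lett (components A₁) fun C =>
  .lett
    (.ite (any fun b => mem B₁ b)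
      -- (b) a good vertex `b`
      (.elim (find fun b => mem B₁ b &ₜ
          all fun b₂ => imp (mem B₁ b₂ &ₜ ∼ₜ (.eqv ♯b₂ ♯b)) (∼ₜ (arrow A₁ C b b₂))) .none fun b =>
        -- (c) every possible neighbour `a` of `b` in the e.d.
        .loop .none fun a best =>
          .ite (mem A₁ a &ₜ nb b a &ₜ isFinite (.get ♯w₁ ♯a))
            (.lett (.tab fun x => .eqv ♯x ♯a |ₜ
                (mem A₁ x &ₜ ∼ₜ (entry C a x) &ₜ ∼ₜ (nb b x))) fun A₂ =>
              .elim (joinReduction A₂ B₁ w₁) ♯best fun I₃ =>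
              .lett (.fst ♯I₃) fun A₃ =>
              .lett (.fst (.snd ♯I₃)) fun B₃ =>
              .lett (.snd (.snd ♯I₃)) fun w₃ =>
              .each (candidates A₃ B₃ w₃) ♯best fun D best₁ => improve S w₁ D best₁)
            ♯best)
      (.each (candidates A₁ B₁ w₁) .none fun D best => improve S w₁ D best))
    fun best =>
  -- (d) the best solution found
  .elim ♯best .none fun p => .some (.snd ♯p)

/-! ## Component-reduction -/

/-- The set of vertices of `A` whose component in `G[A]` is a clique. -/
def cliqueComponents (A : rep .set) (C : rep .mat) : Tm rep .set :=
  .tab fun a => mem A a &ₜ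
    all fun x => all fun y => imp (entry C a x &ₜ entry C a y) (clnb x y)

/-- Step (b) of the Component-Reduction Algorithm for `b* = b` and `q* = q`: `C` is the component
relation of `G[A]` and `K` the set of vertices in clique components. In non-clique components
the neighbours of `b` and of `q` are discarded, and each component of what remains
is replaced by its universal vertices; the component of `q` contributes `q` besides.
The answer `none` means that some component has no universal vertex. -/
def componentReduction (A : rep .set) (w : rep .wts) (C : rep .mat) (K : rep .set)
    (b q : rep .vert) : Tm rep (.opt (.prod .set .wts)) :=
  .lett (.tab fun y => mem A y &ₜ ∼ₜ (mem K y) &ₜ ∼ₜ (nb b y) &ₜ ∼ₜ (clnb q y)) fun Y =>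
  .lett (components Y) fun C₂ =>
  .lett (universalVerts Y C₂) fun U =>
  .ite (any fun y => mem Y y &ₜ ∼ₜ (any fun u => entry C₂ y u &ₜ mem U u)) .none <|
  .lett (.tab fun a =>
    .eqv ♯a ♯q |ₜ (mem K a &ₜ ∼ₜ (entry C q a)) |ₜ mem U a) fun A₂ =>
  .some <| .pair ♯A₂ <| .tab fun a => .ite (mem A₂ a) (.get ♯w ♯a) (.const ⊤)

/-! ## The algorithm for `P₆`-free graphs -/

/-- One round of the main loop, for the vertex `v`. -/
def wedRound (w : rep .wts) (v : rep .vert) (best : rep (.opt (.prod .num .set))) :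
    Tm rep (.opt (.prod .num .set)) :=
  -- (a) the distance levels of `v`
  .lett (.tab fun u => nb v u) fun N₁ =>
  .lett (.tab fun u => ∼ₜ (.eqv ♯u ♯v) &ₜ ∼ₜ (mem N₁ u) &ₜ
    any fun x => mem N₁ x &ₜ nb x u) fun N₂ =>
  .lett (.tab fun u => ∼ₜ (mem N₁ u) &ₜ ∼ₜ (mem N₂ u) &ₜ
    any fun x => mem N₂ x &ₜ nb x u) fun N₃ =>
  .lett (.tab fun u => ∼ₜ (mem N₂ u) &ₜ ∼ₜ (mem N₃ u) &ₜ
    any fun x => mem N₃ x &ₜ nb x u) fun N₄ =>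
  -- (b) join-reduction for `B = N₂(v)` and `A = N₃(v) ∪ N₄(v)`
  .lett (.tab fun u => mem N₃ u |ₜ mem N₄ u) fun A =>
  .lett (.tab fun u => .ite (mem N₂ u) (.const ⊤) (.get ♯w ♯u)) fun w₀ =>
  .elim (joinReduction A N₂ w₀) ♯best fun I =>
  .lett (.fst ♯I) fun A₁ =>
  .lett (.fst (.snd ♯I)) fun B₁ =>
  .lett (.snd (.snd ♯I)) fun w₁ =>
  .lett (components A₁) fun C =>
  .lett (cliqueComponents A₁ C) fun K =>
  -- (c) the list of solutions of the unipolar instances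
  .lett
    (.ite (any fun a => mem A₁ a &ₜ ∼ₜ (mem K a))
      (.elim
        (find fun b => mem N₂ b &ₜ all fun a =>
          imp (mem A₁ a &ₜ ∼ₜ (mem K a)) (any fun y => entry C a y &ₜ nb b y)) .nil fun b =>
        .loop .nil fun q L =>
          .ite (mem A₁ q &ₜ nb b q &ₜ isFinite (.get ♯w₁ ♯q))
            (.elim (componentReduction A₁ w₁ C K b q) ♯L fun R =>
              .lett (.fst ♯R) fun A₂ =>
              .lett (.snd ♯R) fun w₂ =>
              .elim (unipolarWED A₂ B₁ w₂) ♯L fun D => .cons ♯D ♯L)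
            ♯L)
      -- all components are cliques, so the instance is unipolar already
      (.elim (unipolarWED A₁ B₁ w₁) .nil fun D => .cons ♯D .nil))
    fun L =>
  -- (d) check the resulting sets in `G` and keep the best one
  .lett (.tab fun _ => .tt) fun V =>
  .each ♯L ♯best fun D best₁ =>
    .lett (insertVert D v) fun D₁ => improve V w D₁ best₁

/-- Algorithm WED for `P₆`-free graphs. -/
def wedAlgorithm : Tm rep (.opt .set) :=
  .lett (.tab fun x => .wt ♯x) fun w =>
  .lett (.tab fun x => count fun y => nb x y) fun deg =>
  -- a vertex of minimum degree
  .elim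
    (.loop .none fun x m =>
      .elim ♯m (.some ♯x) fun y => .ite (.le (.get ♯deg ♯y) (.get ♯deg ♯x)) ♯m (.some ♯x))
    .none fun v₀ =>
  .lett (.loop .none fun v best => .ite (clnb v v₀) (wedRound w v best) ♯best) fun best =>
  .elim ♯best .none fun p => .some (.snd ♯p)

end Programs

/-- The adjacency matrix that is given to the algorithm. -/
def adjMat {n : ℕ} (G : SimpleGraph (Fin n)) [DecidableRel G.Adj] : Fin n → Fin n → Bool :=
  fun x y => decide (G.Adj x y)

/-- The output of Algorithm WED on the graph `G` with vertex weights `w`. -/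
def wedOutput {n : ℕ} (G : SimpleGraph (Fin n)) [DecidableRel G.Adj] (w : Fin n → ℕ∞) :
    Option (Fin n → Bool) :=
  (wedAlgorithm (rep := Ty.den n)).val (adjMat G) w

/-- The running time of Algorithm WED on the graph `G` with vertex weights `w`. -/
def wedTime {n : ℕ} (G : SimpleGraph (Fin n)) [DecidableRel G.Adj] (w : Fin n → ℕ∞) : ℕ :=
  (wedAlgorithm (rep := Ty.den n)).cost (adjMat G) w

end WED

namespace WED

section

/-! ## Folds -/

/-! Soundness is cheap: a set is output only after it has been tested to be an e.d. of `G` of finite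
weight. The work is to show that every e.d. `D` of finite weight is matched by a tested set that is
no heavier, and that the lists of sets to be tested stay short.

`D` contains exactly one vertex `v` of `N[v₀]`. For this `v`, no other vertex of `D` lies in `N₁` or
`N₂`, and there is no fifth level, since it would complete an induced `P₆`. So `D \ {v}` is an e.d.
of `G[A ∪ N₂]` inside `A = N₃ ∪ N₄`, and conversely adding `v` to any such set gives an e.d. of `G`
(`IsLevels.isSol`, `IsLevels.isEDOn`). Join-reduction does not change the set of solutions: if `b`
has a join to a component, then all members of `D` in that component dominate `b`, so there is just
one, it is universal, and it is the only neighbour of `b` in `D`.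

`P₆`-freeness enters the reductions in two ways. First, no vertex of `N₂` starts a path with three
vertices of `A` that is induced and has only the first of them as a neighbour (`IsLevels.no_path`).
Hence, once `b*` and its neighbour `q*` in `D` are removed with their neighbours, every neighbour of
`b*` that contacts a remaining component has a join to it; this forces a single, universal member of
`D` there, so component-reduction leaves cliques (`ReductionSetup.isSol_of_isSol`). Second, two
vertices of `N₂` cannot each distinguish an edge that the other misses in two different components
(`IsLevels.no_pattern`). This makes the sets of vertices contacting the non-clique components a
chain, so that `b*` exists (`IsLevels.exists_contact`), and it yields `NoMutualOvertaking`, all that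
the unipolar part needs.

In the unipolar part, a solution makes `→` acyclic: along any chain of arrows from `b` to `b'` there
remains a component in which `b'`, but not `b`, sees a certain vertex, while neither sees the member
of `D`. So a good vertex exists (`exists_good_vertex`). Once its neighbour in `D` is fixed, three
distinguished components would be contacted by one common vertex, because contacts form a chain, and
the good vertex would have an arrow to it. Hence at most two components are distinguished
(`JoinReduced.not_three_distinguished`). In the other components all vertices have the same
neighbours in `B`, so the lightest one may be chosen (`IsCandidate.isSol`).

At most two free components give at most `n²` candidates, each tested in `O(n²)` steps. The choices
of `a*` and `q*` contribute a factor `n` each, so a round takes `O(n⁶)` steps. There are `δ + 1`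
rounds, and `n ≤ 2m` and `δ ≥ 1` by connectedness. -/

theorem foldl_preserves {α σ : Type*} {P : σ → Prop} {f : σ → α → σ} (l : List α)
    (h : ∀ s, ∀ a ∈ l, P s → P (f s a)) {s : σ} (hs : P s) : P (l.foldl f s) := by
  induction l generalizing s with
  | nil => exact hs
  | cons a l ih =>
    exact ih (fun s b hb => h s b (List.mem_cons_of_mem _ hb)) (h s a List.mem_cons_self hs)

/-- One successful iteration suffices if the others do no harm. The state in which that iteration
starts is unknown, so it must succeed from every state. -/
theorem foldl_reaches {α σ : Type*} {P : σ → Prop} {f : σ → α → σ} {l : List α} {a : α}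
    (ha : a ∈ l) (hmono : ∀ s, ∀ b ∈ l, P s → P (f s b)) (hstep : ∀ s, P (f s a)) (s : σ) :
    P (l.foldl f s) := by
  obtain ⟨l₁, l₂, rfl⟩ := List.append_of_mem ha
  rw [List.foldl_append, List.foldl_cons]
  exact foldl_preserves l₂ (fun s b hb => hmono s b (by simp [hb])) (hstep _)

theorem foldl_or_eq_true {α : Type*} (f : α → Bool) (l : List α) (b : Bool) :
    l.foldl (fun s x => s || f x) b = true ↔ b = true ∨ ∃ x ∈ l, f x = true := by
  induction l generalizing b with
  | nil => simp
  | cons a l ih => simp [ih, or_assoc]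

theorem foldl_and_eq_true {α : Type*} (f : α → Bool) (l : List α) (b : Bool) :
    l.foldl (fun s x => s && f x) b = true ↔ b = true ∧ ∀ x ∈ l, f x = true := by
  induction l generalizing b with
  | nil => simp
  | cons a l ih => simp [ih, and_assoc]

theorem foldl_ite_add {α M : Type*} [AddCommMonoid M] (f : α → Bool) (c : α → M) (l : List α)
    (s : M) :
    l.foldl (fun s x => if f x = true then s + c x else s) s =
      s + (l.map fun x => if f x = true then c x else 0).sum := by
  induction l generalizing s with
  | nil => simp
  | cons a l ih =>
    simp only [List.foldl_cons, ih, List.map_cons, List.sum_cons]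
    split_ifs <;> simp [add_assoc]

theorem foldl_length {α : Type*} (l : List α) (s : ℕ∞) :
    l.foldl (fun s _ => s + 1) s = s + l.length := by
  induction l generalizing s with
  | nil => simp
  | cons a l ih => rw [List.foldl_cons, ih, List.length_cons, Nat.cast_succ, add_assoc, add_comm 1]

/-! ## Values of the elementary subroutines -/

section Val

variable {n : ℕ} {g : Fin n → Fin n → Bool} {wt : Fin n → ℕ∞}

attribute [simp] Tm.val

@[simp] theorem val_imp (s t : Tm (Ty.den n) .bool) :
    @Eq Bool ((imp s t).val g wt) true ↔
      (@Eq Bool (s.val g wt) true → @Eq Bool (t.val g wt) true) := by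
  simp only [imp, Tm.val]
  cases s.val g wt <;> simp

@[simp] theorem val_any (p : Fin n → Tm (Ty.den n) .bool) :
    @Eq Bool ((any p).val g wt) true ↔ ∃ x, @Eq Bool ((p x).val g wt) true := by
  simp [any, foldl_or_eq_true]

@[simp] theorem val_all (p : Fin n → Tm (Ty.den n) .bool) :
    @Eq Bool ((all p).val g wt) true ↔ ∀ x, @Eq Bool ((p x).val g wt) true := by
  simp [all, foldl_and_eq_true]

@[simp] theorem val_mem (A : Fin n → Bool) (x : Fin n) :
    (mem (rep := Ty.den n) A x).val g wt = A x := by simp [mem]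

@[simp] theorem val_entry (M : Fin n → Fin n → Bool) (x y : Fin n) :
    (entry (rep := Ty.den n) M x y).val g wt = M x y := by simp [entry]

@[simp] theorem val_nb (x y : Fin n) : (nb (rep := Ty.den n) x y).val g wt = g x y := by
  simp [nb]

@[simp] theorem val_clnb (x y : Fin n) :
    (clnb (rep := Ty.den n) x y).val g wt = (decide (x = y) || g x y) := rfl

@[simp] theorem val_insertVert (D : Fin n → Bool) (x : Fin n) :
    (insertVert (rep := Ty.den n) D x).val g wt = fun y => D y || decide (y = x) := rfl

@[simp] theorem val_eqNum (s t : Tm (Ty.den n) .num) :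
    @Eq Bool ((eqNum s t).val g wt) true ↔ @Eq ℕ∞ (s.val g wt) (t.val g wt) := by
  simp only [eqNum, Tm.val, Bool.and_eq_true]
  exact (and_congr decide_eq_true_iff decide_eq_true_iff).trans
    (le_antisymm_iff (α := ℕ∞)).symm

@[simp] theorem val_isFinite (t : Tm (Ty.den n) .num) :
    @Eq Bool ((isFinite t).val g wt) true ↔ t.val g wt ≠ (⊤ : ℕ∞) := by
  simp [isFinite]

theorem val_count (p : Fin n → Tm (Ty.den n) .bool) :
    (count p).val g wt = ((Finset.univ.filter fun x => @Eq Bool ((p x).val g wt) true).card : ℕ∞) := by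
  simp only [count, Tm.val]
  rw [foldl_ite_add, zero_add, ← Fin.sum_univ_def, Finset.sum_boole]

theorem val_find_eq_none (p : Fin n → Tm (Ty.den n) .bool) :
    (find p).val g wt = none ↔ ∀ x, ¬ @Eq Bool ((p x).val g wt) true := by
  have key : ∀ (l : List (Fin n)) (s : Option (Fin n)),
      l.foldl (fun s x => if (p x).val g wt = true then some x else s) s = none ↔
        s = none ∧ ∀ x ∈ l, (p x).val g wt ≠ true := by
    intro l
    induction l with
    | nil => simp
    | cons a l ih =>
      intro s
      rw [List.foldl_cons, ih]
      by_cases h : (p a).val g wt = true <;> simp [h]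
  simpa [find] using key (List.finRange n) none

theorem val_find_of_eq_some {p : Fin n → Tm (Ty.den n) .bool} {b : Fin n}
    (h : (find p).val g wt = some b) :
    @Eq Bool ((p b).val g wt) true := by
  have key : ∀ b, (find p).val g wt = some b → (p b).val g wt = true := by
    refine foldl_preserves (P := fun s : Option (Fin n) => ∀ b, s = some b → (p b).val g wt = true)
      (List.finRange n) ?_ ?_
    · intro s a _ hs b hb
      simp only [Tm.val] at hb
      split_ifs at hb with ha
      · simp only [Option.some.injEq] at hb
        exact hb ▸ ha
      · exact hs b hb
    · simp
  exact key b h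

/-- The total weight of a vertex set given by its characteristic function. -/
def weight (w : Fin n → ℕ∞) (D : Fin n → Bool) : ℕ∞ := ∑ x, if D x = true then w x else 0

theorem val_weightOf (w : Fin n → ℕ∞) (D : Fin n → Bool) :
    (weightOf (rep := Ty.den n) w D).val g wt = weight w D := by
  simp only [weightOf, Tm.val, val_mem]
  rw [foldl_ite_add, zero_add, ← Fin.sum_univ_def, weight]

theorem setWeight_filter (w : Fin n → ℕ∞) (D : Fin n → Bool) :
    setWeight w (Finset.univ.filter fun x => D x = true) = weight w D := by
  rw [setWeight, Finset.sum_filter, weight]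

theorem weight_eq_of_eqOn {w w' : Fin n → ℕ∞} {D : Fin n → Bool}
    (h : ∀ x, D x = true → w x = w' x) : weight w D = weight w' D :=
  Finset.sum_congr rfl fun x _ => by by_cases hx : D x = true <;> simp [hx, h]

theorem weight_ne_top {w : Fin n → ℕ∞} {D : Fin n → Bool} :
    weight w D ≠ ⊤ ↔ ∀ x, D x = true → w x ≠ ⊤ := by
  rw [weight, ne_eq, show (⊤ : ℕ∞) = (⊤ : WithTop ℕ) from rfl]
  erw [WithTop.sum_eq_top]
  simp only [Finset.mem_univ, true_and, not_exists]
  refine forall_congr' fun x => ?_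
  by_cases hx : D x = true
  · simp only [hx, if_true, forall_const]
    exact Iff.rfl
  · simp only [hx, if_false, false_imp_iff, iff_true, Bool.false_eq_true]
    exact WithTop.zero_ne_top

theorem weight_insert (w : Fin n → ℕ∞) (D : Fin n → Bool) {v : Fin n} (hv : D v = false) :
    weight w (fun y => D y || decide (y = v)) = w v + weight w D := by
  unfold weight
  rw [← Finset.add_sum_erase _ _ (Finset.mem_univ v),
    ← Finset.add_sum_erase Finset.univ (fun x => if D x = true then w x else 0)
      (Finset.mem_univ v)]
  simp only [hv, decide_true, Bool.or_true, if_true, Bool.false_eq_true, if_false, zero_add]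
  congr 1
  refine Finset.sum_congr rfl fun x hx => ?_
  simp [Finset.ne_of_mem_erase hx]

end Val

/-! ## Connected components -/

section Graph

variable {n : ℕ} (G : SimpleGraph (Fin n))

/-- `x` and `y` lie in the same component of `G[A]`. -/
def Conn (A : Fin n → Bool) (x y : Fin n) : Prop :=
  A x = true ∧ A y = true ∧
    Relation.ReflTransGen (fun a b => A a = true ∧ A b = true ∧ G.Adj a b) x y

variable {G} {A : Fin n → Bool} {x y z : Fin n}

theorem Conn.left (h : Conn G A x y) : A x = true := h.1

theorem Conn.right (h : Conn G A x y) : A y = true := h.2.1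

theorem Conn.refl (h : A x = true) : Conn G A x x := ⟨h, h, .refl⟩

theorem Conn.of_adj (hx : A x = true) (hy : A y = true) (h : G.Adj x y) : Conn G A x y :=
  ⟨hx, hy, .single ⟨hx, hy, h⟩⟩

theorem Conn.trans (h : Conn G A x y) (h' : Conn G A y z) : Conn G A x z :=
  ⟨h.1, h'.2.1, h.2.2.trans h'.2.2⟩

theorem Conn.symm (h : Conn G A x y) : Conn G A y x := by
  refine ⟨h.2.1, h.1, ?_⟩
  have hr := h.2.2
  induction hr with
  | refl => exact .refl
  | @tail a b _ hab ih =>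
    exact .head ⟨hab.2.1, hab.1, hab.2.2.symm⟩ (ih ⟨h.1, hab.1, ‹_›⟩)

/-- Induction along the edges of a component. -/
theorem Conn.induction {P : Fin n → Prop} (h : Conn G A x y) (hx : P x)
    (step : ∀ a b, Conn G A x a → Conn G A x b → G.Adj a b → P a → P b) : P y := by
  obtain ⟨hAx, hAy, hr⟩ := h
  induction hr with
  | refl => exact hx
  | @tail a b hxa hab ih =>
    have hca : Conn G A x a := ⟨hAx, hab.1, hxa⟩
    exact step a b hca (hca.trans (.of_adj hab.1 hab.2.1 hab.2.2)) hab.2.2 (ih hab.1)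

/-- Used both for an edge distinguished by a vertex and for the edge by which a walk leaves a
component of a smaller set. -/
theorem Conn.exists_edge {P : Fin n → Prop} (h : Conn G A x y) (hx : P x) (hy : ¬ P y) :
    ∃ a b, Conn G A x a ∧ Conn G A x b ∧ G.Adj a b ∧ P a ∧ ¬ P b := by
  by_contra hc
  push Not at hc
  exact hy (h.induction hx fun a b ha hb hab hPa => hc a b ha hb hab hPa)

/-- `A'` only has to contain the component of `x`, so this also covers components that survive a
deletion untouched. -/
theorem Conn.mono {A' : Fin n → Bool} (h : Conn G A x y)
    (hA : ∀ z, Conn G A x z → A' z = true) : Conn G A' x y :=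
  h.induction (P := fun y => Conn G A' x y) (.refl (hA x (.refl h.1)))
    fun a b ha hb hab ih => ih.trans (.of_adj (hA a ha) (hA b hb) hab)

/-- Every component of `G[A]` is a clique. -/
def CliqueComps (G : SimpleGraph (Fin n)) (A : Fin n → Bool) : Prop :=
  ∀ x y, Conn G A x y → x = y ∨ G.Adj x y

variable {wt : Fin n → ℕ∞}

@[simp] theorem adjMat_eq_true [DecidableRel G.Adj] {x y : Fin n} : adjMat G x y = true ↔ G.Adj x y := by
  simp [adjMat]

/-- Warshall's algorithm. The invariant is that the relation is closed under composition through
every pivot processed so far, contains the initial relation and stays inside `Conn`. At the end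
every vertex has been a pivot. -/
theorem val_components [DecidableRel G.Adj] (A : Fin n → Bool) (x y : Fin n) :
    @Eq Bool ((components (rep := Ty.den n) A).val (adjMat G) wt x y) true ↔ Conn G A x y := by
  set base : Fin n → Fin n → Bool :=
    fun x y => A x && (A y && (decide (x = y) || adjMat G x y)) with hbase
  set step : (Fin n → Fin n → Bool) → Fin n → (Fin n → Fin n → Bool) :=
    fun R k x y => R x y || (R x k && R k y) with hstep
  have hval : (components (rep := Ty.den n) A).val (adjMat G) wt =
      (List.finRange n).foldl step base := by
    simp [components, hbase, hstep]
  have key : ∀ (l : List (Fin n)) (S : Fin n → Prop) (R : Fin n → Fin n → Bool),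
      (∀ k, S k → ∀ x y, R x k = true → R k y = true → R x y = true) →
      (∀ x y, base x y = true → R x y = true) → (∀ x y, R x y = true → Conn G A x y) →
      (∀ k, (S k ∨ k ∈ l) → ∀ x y, l.foldl step R x k = true → l.foldl step R k y = true →
        l.foldl step R x y = true) ∧
      (∀ x y, base x y = true → l.foldl step R x y = true) ∧
      (∀ x y, l.foldl step R x y = true → Conn G A x y) := by
    intro l
    induction l with
    | nil => intro S R h₁ h₂ h₃; simpa using ⟨h₁, h₂, h₃⟩
    | cons a l ih =>
      intro S R h₁ h₂ h₃
      have := ih (fun k => S k ∨ k = a) (step R a) ?_ ?_ ?_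
      · refine ⟨fun k hk => this.1 k ?_, this.2⟩
        simpa [or_assoc] using hk
      · rintro k hk x y
        simp only [hstep, Bool.or_eq_true, Bool.and_eq_true]
        rcases hk with hk | rfl
        · have := h₁ k hk
          rintro (h | ⟨h, h'⟩) (h'' | ⟨h'', h'''⟩)
          · exact .inl (this _ _ h h'')
          · exact .inr ⟨this _ _ h h'', h'''⟩
          · exact .inr ⟨h, this _ _ h' h''⟩
          · exact .inr ⟨h, h'''⟩
        -- For the new pivot itself, being related to it after the step already means being related
        -- to it before.
        · rintro (h | ⟨h, h'⟩) (h'' | ⟨h'', h'''⟩) <;> exact .inr ⟨by assumption, by assumption⟩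
      · intro x y h
        simp [hstep, h₂ x y h]
      · intro x y h
        simp only [hstep, Bool.or_eq_true, Bool.and_eq_true] at h
        rcases h with h | ⟨h, h'⟩
        · exact h₃ x y h
        · exact (h₃ _ _ h).trans (h₃ _ _ h')
  obtain ⟨h₁, h₂, h₃⟩ := key (List.finRange n) (fun _ => False) base (by simp) (fun _ _ h => h) (by
    intro x y h
    simp only [hbase, Bool.and_eq_true, Bool.or_eq_true, decide_eq_true_eq, adjMat_eq_true] at h
    obtain ⟨hx, hy, rfl | hxy⟩ := h
    · exact .refl hx
    · exact .of_adj hx hy hxy)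
  rw [hval]
  refine ⟨h₃ x y, fun h => ?_⟩
  refine h.induction (P := fun y => (List.finRange n).foldl step base x y = true) ?_ ?_
  · exact h₂ _ _ (by simp [hbase, h.left])
  · intro a b ha hb hab ih
    exact h₁ a (by simp) _ _ ih (h₂ _ _ (by simp [hbase, ha.right, hb.right, hab]))

/-- `u` is adjacent to all other vertices of its component in `G[A]`. -/
def IsUniversal (G : SimpleGraph (Fin n)) (A : Fin n → Bool) (u : Fin n) : Prop :=
  A u = true ∧ ∀ y, Conn G A u y → y = u ∨ G.Adj y u

theorem val_universalVerts [DecidableRel G.Adj] {C : Fin n → Fin n → Bool}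
    (hC : ∀ x y, C x y = true ↔ Conn G A x y) (u : Fin n) :
    @Eq Bool ((universalVerts (rep := Ty.den n) A C).val (adjMat G) wt u) true ↔ IsUniversal G A u := by
  simp [universalVerts, IsUniversal, hC]

theorem val_cliqueComponents [DecidableRel G.Adj] {C : Fin n → Fin n → Bool}
    (hC : ∀ x y, C x y = true ↔ Conn G A x y) (a : Fin n) :
    @Eq Bool ((cliqueComponents (rep := Ty.den n) A C).val (adjMat G) wt a) true ↔
      A a = true ∧ ∀ x y, Conn G A a x → Conn G A a y → x = y ∨ G.Adj x y := by
  simp [cliqueComponents, hC]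

/-! ## Representatives -/

section Representatives

variable {g : Fin n → Fin n → Bool} {P : Fin n → Bool} {C : Fin n → Fin n → Bool}

/-- New representatives are put in front, and each is tested against the older ones behind it; this
gives the orientation `C b a` in the pairwise condition. -/
theorem val_representatives_spec (hC : ∀ x, P x = true → C x x = true) :
    (∀ r ∈ (representatives (rep := Ty.den n) P C).val g wt, P r = true) ∧
    ((representatives (rep := Ty.den n) P C).val g wt).Pairwise (fun a b => C b a = false) ∧
    (∀ x, P x = true → ∃ r ∈ (representatives (rep := Ty.den n) P C).val g wt, C r x = true) := by
  have key : ∀ (l : List (Fin n)) (s : List (Fin n)),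
      (∀ r ∈ s, P r = true) → s.Pairwise (fun a b => C b a = false) →
      let t := l.foldl (fun (s : List (Fin n)) x =>
        if (P x && !(s.foldl (fun t r => t || C r x) false)) = true then x :: s else s) s
      (∀ r ∈ t, P r = true) ∧ t.Pairwise (fun a b => C b a = false) ∧ (∀ r ∈ s, r ∈ t) ∧
        ∀ x ∈ l, P x = true → ∃ r ∈ t, C r x = true := by
    intro l
    induction l with
    | nil => intro s h₁ h₂; simpa using ⟨h₁, h₂⟩
    | cons a l ih =>
      intro s h₁ h₂
      simp only [List.foldl_cons]
      split_ifs with hif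
      · rw [Bool.and_eq_true, Bool.not_eq_true', ← Bool.not_eq_true, foldl_or_eq_true] at hif
        obtain ⟨hPa, hr⟩ := hif
        push Not at hr
        have hr' : ∀ r ∈ s, C r a = false := by simpa using hr.2
        obtain ⟨i₁, i₂, i₃, i₄⟩ := ih (a :: s) (by simpa [hPa] using h₁)
          (List.pairwise_cons.2 ⟨hr', h₂⟩)
        refine ⟨i₁, i₂, fun r hr => i₃ r (List.mem_cons_of_mem _ hr), fun x hx hPx => ?_⟩
        rcases List.mem_cons.1 hx with rfl | hx
        · exact ⟨x, i₃ x List.mem_cons_self, hC x hPx⟩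
        · exact i₄ x hx hPx
      · obtain ⟨i₁, i₂, i₃, i₄⟩ := ih s h₁ h₂
        refine ⟨i₁, i₂, i₃, fun x hx hPx => ?_⟩
        rcases List.mem_cons.1 hx with rfl | hx
        · rw [Bool.and_eq_true, Bool.not_eq_true', ← Bool.not_eq_true, foldl_or_eq_true] at hif
          by_contra hcon
          push Not at hcon
          refine hif ⟨hPx, ?_⟩
          rintro (h | ⟨r, hr, h⟩)
          · cases h
          · exact hcon r (i₃ r hr) h
        · exact i₄ x hx hPx
  obtain ⟨h₁, h₂, -, h₄⟩ := key (List.finRange n) [] (by simp) List.Pairwise.nil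
  have hval : (representatives (rep := Ty.den n) P C).val g wt =
      (List.finRange n).foldl (fun (s : List (Fin n)) x =>
        if (P x && !(s.foldl (fun t r => t || C r x) false)) = true then x :: s else s) [] := by
    simp [representatives]
  rw [hval]
  exact ⟨h₁, h₂, fun x hx => h₄ x (List.mem_finRange x) hx⟩

/-- Turns the length of a list of representatives into a statement about components; it decides `→`
and later bounds the number of distinguished components. -/
theorem three_le_length_representatives
    (hC : ∀ x y, C x y = true ↔ Conn G A x y) (hP : ∀ x, P x = true → A x = true) :
    3 ≤ ((representatives (rep := Ty.den n) P C).val g wt).length ↔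
      ∃ x y z, P x = true ∧ P y = true ∧ P z = true ∧
        ¬ Conn G A x y ∧ ¬ Conn G A x z ∧ ¬ Conn G A y z := by
  obtain ⟨h₁, h₂, h₃⟩ := val_representatives_spec (P := P) (C := C) (g := g) (wt := wt)
    fun x hx => (hC x x).2 (.refl (hP x hx))
  generalize (representatives (rep := Ty.den n) P C).val g wt = l at h₁ h₂ h₃ ⊢
  constructor
  · intro hl
    obtain _ | ⟨x, _ | ⟨y, _ | ⟨z, l⟩⟩⟩ := l
    · simp at hl
    · simp at hl
    · simp at hl
    · simp only [List.pairwise_cons, List.mem_cons, forall_eq_or_imp] at h₁ h₂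
      refine ⟨x, y, z, h₁.1, h₁.2.1, h₁.2.2.1, ?_, ?_, ?_⟩ <;> intro h
      · simp [(hC _ _).2 h.symm] at h₂
      · simp [(hC _ _).2 h.symm] at h₂
      · simp [(hC _ _).2 h.symm] at h₂
  · rintro ⟨x, y, z, hx, hy, hz, hxy, hxz, hyz⟩
    obtain ⟨r, hr, hrx⟩ := h₃ x hx
    obtain ⟨s, hs, hsy⟩ := h₃ y hy
    obtain ⟨t, ht, htz⟩ := h₃ z hz
    rw [hC] at hrx hsy htz
    have hrs : r ≠ s := fun e => hxy ((e ▸ hrx.symm).trans hsy)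
    have hrt : r ≠ t := fun e => hxz ((e ▸ hrx.symm).trans htz)
    have hst : s ≠ t := fun e => hyz ((e ▸ hsy.symm).trans htz)
    calc 3 = ({r, s, t} : Finset (Fin n)).card := by
          rw [Finset.card_eq_three.2 ⟨r, s, t, hrs, hrt, hst, rfl⟩]
      _ ≤ l.toFinset.card := Finset.card_le_card (by
          intro u hu
          simp only [Finset.mem_insert, Finset.mem_singleton] at hu
          rcases hu with rfl | rfl | rfl <;> simpa)
      _ ≤ l.length := l.toFinset_card_le

end Representatives

/-! ## Testing and improving solutions -/

/-- `D ⊆ S` is an e.d. of `G[S]`. -/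
def IsEDOn (G : SimpleGraph (Fin n)) (S D : Fin n → Bool) : Prop :=
  (∀ d, D d = true → S d = true) ∧
    ∀ x, S x = true → ∃! d, D d = true ∧ (d = x ∨ G.Adj d x)

theorem val_isED [DecidableRel G.Adj] (S D : Fin n → Bool) :
    @Eq Bool ((isED (rep := Ty.den n) S D).val (adjMat G) wt) true ↔ IsEDOn G S D := by
  simp only [isED, Tm.val, Bool.and_eq_true, val_all, val_imp, val_mem, val_eqNum, val_count,
    IsEDOn, val_clnb, Bool.or_eq_true, decide_eq_true_eq, adjMat_eq_true]
  refine and_congr_right fun _ => forall_congr' fun x => imp_congr_right fun _ => ?_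
  rw [Nat.cast_eq_one, Finset.card_eq_one]
  simp only [ExistsUnique, Finset.ext_iff, Finset.mem_filter, Finset.mem_univ, true_and,
    Finset.mem_singleton]
  exact exists_congr fun d => ⟨fun h => ⟨(h d).2 rfl, fun y hy => (h y).1 hy⟩,
    fun h y => ⟨h.2 y, fun e => e ▸ h.1⟩⟩

theorem isEDOn_univ {V D : Fin n → Bool} (hV : ∀ x, V x = true) :
    IsEDOn G V D ↔ IsEfficientDominating G (Finset.univ.filter fun x => D x = true) := by
  simp [IsEDOn, IsEfficientDominating, hV]

/-- The optional pair `best` is a correctly stored e.d. of `G[S]` of finite weight. -/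
def IsStored (G : SimpleGraph (Fin n)) (S : Fin n → Bool) (w : Fin n → ℕ∞)
    (best : Option (ℕ∞ × (Fin n → Bool))) : Prop :=
  ∀ p, best = some p → p.1 = weight w p.2 ∧ IsEDOn G S p.2 ∧ p.1 ≠ ⊤

/-- A set of weight at most `c` is stored in `best`. -/
def StoresLE (best : Option (ℕ∞ × (Fin n → Bool))) (c : ℕ∞) : Prop :=
  ∃ p, best = some p ∧ p.1 ≤ c

variable {S D : Fin n → Bool} {w : Fin n → ℕ∞} {best : Option (ℕ∞ × (Fin n → Bool))} {c : ℕ∞}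

theorem IsStored.improve [DecidableRel G.Adj] (h : IsStored G S w best) :
    IsStored G S w ((improve (rep := Ty.den n) S w D best).val (adjMat G) wt) := by
  intro p hp
  simp only [WED.improve, Tm.val, val_weightOf] at hp
  split_ifs at hp with h₁ h₂
  · cases best with
    | none =>
      simp only [Option.elim, Option.some.injEq] at hp
      subst hp
      exact ⟨rfl, (val_isED S D).1 h₁, (val_isFinite _).1 h₂⟩
    | some q =>
      simp only [Option.elim] at hp
      split_ifs at hp
      · exact h p hp
      · simp only [Option.some.injEq] at hp
        subst hp
        exact ⟨rfl, (val_isED S D).1 h₁, (val_isFinite _).1 h₂⟩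
  · exact h p hp
  · exact h p hp

/-- The stored weight never increases, so a good set found once is never lost in the remaining
iterations. -/
theorem StoresLE.improve [DecidableRel G.Adj] (h : StoresLE best c) :
    StoresLE ((improve (rep := Ty.den n) S w D best).val (adjMat G) wt) c := by
  obtain ⟨q, rfl, hq⟩ := h
  simp only [WED.improve, Tm.val, val_isED, val_weightOf, val_isFinite, Option.elim]
  split_ifs with h₁ h₂ h₃
  · exact ⟨q, rfl, hq⟩
  · refine ⟨_, rfl, le_trans ?_ hq⟩
    simp only [decide_eq_true_eq, not_le] at h₃
    exact h₃.le
  · exact ⟨q, rfl, hq⟩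
  · exact ⟨q, rfl, hq⟩

theorem storesLE_improve [DecidableRel G.Adj] (hD : IsEDOn G S D) (hw : weight w D ≠ ⊤) :
    StoresLE ((improve (rep := Ty.den n) S w D best).val (adjMat G) wt) (weight w D) := by
  simp only [WED.improve, Tm.val, val_isED, val_weightOf, val_isFinite, hD, hw, if_true, ne_eq,
    not_false_eq_true]
  cases best with
  | none => exact ⟨_, rfl, le_rfl⟩
  | some q =>
    simp only [Option.elim]
    split_ifs with h₃
    · exact ⟨q, rfl, by simpa using h₃⟩
    · exact ⟨_, rfl, le_rfl⟩

end Graph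

end

section

variable {n : ℕ} {G : SimpleGraph (Fin n)} {A B D : Fin n → Bool} {w : Fin n → ℕ∞}

/-! ## Solutions of partitioned instances -/

/-- `D ⊆ A` is an e.d. of `G[A ∪ B]` of finite weight. -/
structure IsSol (G : SimpleGraph (Fin n)) (A B : Fin n → Bool) (w : Fin n → ℕ∞)
    (D : Fin n → Bool) : Prop where
  sub : ∀ d, D d = true → A d = true
  dom : ∀ x, A x = true ∨ B x = true → ∃ d, D d = true ∧ (d = x ∨ G.Adj d x)
  uniq : ∀ x, A x = true ∨ B x = true → ∀ d e, D d = true → D e = true →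
    (d = x ∨ G.Adj d x) → (e = x ∨ G.Adj e x) → d = e
  fin : ∀ d, D d = true → w d ≠ ⊤

/-- `b` has a join to the component of `a` in `G[A]`. -/
def Joins (G : SimpleGraph (Fin n)) (A : Fin n → Bool) (b a : Fin n) : Prop :=
  A a = true ∧ ∀ y, Conn G A a y → G.Adj b y

theorem Joins.congr {b a a' : Fin n} (h : Joins G A b a) (h' : Conn G A a a') :
    Joins G A b a' :=
  ⟨h'.right, fun y hy => h.2 y (h'.trans hy)⟩

/-- `I` is the result of join-reduction of `(A, B, w)`. -/
structure JoinReduced (G : SimpleGraph (Fin n)) (A B : Fin n → Bool) (w : Fin n → ℕ∞)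
    (I : (Fin n → Bool) × (Fin n → Bool) × (Fin n → ℕ∞)) : Prop where
  conn : ∀ b a₁ a₂, B b = true → Joins G A b a₁ → Joins G A b a₂ → Conn G A a₁ a₂
  univ : ∀ a b, B b = true → Joins G A b a → ∃ u, Conn G A a u ∧ IsUniversal G A u
  memA : ∀ a, I.1 a = true ↔
    A a = true ∧ (∀ b, B b = true → Joins G A b a → IsUniversal G A a)
  memB : ∀ b, I.2.1 b = true ↔ B b = true ∧ ∀ a, ¬ Joins G A b a
  top : ∀ y b a, A y = true → B b = true → Joins G A b a → ¬ Conn G A a y → G.Adj b y →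
    I.2.2 y = ⊤
  eq : ∀ y, (∀ b a, A y = true → B b = true → Joins G A b a → ¬ Conn G A a y → ¬ G.Adj b y) →
    I.2.2 y = w y

/-! ## Reasoning about values -/

section Spec

variable {g : Fin n → Fin n → Bool} {wt : Fin n → ℕ∞} {σ τ : Ty}

/-- The value computed by `t` has property `Q`. -/
def Spec (g : Fin n → Fin n → Bool) (wt : Fin n → ℕ∞) {τ : Ty} (t : Tm (Ty.den n) τ)
    (Q : Ty.den n τ → Prop) : Prop := Q (t.val g wt)

/-- Only the property `P` of the stored value is kept, so the code that computed it does not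
reappear in the rest of the program. -/
theorem Spec.lett {t : Tm (Ty.den n) σ} {k : Ty.den n σ → Tm (Ty.den n) τ}
    {P : Ty.den n σ → Prop} {Q : Ty.den n τ → Prop} (h : Spec g wt t P)
    (h' : ∀ x, P x → Spec g wt (k x) Q) : Spec g wt (.lett t k) Q :=
  h' _ h

theorem Spec.lett_eq {t : Tm (Ty.den n) σ} {k : Ty.den n σ → Tm (Ty.den n) τ}
    {Q : Ty.den n τ → Prop} (h' : Spec g wt (k (t.val g wt)) Q) : Spec g wt (.lett t k) Q :=
  h'

theorem Spec.ite {c : Tm (Ty.den n) .bool} {s t : Tm (Ty.den n) τ} {Q : Ty.den n τ → Prop}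
    (h : @Eq Bool (c.val g wt) true → Spec g wt s Q)
    (h' : ¬ @Eq Bool (c.val g wt) true → Spec g wt t Q) : Spec g wt (.ite c s t) Q := by
  rw [Spec, Tm.val]
  split_ifs with hc
  · exact h hc
  · exact h' hc

theorem val_ite_pos {c : Tm (Ty.den n) .bool} {s t : Tm (Ty.den n) τ}
    (h : @Eq Bool (c.val g wt) true) : (Tm.ite c s t).val g wt = s.val g wt := by
  rw [Tm.val, if_pos h]

theorem val_ite_neg {c : Tm (Ty.den n) .bool} {s t : Tm (Ty.den n) τ}
    (h : ¬ @Eq Bool (c.val g wt) true) : (Tm.ite c s t).val g wt = t.val g wt := by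
  rw [Tm.val, if_neg h]

theorem Spec.elim {t : Tm (Ty.den n) (.opt σ)} {d : Tm (Ty.den n) τ}
    {k : Ty.den n σ → Tm (Ty.den n) τ} {Q : Ty.den n τ → Prop}
    (h : t.val g wt = none → Spec g wt d Q) (h' : ∀ x, t.val g wt = some x → Spec g wt (k x) Q) :
    Spec g wt (.elim t d k) Q := by
  rw [Spec, Tm.val]
  generalize ht : t.val g wt = v
  rw [ht] at h h'
  cases v with
  | none => exact h rfl
  | some x => exact h' x rfl

end Spec

/-- What the answer of join-reduction means. -/
def JoinReductionAnswer (G : SimpleGraph (Fin n)) (A B : Fin n → Bool) (w : Fin n → ℕ∞) :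
    Option ((Fin n → Bool) × (Fin n → Bool) × (Fin n → ℕ∞)) → Prop
  | none =>
    (∃ b a₁ a₂, B b = true ∧ Joins G A b a₁ ∧ Joins G A b a₂ ∧ ¬ Conn G A a₁ a₂) ∨
      ∃ a b, B b = true ∧ Joins G A b a ∧ ∀ u, Conn G A a u → ¬ IsUniversal G A u
  | some I => JoinReduced G A B w I

section

variable [DecidableRel G.Adj] {wt : Fin n → ℕ∞}

theorem spec_joinReduction (A B : Fin n → Bool) (w : Fin n → ℕ∞) :
    Spec (adjMat G) wt (joinReduction (rep := Ty.den n) A B w)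
      (JoinReductionAnswer G A B w) := by
  refine .lett (P := fun C : Ty.den n .mat => ∀ x y, @Eq Bool (C x y) true ↔ Conn G A x y)
    (val_components A) fun C hC => ?_
  refine .lett (P := fun J : Ty.den n .mat => ∀ b a, @Eq Bool (J b a) true ↔ B b = true ∧ Joins G A b a)
    (by intro b a; simp [Joins, hC]) fun J hJ => ?_
  refine .lett (P := fun S : Ty.den n .set => ∀ b, @Eq Bool (S b) true ↔ ∃ a, B b = true ∧ Joins G A b a)
    (by intro b; simp [hJ]) fun Bj hBj => ?_
  refine .lett (P := fun S : Ty.den n .set => ∀ a, @Eq Bool (S a) true ↔ ∃ b, B b = true ∧ Joins G A b a)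
    (by intro b; simp [hJ]) fun Aj hAj => ?_
  refine .ite (fun h => ?_) fun h₁ => ?_
  · simp only [Tm.val, val_any, val_entry, Bool.and_eq_true, Bool.not_eq_true',
      ← Bool.not_eq_true, hC, hJ] at h
    obtain ⟨b, a₁, a₂, h₁, h₂, h₃⟩ := h
    exact .inl ⟨b, a₁, a₂, h₁.1, h₁.2, h₂.2, h₃⟩
  refine .lett (P := fun U : Ty.den n .set => ∀ u, @Eq Bool (U u) true ↔ IsUniversal G A u)
    (val_universalVerts hC) fun U hU => ?_
  refine .ite (fun h => ?_) fun h₂ => ?_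
  · simp only [Tm.val, val_any, val_entry, val_mem, Bool.and_eq_true, Bool.not_eq_true',
      ← Bool.not_eq_true, hC, hAj, hU] at h
    obtain ⟨a, ⟨b, hb, hJ⟩, h₂⟩ := h
    exact .inr ⟨a, b, hb, hJ, fun u hu hu' => h₂ ⟨u, hu, hu'⟩⟩
  simp only [Tm.val, val_any, val_entry, val_mem, Bool.and_eq_true, Bool.not_eq_true',
      ← Bool.not_eq_true, hC, hJ, hAj, hU] at h₁ h₂
  push Not at h₁ h₂
  refine ⟨fun b a₁ a₂ hb h h' => h₁ b a₁ a₂ ⟨hb, h⟩ ⟨hb, h'⟩, fun a b hb h => h₂ a ⟨b, hb, h⟩,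
    fun a => ?_, fun b => ?_, fun y b a hy hb h h' h'' => ?_, fun y h => ?_⟩
  · simp [hAj, hU]
  · simp only [Tm.val, val_mem, Bool.and_eq_true, Bool.not_eq_true', ← Bool.not_eq_true, hBj]
    push Not
    exact and_congr_right fun hb => ⟨fun h a => h a hb, fun h a _ => h a⟩
  · refine (val_ite_pos ?_ : Tm.val _ _ (Tm.ite (mem A y &ₜ any fun b => any fun a =>
      entry J b a &ₜ ∼ₜ (entry C a y) &ₜ nb b y) (.const ⊤) (.get ♯w ♯y)) = _).trans rfl
    simp only [Tm.val, val_mem, val_any, val_entry, val_nb, Bool.and_eq_true, Bool.not_eq_true',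
      ← Bool.not_eq_true, hJ, hC, adjMat_eq_true]
    exact ⟨hy, b, a, ⟨hb, h⟩, h', h''⟩
  · refine (val_ite_neg ?_ : Tm.val _ _ (Tm.ite (mem A y &ₜ any fun b => any fun a =>
      entry J b a &ₜ ∼ₜ (entry C a y) &ₜ nb b y) (.const ⊤) (.get ♯w ♯y)) = _).trans rfl
    simp only [Tm.val, val_mem, val_any, val_entry, val_nb, Bool.and_eq_true, Bool.not_eq_true',
      ← Bool.not_eq_true, hJ, hC, adjMat_eq_true]
    rintro ⟨hy, b, a, ⟨hb, h'⟩, h'', h₄⟩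
    exact h b a hy hb h' h'' h₄

end

/-! ## Correctness of join-reduction -/

/-- Each component contains the dominator of any of its vertices, and a vertex with a join to two
components would be dominated from both. -/
theorem IsSol.not_two_joins (h : IsSol G A B w D) {b a₁ a₂ : Fin n} (hb : B b = true)
    (h₁ : Joins G A b a₁) (h₂ : Joins G A b a₂) : Conn G A a₁ a₂ := by
  have key : ∀ a, Joins G A b a → ∃ d, D d = true ∧ Conn G A a d := by
    intro a ha
    obtain ⟨d, hd, hda⟩ := h.dom a (.inl ha.1)
    refine ⟨d, hd, ?_⟩
    rcases hda with rfl | hda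
    · exact .refl ha.1
    · exact .of_adj ha.1 (h.sub d hd) hda.symm
  obtain ⟨d, hd, hda⟩ := key a₁ h₁
  obtain ⟨e, he, hea⟩ := key a₂ h₂
  have := h.uniq b (.inr hb) d e hd he (.inr (h₁.2 d hda).symm) (.inr (h₂.2 e hea).symm)
  subst this
  exact hda.trans hea.symm

/-- All members of `D` in a joined component dominate `b`, so there is only one, and it must
dominate the whole component. -/
theorem IsSol.isUniversal_of_joins (h : IsSol G A B w D) {b a d : Fin n} (hb : B b = true)
    (hj : Joins G A b a) (hd : D d = true) (hda : Conn G A a d) : IsUniversal G A d := by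
  refine ⟨hda.right, fun y hy => ?_⟩
  obtain ⟨e, he, hey⟩ := h.dom y (.inl hy.right)
  have hye : Conn G A a e := by
    refine (hda.trans hy).trans ?_
    rcases hey with rfl | hey
    · exact .refl hy.right
    · exact .of_adj hy.right (h.sub e he) hey.symm
  have := h.uniq b (.inr hb) d e hd he (.inr (hj.2 d hda).symm) (.inr (hj.2 e hye).symm)
  subst this
  rcases hey with rfl | hey
  · exact .inl rfl
  · exact .inr hey.symm

theorem IsSol.exists_conn (h : IsSol G A B w D) {a : Fin n} (ha : A a = true) :
    ∃ d, D d = true ∧ (d = a ∨ G.Adj d a) ∧ Conn G A a d := by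
  obtain ⟨d, hd, hda⟩ := h.dom a (.inl ha)
  refine ⟨d, hd, hda, ?_⟩
  rcases hda with rfl | hda
  · exact .refl ha
  · exact .of_adj ha (h.sub d hd) hda.symm

theorem IsSol.of_subset {A' B' : Fin n → Bool} {w' : Fin n → ℕ∞} (h : IsSol G A B w D)
    (hA : ∀ a, A' a = true → A a = true) (hB : ∀ b, B' b = true → B b = true)
    (hD : ∀ d, D d = true → A' d = true) (hw : ∀ d, D d = true → w' d = w d) :
    IsSol G A' B' w' D :=
  ⟨hD, fun x hx => h.dom x (hx.imp (hA x) (hB x)), fun x hx => h.uniq x (hx.imp (hA x) (hB x)),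
    fun d hd => hw d hd ▸ h.fin d hd⟩

variable {I : (Fin n → Bool) × (Fin n → Bool) × (Fin n → ℕ∞)}

theorem JoinReduced.weight_eq_or (hI : JoinReduced G A B w I) (y : Fin n) :
    I.2.2 y = w y ∨ I.2.2 y = ⊤ := by
  by_cases h : ∀ b a, A y = true → B b = true → Joins G A b a → ¬ Conn G A a y → ¬ G.Adj b y
  · exact .inl (hI.eq y h)
  · push Not at h
    obtain ⟨b, a, hy, hb, hj, hc, hby⟩ := h
    exact .inr (hI.top y b a hy hb hj hc hby)

theorem JoinReduced.weight_eq (hI : JoinReduced G A B w I) {y : Fin n} (hy : I.2.2 y ≠ ⊤) :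
    I.2.2 y = w y :=
  (hI.weight_eq_or y).resolve_right hy

/-- No member of `D` is discarded or made infinite: in a joined component it is universal, and
elsewhere a neighbour of `b` would be a second dominator of `b`. -/
theorem JoinReduced.isSol (hI : JoinReduced G A B w I) (h : IsSol G A B w D) :
    IsSol G I.1 I.2.1 I.2.2 D := by
  refine h.of_subset (fun a ha => ((hI.memA a).1 ha).1) (fun b hb => ((hI.memB b).1 hb).1) ?_ ?_
  · intro d hd
    have hAd := h.sub d hd
    exact (hI.memA d).2 ⟨hAd, fun b hb hj => h.isUniversal_of_joins hb hj hd (.refl hAd)⟩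
  · intro d hd
    refine hI.eq d fun b a _ hb hj hc hbd => hc ?_
    obtain ⟨e, he, -, hae⟩ := h.exists_conn hj.1
    rwa [h.uniq b (.inr hb) d e hd he (.inr hbd.symm) (.inr (hj.2 e hae).symm)]

/-- The universal vertices that are kept force exactly one member of `D` in each joined component.
It dominates the discarded vertices there and every deleted `b` with a join to it; the infinite
weights exclude a second dominator of `b`. -/
theorem JoinReduced.isSol_of_isSol (hI : JoinReduced G A B w I)
    (h : IsSol G I.1 I.2.1 I.2.2 D) : IsSol G A B w D := by
  have hsub : ∀ d, D d = true → A d = true := fun d hd => ((hI.memA d).1 (h.sub d hd)).1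
  -- in a joined component, there is exactly one member of `D`, and it is universal
  have key : ∀ a b, B b = true → Joins G A b a →
      ∃ d, D d = true ∧ Conn G A a d ∧ IsUniversal G A d ∧
        ∀ e, D e = true → Conn G A a e → e = d := by
    intro a b hb hj
    obtain ⟨u, hau, hu⟩ := hI.univ a b hb hj
    have huA : I.1 u = true := (hI.memA u).2 ⟨hu.1, fun _ _ _ => hu⟩
    obtain ⟨d, hd, hdu⟩ := h.dom u (.inl huA)
    have hud : Conn G A u d := by
      rcases hdu with rfl | hdu
      · exact .refl hu.1
      · exact .of_adj hu.1 (hsub d hd) hdu.symm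
    refine ⟨d, hd, hau.trans hud,
      ((hI.memA d).1 (h.sub d hd)).2 b hb (hj.congr (hau.trans hud)), fun e he hae => ?_⟩
    -- `u` is universal, so every member of `D` in its component dominates it.
    refine h.uniq u (.inl huA) e d he hd ?_ hdu
    exact hu.2 e (hau.symm.trans hae)
  have hjoin : ∀ x b, B b = true → Joins G A b x → (∃ d, D d = true ∧ (d = x ∨ G.Adj d x)) ∧
      ∀ d e, D d = true → D e = true → (d = x ∨ G.Adj d x) → (e = x ∨ G.Adj e x) → d = e := by
    intro x b hb hj
    obtain ⟨d, hd, hxd, hud, huniq⟩ := key x b hb hj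
    have hconn : ∀ e, D e = true → (e = x ∨ G.Adj e x) → Conn G A x e := by
      rintro e he (rfl | hex)
      · exact .refl hj.1
      · exact .of_adj hj.1 (hsub e he) hex.symm
    refine ⟨⟨d, hd, (hud.2 x hxd.symm).imp Eq.symm SimpleGraph.Adj.symm⟩, fun e e' he he' hex hex' => ?_⟩
    rw [huniq e he (hconn e he hex), huniq e' he' (hconn e' he' hex')]
  have hall : ∀ x, A x = true ∨ B x = true → (∃ d, D d = true ∧ (d = x ∨ G.Adj d x)) ∧
      ∀ d e, D d = true → D e = true → (d = x ∨ G.Adj d x) → (e = x ∨ G.Adj e x) → d = e := by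
    intro x hx
    rcases hx with hx | hx
    · by_cases hj : ∃ b, B b = true ∧ Joins G A b x
      · obtain ⟨b, hb, hj⟩ := hj
        exact hjoin x b hb hj
      · push Not at hj
        have hx' : I.1 x = true := (hI.memA x).2 ⟨hx, fun b hb h => absurd h (hj b hb)⟩
        exact ⟨h.dom x (.inl hx'), h.uniq x (.inl hx')⟩
    · by_cases hj : ∃ a, Joins G A x a
      · obtain ⟨a, hj⟩ := hj
        obtain ⟨d, hd, had, hud, huniq⟩ := key a x hx hj
        have hconn : ∀ e, D e = true → (e = x ∨ G.Adj e x) → e = d := by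
          intro e he hex
          apply huniq e he
          rcases hex with rfl | hex
          · exact .of_adj hj.1 (hsub e he) (hj.2 a (.refl hj.1)).symm
          · by_contra hc
            -- A dominator of the deleted vertex outside the component to which it has a join was
            -- given weight `∞`.
            exact h.fin e he (hI.top e x a (hsub e he) hx hj hc hex.symm)
        exact ⟨⟨d, hd, .inr (hj.2 d had).symm⟩, fun e e' he he' hex hex' => by
          rw [hconn e he hex, hconn e' he' hex']⟩
      · push Not at hj
        have hx' : I.2.1 x = true := (hI.memB x).2 ⟨hx, hj⟩
        exact ⟨h.dom x (.inr hx'), h.uniq x (.inr hx')⟩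
  exact ⟨hsub, fun x hx => (hall x hx).1, fun x hx => (hall x hx).2,
    fun d hd => hI.weight_eq (h.fin d hd) ▸ h.fin d hd⟩

theorem JoinReductionAnswer.exists_of_isSol {r} (hr : JoinReductionAnswer G A B w r)
    (h : IsSol G A B w D) : ∃ I, r = some I ∧ JoinReduced G A B w I := by
  cases r with
  | some I => exact ⟨I, rfl, hr⟩
  | none =>
    exfalso
    rcases hr with ⟨b, a₁, a₂, hb, h₁, h₂, hc⟩ | ⟨a, b, hb, hj, hu⟩
    · exact hc (h.not_two_joins hb h₁ h₂)
    · obtain ⟨d, hd, -, had⟩ := h.exists_conn hj.1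
      exact hu d had (h.isUniversal_of_joins hb hj hd had)

/-- In a clique every vertex is universal, so in the unipolar case join-reduction changes only `B`
and the weights. -/
theorem JoinReduced.fst_eq_of_cliqueComps (hI : JoinReduced G A B w I) (hA : CliqueComps G A) :
    I.1 = A := by
  funext a
  rw [Bool.eq_iff_iff, hI.memA]
  exact ⟨fun h => h.1, fun h => ⟨h, fun _ _ _ => ⟨h, fun y hy =>
    (hA a y hy).imp Eq.symm SimpleGraph.Adj.symm⟩⟩⟩

end

section

variable {n : ℕ} {G : SimpleGraph (Fin n)} {A B D : Fin n → Bool} {w : Fin n → ℕ∞}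

/-! ## Good vertices -/

/-- In the component of `y ∈ N(b') \ N(b)`, the vertex `b'` overtakes `b`. -/
def Overtakes (G : SimpleGraph (Fin n)) (A : Fin n → Bool) (b b' y : Fin n) : Prop :=
  A y = true ∧ ∃ z, Conn G A y z ∧ G.Adj y z ∧ ¬ G.Adj b y ∧ ¬ G.Adj b z ∧ G.Adj b' y ∧
    ¬ G.Adj b' z

/-- `b'` overtakes `b` in three components of `G[A]`. -/
def Arrow (G : SimpleGraph (Fin n)) (A : Fin n → Bool) (b b' : Fin n) : Prop :=
  ∃ x y z, Overtakes G A b b' x ∧ Overtakes G A b b' y ∧ Overtakes G A b b' z ∧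
    ¬ Conn G A x y ∧ ¬ Conn G A x z ∧ ¬ Conn G A y z

/-- Two vertices of `B` overtake each other only in the same component of `G[A]`. -/
def NoMutualOvertaking (G : SimpleGraph (Fin n)) (A B : Fin n → Bool) : Prop :=
  ∀ b b' y y', B b = true → B b' = true → Overtakes G A b b' y → Overtakes G A b' b y' →
    Conn G A y y'

section

variable [DecidableRel G.Adj] {wt : Fin n → ℕ∞}

theorem val_arrow {C : Fin n → Fin n → Bool} (hC : ∀ x y, C x y = true ↔ Conn G A x y)
    (b b' : Fin n) :
    @Eq Bool ((arrow (rep := Ty.den n) A C b b').val (adjMat G) wt) true ↔ Arrow G A b b' := by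
  refine Spec.lett (P := fun P : Ty.den n .set =>
    ∀ y, @Eq Bool (P y) true ↔ Overtakes G A b b' y)
    (Q := fun r : Ty.den n .bool => @Eq Bool r true ↔ Arrow G A b b') (t := .tab _) ?_ fun P hP => ?_
  · intro y
    simp only [Tm.val, val_mem, val_any, val_entry, val_nb, Bool.and_eq_true, Bool.not_eq_true',
      ← Bool.not_eq_true, hC, adjMat_eq_true, Overtakes]
  · rw [Spec, Tm.val, decide_eq_true_iff, Tm.val, Tm.val]
    simp only [Tm.val]
    rw [foldl_length, zero_add]
    have := three_le_length_representatives (g := adjMat G) (wt := wt) (P := P) hC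
      fun x hx => ((hP x).1 hx).1
    simp only [hP] at this
    rw [Arrow, ← this]
    exact Nat.cast_le (α := ℕ∞) (m := 3)

end

/-- A witness for "`b'` overtakes `b`" by means of the member `d` of `D` in the component. -/
def OvertakesAt (G : SimpleGraph (Fin n)) (A D : Fin n → Bool) (b b' y d : Fin n) : Prop :=
  D d = true ∧ Conn G A y d ∧ G.Adj b' y ∧ ¬ G.Adj b y ∧ ¬ G.Adj b d ∧ ¬ G.Adj b' d

/-- In a clique the edge required for overtaking is present between any neighbour and any
non-neighbour. -/
theorem overtakes_of_cliqueComps (hA : CliqueComps G A) {b b' y z : Fin n} (hyz : Conn G A y z)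
    (h₁ : ¬ G.Adj b y) (h₂ : ¬ G.Adj b z) (h₃ : G.Adj b' y) (h₄ : ¬ G.Adj b' z) :
    Overtakes G A b b' y :=
  ⟨hyz.left, z, hyz, (hA y z hyz).resolve_left fun e => h₄ (e ▸ h₃), h₁, h₂, h₃, h₄⟩

theorem IsSol.neighbor_unique (h : IsSol G A B w D) {b d e : Fin n} (hb : B b = true)
    (hd : D d = true) (he : D e = true) (hbd : G.Adj b d) (hbe : G.Adj b e) : d = e :=
  h.uniq b (.inr hb) d e hd he (.inr hbd.symm) (.inr hbe.symm)

theorem IsSol.conn_unique (h : IsSol G A B w D) (hA : CliqueComps G A) {d e : Fin n}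
    (hd : D d = true) (he : D e = true) (hde : Conn G A d e) : d = e :=
  h.uniq e (.inl hde.right) d e hd he (hA d e hde) (.inl rfl)

/-- A component where `b` overtakes `b'` would have to coincide with each of those where `b'`
overtakes `b`, and these are not all the same. -/
theorem Arrow.not_overtakes (hN : NoMutualOvertaking G A B) {b b' : Fin n} (hb : B b = true)
    (hb' : B b' = true) (h : Arrow G A b b') (y : Fin n) : ¬ Overtakes G A b' b y := by
  obtain ⟨x₁, x₂, x₃, h₁, h₂, h₃, h₁₂, -, -⟩ := h
  intro hy
  exact h₁₂ ((hN b b' x₁ y hb hb' h₁ hy).trans (hN b b' x₂ y hb hb' h₂ hy).symm)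

/-- The reason for requiring three components: `b'` has at most one neighbour in `D`, so in two of
the three it misses the member of `D`. There `b` misses it as well, since otherwise `b` would
overtake `b'`. -/
theorem Arrow.exists_overtakesAt (h : IsSol G A B w D) (hA : CliqueComps G A)
    (hN : NoMutualOvertaking G A B) {b b' : Fin n} (hb : B b = true) (hb' : B b' = true)
    (hbb : Arrow G A b b') :
    ∃ x x' d d', ¬ Conn G A x x' ∧ OvertakesAt G A D b b' x d ∧ OvertakesAt G A D b b' x' d' := by
  have hnot := hbb.not_overtakes hN hb hb'
  -- either `x` has a witness, or `b'` is adjacent to the member of `D` in the component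
  have key : ∀ x, Overtakes G A b b' x → ∃ d, D d = true ∧ Conn G A x d ∧
      (OvertakesAt G A D b b' x d ∨ G.Adj b' d) := by
    intro x hx
    obtain ⟨hAx, z, hxz, -, hbx, hbz, hb'x, hb'z⟩ := hx
    obtain ⟨d, hd, -, hxd⟩ := h.exists_conn hAx
    refine ⟨d, hd, hxd, ?_⟩
    by_cases h' : G.Adj b' d
    · exact .inr h'
    · refine .inl ⟨hd, hxd, hb'x, hbx, fun hbd => ?_, h'⟩
      exact hnot d (overtakes_of_cliqueComps hA (hxd.symm.trans hxz) h' hb'z hbd hbz)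
  have bad : ∀ x y d e, D d = true → D e = true → Conn G A x d → Conn G A y e →
      G.Adj b' d → G.Adj b' e → Conn G A x y := by
    intro x y d e hd he hxd hye hbd hbe
    have := h.neighbor_unique hb' hd he hbd hbe
    subst this
    exact hxd.trans hye.symm
  obtain ⟨x₁, x₂, x₃, h₁, h₂, h₃, h₁₂, h₁₃, h₂₃⟩ := hbb
  obtain ⟨d₁, hd₁, hc₁, k₁⟩ := key x₁ h₁
  obtain ⟨d₂, hd₂, hc₂, k₂⟩ := key x₂ h₂
  obtain ⟨d₃, hd₃, hc₃, k₃⟩ := key x₃ h₃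
  rcases k₁ with k₁ | k₁
  · rcases k₂ with k₂ | k₂
    · exact ⟨x₁, x₂, d₁, d₂, h₁₂, k₁, k₂⟩
    · rcases k₃ with k₃ | k₃
      · exact ⟨x₁, x₃, d₁, d₃, h₁₃, k₁, k₃⟩
      · exact absurd (bad _ _ _ _ hd₂ hd₃ hc₂ hc₃ k₂ k₃) h₂₃
  · rcases k₂ with k₂ | k₂
    · rcases k₃ with k₃ | k₃
      · exact ⟨x₂, x₃, d₂, d₃, h₂₃, k₂, k₃⟩
      · exact absurd (bad _ _ _ _ hd₁ hd₃ hc₁ hc₃ k₁ k₃) h₁₃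
    · exact absurd (bad _ _ _ _ hd₁ hd₂ hc₁ hc₂ k₁ k₂) h₁₂

/-- If `b''` misses `d`, the old witness survives, since `b''` must see `y` lest `b'` overtake
`b''`. Otherwise one of the two witnesses for `b' → b''` is used. -/
theorem OvertakesAt.step (h : IsSol G A B w D) (hA : CliqueComps G A)
    (hN : NoMutualOvertaking G A B) {b b' b'' y d : Fin n} (hb : B b = true) (hb' : B b' = true)
    (hb'' : B b'' = true) (hy : OvertakesAt G A D b b' y d) (harr : Arrow G A b' b'') :
    ∃ x e, OvertakesAt G A D b b'' x e := by
  obtain ⟨hd, hyd, hb'y, hby, hbd, hb'd⟩ := hy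
  by_cases hb''d : G.Adj b'' d
  · obtain ⟨x, x', e, e', hxx, hx, hx'⟩ := harr.exists_overtakesAt h hA hN hb' hb''
    -- of the two witnesses, take one in a component without neighbour of `b` in `D`
    have main : ∀ x e, OvertakesAt G A D b' b'' x e → ¬ G.Adj b e →
        ∃ x e, OvertakesAt G A D b b'' x e := by
      rintro x e ⟨he, hxe, hb''x, hb'x, hb'e, hb''e⟩ hbe
      refine ⟨x, e, he, hxe, hb''x, fun hbx => ?_, hbe, hb''e⟩
      -- If `b` saw `x`, it would overtake `b'` there, while `b'` overtakes `b` at `y`. The two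
      -- components would coincide and `d = e`, although `b''` sees `d` and misses `e`.
      have hyx := hN b b' y x hb hb' (overtakes_of_cliqueComps hA hyd hby hbd hb'y hb'd)
        (overtakes_of_cliqueComps hA hxe hb'x hb'e hbx hbe)
      have := h.conn_unique hA hd he ((hyd.symm.trans hyx).trans hxe)
      exact hb''e (this ▸ hb''d)
    -- `b` has only one neighbour in `D`, so it misses the member of `D` in at least one of the two
    -- components.
    by_cases hbe : G.Adj b e
    · refine main x' e' hx' fun hbe' => hxx ?_
      have := h.neighbor_unique hb hx.1 hx'.1 hbe hbe'
      subst this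
      exact hx.2.1.trans hx'.2.1.symm
    · exact main x e hx hbe
  · refine ⟨y, d, hd, hyd, ?_, hby, hbd, hb''d⟩
    by_contra hb''y
    exact harr.not_overtakes hN hb' hb'' y
      (overtakes_of_cliqueComps hA hyd hb''y hb''d hb'y hb'd)

/-- Witnesses pass along chains of arrows, and no vertex has a witness against itself. So the
transitive closure is irreflexive, and finiteness yields a vertex without outgoing arrow. -/
theorem exists_good_vertex (h : IsSol G A B w D) (hA : CliqueComps G A)
    (hN : NoMutualOvertaking G A B) (hB : ∃ b, B b = true) :
    ∃ b, B b = true ∧ ∀ b', B b' = true → b' ≠ b → ¬ Arrow G A b b' := by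
  set R : Fin n → Fin n → Prop := fun b b' => B b = true ∧ B b' = true ∧ Arrow G A b b' with hR
  have key : ∀ b b', Relation.TransGen R b b' → ∃ x e, OvertakesAt G A D b b' x e := by
    intro b b' hbb
    induction hbb with
    | single hbb =>
      obtain ⟨x, -, d, -, -, hx, -⟩ := hbb.2.2.exists_overtakesAt h hA hN hbb.1 hbb.2.1
      exact ⟨x, d, hx⟩
    | @tail c c' hbc hcc ih =>
      obtain ⟨x, e, hx⟩ := ih
      have hb : B b = true := by
        rcases Relation.TransGen.head'_iff.1 hbc with ⟨_, hb, _⟩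
        exact hb.1
      exact hx.step h hA hN hb hcc.1 hcc.2.1 hcc.2.2
  let T : Fin n → Fin n → Prop := fun b b' => Relation.TransGen R b' b
  have hirr : Std.Irrefl T := ⟨fun b hb => by
    obtain ⟨x, e, hx⟩ := key b b hb
    exact hx.2.2.2.1 hx.2.2.1⟩
  have htrans : IsTrans (Fin n) T := ⟨fun a b c hab hbc => Relation.TransGen.trans hbc hab⟩
  have hwf : WellFounded T := Finite.wellFounded_of_trans_of_irrefl T
  obtain ⟨b, hb, hmin⟩ := hwf.has_min {b | B b = true} hB
  exact ⟨b, hb, fun b' hb' _ harr => hmin b' hb' (.single ⟨hb, hb', harr⟩)⟩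

/-! ## Candidates -/

/-- The component of `a` in `G[A]` is distinguished by some vertex of `B`. -/
def IsDistinguished (G : SimpleGraph (Fin n)) (A B : Fin n → Bool) (a : Fin n) : Prop :=
  A a = true ∧ ∃ b, B b = true ∧ (∃ y, Conn G A a y ∧ G.Adj b y) ∧
    ∃ y, Conn G A a y ∧ ¬ G.Adj b y

theorem IsDistinguished.congr {a a' : Fin n} (h : IsDistinguished G A B a)
    (h' : Conn G A a a') : IsDistinguished G A B a' := by
  obtain ⟨-, b, hb, ⟨y, hy, hby⟩, z, hz, hbz⟩ := h
  exact ⟨h'.right, b, hb, ⟨y, h'.symm.trans hy, hby⟩, z, h'.symm.trans hz, hbz⟩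

/-- `E` has exactly one vertex in each component of `G[A]`: that of `D` if the component is
distinguished, and one of minimum weight otherwise. -/
structure IsCandidate (G : SimpleGraph (Fin n)) (A B : Fin n → Bool) (w : Fin n → ℕ∞)
    (D E : Fin n → Bool) : Prop where
  sub : ∀ y, E y = true → A y = true
  uniq : ∀ y z, E y = true → E z = true → Conn G A y z → y = z
  ex : ∀ a, A a = true → ∃ y, E y = true ∧ Conn G A a y
  dist : ∀ y, E y = true → IsDistinguished G A B y → D y = true
  min : ∀ y, E y = true → ¬ IsDistinguished G A B y → ∀ x, Conn G A y x → w y ≤ w x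

theorem foldl_insert_eq_true {α : Type*} (m : α → Fin n) (l : List α) (D : Fin n → Bool)
    (y : Fin n) :
    l.foldl (fun D r y => D y || decide (y = m r)) D y = true ↔
      D y = true ∨ ∃ r ∈ l, y = m r := by
  induction l generalizing D with
  | nil => simp
  | cons a l ih => simp [ih, or_assoc]

theorem foldl_argmin (p : Fin n → Bool) (w : Fin n → ℕ∞) (l : List (Fin n)) (m : Fin n)
    (hm : p m = true) :
    let r := l.foldl (fun m x => if (p x && !decide (w m ≤ w x)) = true then x else m) m
    p r = true ∧ w r ≤ w m ∧ ∀ x ∈ l, p x = true → w r ≤ w x := by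
  induction l generalizing m with
  | nil => simp [hm]
  | cons a l ih =>
    simp only [List.foldl_cons]
    split_ifs with h
    · simp only [Bool.and_eq_true, Bool.not_eq_true', decide_eq_false_iff_not, not_le] at h
      obtain ⟨h₁, h₂, h₃⟩ := ih a h.1
      refine ⟨h₁, h₂.trans h.2.le, fun x hx hpx => ?_⟩
      rcases List.mem_cons.1 hx with rfl | hx
      · exact h₂
      · exact h₃ x hx hpx
    · obtain ⟨h₁, h₂, h₃⟩ := ih m hm
      refine ⟨h₁, h₂, fun x hx hpx => ?_⟩
      rcases List.mem_cons.1 hx with rfl | hx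
      · simp only [hpx, Bool.true_and, Bool.not_eq_true', decide_eq_false_iff_not,
          not_not] at h
        exact h₂.trans h
      · exact h₃ x hx hpx

section

variable [DecidableRel G.Adj] {wt : Fin n → ℕ∞}

theorem val_distinguished {C : Fin n → Fin n → Bool} (hC : ∀ x y, C x y = true ↔ Conn G A x y)
    (a : Fin n) : @Eq Bool (Tm.val (adjMat G) wt (mem (rep := Ty.den n) A a &ₜ any fun b =>
      mem B b &ₜ (any fun y => entry C a y &ₜ nb b y) &ₜ
        (any fun y => entry C a y &ₜ ∼ₜ (nb b y)))) true ↔ IsDistinguished G A B a := by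
  simp only [Tm.val, val_mem, val_any, val_entry, val_nb, Bool.and_eq_true, Bool.not_eq_true',
    ← Bool.not_eq_true, hC, adjMat_eq_true, IsDistinguished]

/-- Among all combinations of choices is the one that follows `D` in the distinguished components.
-/
theorem spec_candidates (h : IsSol G A B w D) (hA : CliqueComps G A) :
    Spec (adjMat G) wt (candidates (rep := Ty.den n) A B w)
      (fun L => ∃ E ∈ L, IsCandidate G A B w D E) := by
  -- `f a` is a member of `D` in the component of `a`.
  choose! f hfD hfd hfc using fun a (ha : A a = true) => h.exists_conn ha
  refine .lett (P := fun C : Ty.den n .mat => ∀ x y, @Eq Bool (C x y) true ↔ Conn G A x y)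
    (val_components A) fun C hC => ?_
  refine .lett (P := fun S : Ty.den n .set =>
    ∀ a, @Eq Bool (S a) true ↔ IsDistinguished G A B a) (val_distinguished hC) fun C₂ hC₂ => ?_
  refine .lett (P := fun S : Ty.den n .set =>
    ∀ a, @Eq Bool (S a) true ↔ A a = true ∧ ¬ IsDistinguished G A B a)
    (by intro a; simp [← hC₂]) fun C₁ hC₁ => ?_
  obtain ⟨p₁, p₂, p₃⟩ := val_representatives_spec (P := C₁) (C := C) (g := adjMat G) (wt := wt)
    fun x hx => (hC x x).2 (.refl ((hC₁ x).1 hx).1)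
  obtain ⟨q₁, q₂, q₃⟩ := val_representatives_spec (P := C₂) (C := C) (g := adjMat G) (wt := wt)
    fun x hx => (hC x x).2 (.refl ((hC₂ x).1 hx).1)
  set R₁ := (representatives (rep := Ty.den n) C₁ C).val (adjMat G) wt with hR₁
  set R₂ := (representatives (rep := Ty.den n) C₂ C).val (adjMat G) wt with hR₂
  refine .lett (P := fun D₁ : Ty.den n .set => ∃ m : Fin n → Fin n,
    (∀ r ∈ R₁, Conn G A r (m r) ∧ ∀ x, Conn G A r x → w (m r) ≤ w x) ∧
      ∀ y, @Eq Bool (D₁ y) true ↔ ∃ r ∈ R₁, y = m r) ?_ fun D₁ hD₁ => ?_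
  · let m : Fin n → Fin n := fun r => (List.finRange n).foldl
      (fun m x => if (C r x && !decide (w m ≤ w x)) = true then x else m) r
    refine ⟨m, fun r hr => ?_, fun y => ?_⟩
    · have hr' : C r r = true := (hC r r).2 (.refl ((hC₁ r).1 (p₁ r hr)).1)
      obtain ⟨h₁, -, h₃⟩ := foldl_argmin (C r) w (List.finRange n) r hr'
      exact ⟨(hC _ _).1 h₁, fun x hx => h₃ x (List.mem_finRange x) ((hC _ _).2 hx)⟩
    · refine Iff.trans ?_ ((foldl_insert_eq_true m R₁ (fun _ => false) y).trans (by simp))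
      exact Iff.rfl
  obtain ⟨m, hm, hD₁⟩ := hD₁
  -- Invariant of the loop over the distinguished components: if a set is in the list, then so is
  -- its extension by the members of `D` in the components processed.
  have step : ∀ (l : List (Fin n)) (L : List (Fin n → Bool)) (E₀ : Fin n → Bool), E₀ ∈ L →
      (∀ r ∈ l, A r = true) →
      ∃ E ∈ l.foldl (fun (L : List (Fin n → Bool)) r =>
          L.foldl (fun (L₁ : List (Fin n → Bool)) (D : Fin n → Bool) =>
          (List.finRange n).foldl (fun (L₂ : List (Fin n → Bool)) x =>
            if @Eq Bool (Tm.val (adjMat G) wt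
              (entry (rep := Ty.den n) C r x &ₜ isFinite (.get ♯w ♯x))) true then
              (fun y => D y || decide (y = x)) :: L₂ else L₂) L₁) []) L,
        ∀ y, E y = true ↔ E₀ y = true ∨ ∃ r ∈ l, y = f r := by
    intro l
    induction l with
    | nil => intro L E₀ hE₀ _; exact ⟨E₀, hE₀, by simp⟩
    | cons a l ih =>
      intro L E₀ hE₀ hl
      have hAa : A a = true := hl a List.mem_cons_self
      rw [List.foldl_cons]
      refine (ih _ (fun y => E₀ y || decide (y = f a)) ?_
        (fun r hr => hl r (List.mem_cons_of_mem _ hr))).imp fun E hE => ⟨hE.1, fun y => ?_⟩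
      · refine foldl_reaches (P := fun L : List (Fin n → Bool) =>
          (fun y => E₀ y || decide (y = f a)) ∈ L) hE₀ ?_ ?_ []
        · intro s b _ hs
          refine foldl_preserves (P := fun L : List (Fin n → Bool) =>
            (fun y => E₀ y || decide (y = f a)) ∈ L) _ ?_ hs
          intro s b _ hs
          split_ifs
          · exact List.mem_cons_of_mem _ hs
          · exact hs
        · intro s
          refine foldl_reaches (P := fun L : List (Fin n → Bool) =>
            (fun y => E₀ y || decide (y = f a)) ∈ L) (List.mem_finRange (f a)) ?_ ?_ s
          · intro s b _ hs
            split_ifs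
            · exact List.mem_cons_of_mem _ hs
            · exact hs
          · intro s
            rw [if_pos]
            · exact List.mem_cons_self
            · simp only [Tm.val, val_entry, Bool.and_eq_true, val_isFinite, hC]
              exact ⟨hfc a hAa, h.fin _ (hfD a hAa)⟩
      · rw [hE.2]
        simp [or_assoc]
  obtain ⟨E, hE, hEy⟩ := step R₂ [D₁] D₁ (by simp) fun r hr => ((hC₂ r).1 (q₁ r hr)).1
  refine ⟨E, hE, ?_⟩
  -- the members of `E`
  have hE' : ∀ y, E y = true ↔ (∃ r ∈ R₁, y = m r) ∨ ∃ r ∈ R₂, y = f r := fun y => by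
    rw [hEy, hD₁]
  have hR₁' : ∀ r ∈ R₁, A r = true ∧ ¬ IsDistinguished G A B r := fun r hr => (hC₁ r).1 (p₁ r hr)
  have hR₂' : ∀ r ∈ R₂, IsDistinguished G A B r := fun r hr => (hC₂ r).1 (q₁ r hr)
  have huniq₁ : ∀ r ∈ R₁, ∀ s ∈ R₁, Conn G A r s → r = s := by
    intro r hr s hs hrs
    by_contra hne
    have hsymm : R₁.Pairwise (fun a b => ¬ Conn G A a b) := p₂.imp fun {a b} hab hc => by
      simp [(hC _ _).2 hc.symm] at hab
    have : Std.Symm fun a b => ¬ Conn G A a b := ⟨fun _ _ h h' => h h'.symm⟩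
    exact hsymm.forall hr hs hne hrs
  have hone : ∀ y, E y = true → ∃ r, Conn G A r y ∧
      ((r ∈ R₁ ∧ y = m r) ∨ (r ∈ R₂ ∧ y = f r)) := by
    intro y hy
    rcases (hE' y).1 hy with ⟨r, hr, rfl⟩ | ⟨r, hr, rfl⟩
    · exact ⟨r, (hm r hr).1, .inl ⟨hr, rfl⟩⟩
    · exact ⟨r, hfc r (hR₂' r hr).1, .inr ⟨hr, rfl⟩⟩
  refine ⟨fun y hy => ?_, fun y z hy hz hyz => ?_, fun a ha => ?_, fun y hy hd => ?_,
    fun y hy hd x hx => ?_⟩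
  · obtain ⟨r, hr, -⟩ := hone y hy
    exact hr.right
  · obtain ⟨r, hr, ⟨hr₁, rfl⟩ | ⟨hr₂, rfl⟩⟩ := hone y hy
    · obtain ⟨s, hs, ⟨hs₁, rfl⟩ | ⟨hs₂, rfl⟩⟩ := hone z hz
      · rw [huniq₁ r hr₁ s hs₁ ((hr.trans hyz).trans hs.symm)]
      · exact absurd ((hR₂' s hs₂).congr (hs.trans (hyz.symm.trans hr.symm))) (hR₁' r hr₁).2
    · obtain ⟨s, hs, ⟨hs₁, rfl⟩ | ⟨hs₂, rfl⟩⟩ := hone z hz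
      · exact absurd ((hR₂' r hr₂).congr (hr.trans (hyz.trans hs.symm))) (hR₁' s hs₁).2
      · exact h.conn_unique hA (hfD r hr.left) (hfD s hs.left) hyz
  · by_cases hd : IsDistinguished G A B a
    · obtain ⟨r, hr, hra⟩ := q₃ a ((hC₂ a).2 hd)
      rw [hC] at hra
      exact ⟨f r, (hE' _).2 (.inr ⟨r, hr, rfl⟩), hra.symm.trans (hfc r hra.left)⟩
    · obtain ⟨r, hr, hra⟩ := p₃ a ((hC₁ a).2 ⟨ha, hd⟩)
      rw [hC] at hra
      exact ⟨m r, (hE' _).2 (.inl ⟨r, hr, rfl⟩), hra.symm.trans (hm r hr).1⟩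
  · obtain ⟨r, hr, ⟨hr₁, rfl⟩ | ⟨hr₂, rfl⟩⟩ := hone y hy
    · exact absurd (hd.congr hr.symm) (hR₁' r hr₁).2
    · exact hfD r hr.left
  · obtain ⟨r, hr, ⟨hr₁, rfl⟩ | ⟨hr₂, rfl⟩⟩ := hone y hy
    · exact (hm r hr₁).2 x (hr.trans hx)
    · exact absurd ((hR₂' r hr₂).congr hr) hd

end

/-- `E` and `D` are matched componentwise by `f`. Matched vertices have the same neighbours in `B`,
because they are equal or their component is not distinguished, and inside `A` the components are
cliques. -/
theorem IsCandidate.isSol {E : Fin n → Bool} (hE : IsCandidate G A B w D E)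
    (h : IsSol G A B w D) (hA : CliqueComps G A) (hAB : ∀ x, A x = true → ¬ B x = true) :
    IsSol G A B w E ∧ weight w E ≤ weight w D := by
  choose! f hfD hfd hfc using fun a (ha : A a = true) => h.exists_conn ha
  have hle : ∀ y, E y = true → w y ≤ w (f y) := by
    intro y hy
    have hyA := hE.sub y hy
    by_cases hd : IsDistinguished G A B y
    · rw [← h.conn_unique hA (hE.dist y hy hd) (hfD y hyA) (hfc y hyA)]
    · exact hE.min y hy hd _ (hfc y hyA)
  have hB : ∀ x, B x = true → ∀ y, E y = true → (G.Adj y x ↔ G.Adj (f y) x) := by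
    intro x hx y hy
    have hyA := hE.sub y hy
    by_cases hd : IsDistinguished G A B y
    · rw [← h.conn_unique hA (hE.dist y hy hd) (hfD y hyA) (hfc y hyA)]
    · constructor
      · intro hyx
        by_contra hfx
        exact hd ⟨hyA, x, hx, ⟨y, .refl hyA, hyx.symm⟩, f y, hfc y hyA, fun h => hfx h.symm⟩
      · intro hfx
        by_contra hyx
        exact hd ⟨hyA, x, hx, ⟨f y, hfc y hyA, hfx.symm⟩, y, .refl hyA, fun h => hyx h.symm⟩
  have hconn : ∀ x y, A x = true → E y = true → (y = x ∨ G.Adj y x) → Conn G A y x := by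
    rintro x y hx hy (rfl | hyx)
    · exact .refl hx
    · exact .of_adj (hE.sub y hy) hx hyx
  refine ⟨⟨hE.sub, fun x hx => ?_, fun x hx y z hy hz hyx hzx => ?_, fun y hy => ?_⟩, ?_⟩
  · rcases hx with hx | hx
    · obtain ⟨y, hy, hxy⟩ := hE.ex x hx
      exact ⟨y, hy, hA y x hxy.symm⟩
    · obtain ⟨d, hd, hdx⟩ := h.dom x (.inr hx)
      have hdx : G.Adj d x := hdx.resolve_left fun e => hAB d (h.sub d hd) (e ▸ hx)
      obtain ⟨y, hy, hdy⟩ := hE.ex d (h.sub d hd)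
      refine ⟨y, hy, .inr ((hB x hx y hy).2 ?_)⟩
      rwa [← h.conn_unique hA hd (hfD y hdy.right) (hdy.trans (hfc y hdy.right))]
  · rcases hx with hx | hx
    · exact hE.uniq y z hy hz ((hconn x y hx hy hyx).trans (hconn x z hx hz hzx).symm)
    · have hne : ∀ y, E y = true → y ≠ x := fun y hy e => hAB y (hE.sub y hy) (e ▸ hx)
      have hyx := (hB x hx y hy).1 (hyx.resolve_left (hne y hy))
      have hzx := (hB x hx z hz).1 (hzx.resolve_left (hne z hz))
      have hyA := hE.sub y hy
      have hzA := hE.sub z hz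
      have := h.neighbor_unique hx (hfD y hyA) (hfD z hzA) hyx.symm hzx.symm
      exact hE.uniq y z hy hz ((hfc y hyA).trans (this ▸ (hfc z hzA).symm))
  · exact ne_top_of_le_ne_top (h.fin _ (hfD y (hE.sub y hy))) (hle y hy)
  · unfold weight
    rw [← Finset.sum_filter, ← Finset.sum_filter]
    calc ∑ y with E y = true, w y ≤ ∑ y with E y = true, w (f y) :=
          Finset.sum_le_sum fun y hy => hle y (by simpa using hy)
      -- `f` is injective on `E`, which has one vertex in each component, and its image lies in `D`.
      _ = ∑ y ∈ (Finset.univ.filter fun y => E y = true).image f, w y := by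
          rw [Finset.sum_image]
          intro y hy z hz hyz
          simp only [Finset.coe_filter, Finset.mem_univ, true_and, Set.mem_ofPred_eq] at hy hz
          have := hfc y (hE.sub y hy)
          rw [hyz] at this
          exact hE.uniq y z hy hz (this.trans (hfc z (hE.sub z hz)).symm)
      _ ≤ ∑ y with D y = true, w y := by
          refine Finset.sum_le_sum_of_subset fun d hd => ?_
          simp only [Finset.mem_image, Finset.mem_filter, Finset.mem_univ, true_and] at hd ⊢
          obtain ⟨y, hy, rfl⟩ := hd
          exact hfD y (hE.sub y hy)

end

section

variable {n : ℕ} {G : SimpleGraph (Fin n)} {A B D : Fin n → Bool} {w : Fin n → ℕ∞}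

/-! ## The algorithm for unipolar graphs -/

/-! ### Invariants of loops -/

section Loops

variable {g : Fin n → Fin n → Bool} {wt : Fin n → ℕ∞} {σ τ : Ty}

theorem Spec.loop_preserves {i : Tm (Ty.den n) σ} {k : Fin n → Ty.den n σ → Tm (Ty.den n) σ}
    {P : Ty.den n σ → Prop} (hi : Spec g wt i P) (h : ∀ x s, P s → Spec g wt (k x s) P) :
    Spec g wt (.loop i k) P := by
  rw [Spec, Tm.val]
  exact foldl_preserves _ (fun s x _ hs => h x s hs) hi

theorem Spec.loop_reaches {i : Tm (Ty.den n) σ} {k : Fin n → Ty.den n σ → Tm (Ty.den n) σ}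
    {P : Ty.den n σ → Prop} (x₀ : Fin n) (h : ∀ x s, P s → Spec g wt (k x s) P)
    (h' : ∀ s, Spec g wt (k x₀ s) P) : Spec g wt (.loop i k) P := by
  rw [Spec, Tm.val]
  exact foldl_reaches (List.mem_finRange x₀) (fun s x _ hs => h x s hs) h' _

theorem Spec.each_preserves {l : Tm (Ty.den n) (.list τ)} {i : Tm (Ty.den n) σ}
    {k : Ty.den n τ → Ty.den n σ → Tm (Ty.den n) σ} {P : Ty.den n σ → Prop}
    (hi : Spec g wt i P) (h : ∀ x s, x ∈ l.val g wt → P s → Spec g wt (k x s) P) :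
    Spec g wt (.each l i k) P := by
  rw [Spec, Tm.val]
  exact foldl_preserves _ (fun s x hx hs => h x s hx hs) hi

theorem Spec.each_reaches {l : Tm (Ty.den n) (.list τ)} {i : Tm (Ty.den n) σ}
    {k : Ty.den n τ → Ty.den n σ → Tm (Ty.den n) σ} {P : Ty.den n σ → Prop} (x₀ : Ty.den n τ)
    (hx₀ : x₀ ∈ l.val g wt) (h : ∀ x s, P s → Spec g wt (k x s) P)
    (h' : ∀ s, Spec g wt (k x₀ s) P) : Spec g wt (.each l i k) P := by
  rw [Spec, Tm.val]
  exact foldl_reaches hx₀ (fun s x _ hs => h x s hs) h' _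

theorem Spec.and {t : Tm (Ty.den n) σ} {P Q : Ty.den n σ → Prop} (hP : Spec g wt t P)
    (hQ : Spec g wt t Q) : Spec g wt t (fun x => P x ∧ Q x) :=
  ⟨hP, hQ⟩

end Loops

theorem StoresLE.mono {best : Option (ℕ∞ × (Fin n → Bool))} {c c' : ℕ∞} (h : StoresLE best c)
    (hc : c ≤ c') : StoresLE best c' := by
  obtain ⟨p, hp, hpc⟩ := h
  exact ⟨p, hp, hpc.trans hc⟩

theorem IsSol.isEDOn (h : IsSol G A B w D) {S : Fin n → Bool}
    (hS : ∀ x, S x = true ↔ A x = true ∨ B x = true) :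
    IsEDOn G S D ∧ weight w D ≠ ⊤ := by
  refine ⟨⟨fun d hd => (hS d).2 (.inl (h.sub d hd)), fun x hx => ?_⟩, weight_ne_top.2 h.fin⟩
  rw [hS] at hx
  obtain ⟨d, hd, hdx⟩ := h.dom x hx
  exact ⟨d, ⟨hd, hdx⟩, fun e he => h.uniq x hx e d he.1 hd he.2 hdx⟩

/-- The infinite weights on `B` keep an e.d. of finite weight inside `A`. -/
theorem IsEDOn.isSol {S : Fin n → Bool} (h : IsEDOn G S D) (hw : weight w D ≠ ⊤)
    (hS : ∀ x, S x = true ↔ A x = true ∨ B x = true) (hB : ∀ b, B b = true → w b = ⊤) :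
    IsSol G A B w D := by
  rw [weight_ne_top] at hw
  refine ⟨fun d hd => ?_, fun x hx => ?_, fun x hx d e hd he hdx hex => ?_, hw⟩
  · exact ((hS d).1 (h.1 d hd)).resolve_right fun hb => hw d hd (hB d hb)
  · exact (h.2 x ((hS x).2 hx)).exists
  · exact (h.2 x ((hS x).2 hx)).unique ⟨hd, hdx⟩ ⟨he, hex⟩

/-- The instance obtained by fixing the neighbour `a` of `b` in the solution. -/
theorem IsSol.fix_neighbor {A' : Fin n → Bool} (h : IsSol G A B w D) (hA : CliqueComps G A)
    {a b : Fin n} (hb : B b = true) (hba : G.Adj b a) (ha : D a = true)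
    (hA' : ∀ x, A' x = true ↔ x = a ∨ A x = true ∧ ¬ Conn G A a x ∧ ¬ G.Adj b x) :
    IsSol G A' B w D := by
  refine h.of_subset (fun x hx => ?_) (fun _ => id) (fun d hd => ?_) fun _ _ => rfl
  · rcases (hA' x).1 hx with rfl | hx
    · exact h.sub _ ha
    · exact hx.1
  · rw [hA']
    by_cases hda : d = a
    · exact .inl hda
    · refine .inr ⟨h.sub d hd, fun hc => hda (h.conn_unique hA hd ha hc.symm), fun hbd => ?_⟩
      exact hda (h.neighbor_unique hb hd ha hbd hba)

/-- Every component of `G[A]` meets `D` in a vertex that was kept. The member of `E` dominating that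
vertex lies in the same clique and therefore dominates all of it, including the deleted vertices. -/
theorem IsSol.of_fix_neighbor {A' E : Fin n → Bool} (hE : IsSol G A' B w E)
    (h : IsSol G A' B w D) (hD : IsSol G A B w D) (hA : CliqueComps G A)
    (hA' : ∀ x, A' x = true → A x = true) : IsSol G A B w E := by
  have hconn : ∀ x d, A x = true → A d = true → (d = x ∨ G.Adj d x) → Conn G A x d := by
    rintro x d hx hd (rfl | hdx)
    · exact .refl hx
    · exact .of_adj hx hd hdx.symm
  refine ⟨fun d hd => hA' d (hE.sub d hd), fun x hx => ?_, fun x hx y z hy hz hyx hzx => ?_,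
    hE.fin⟩
  · rcases hx with hx | hx
    · obtain ⟨d, hd, -, hxd⟩ := hD.exists_conn hx
      obtain ⟨e, he, hed⟩ := hE.dom d (.inl (h.sub d hd))
      have hde := hconn d e hxd.right (hA' e (hE.sub e he)) hed
      exact ⟨e, he, hA e x (hxd.trans hde).symm⟩
    · exact hE.dom x (.inr hx)
  · rcases hx with hx | hx
    · have hyA := hA' y (hE.sub y hy)
      have hzA := hA' z (hE.sub z hz)
      have hyz := (hconn x y hx hyA hyx).symm.trans (hconn x z hx hzA hzx)
      exact hE.uniq z (.inl (hE.sub z hz)) y z hy hz (hA y z hyz) (.inl rfl)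
    · exact hE.uniq x (.inr hx) y z hy hz hyx hzx

theorem cliqueComps_fix_neighbor {A' : Fin n → Bool} (hA : CliqueComps G A)
    (hA' : ∀ x, A' x = true → A x = true) : CliqueComps G A' := fun x y hxy =>
  hA x y (hxy.mono fun z hz => hA' z hz.right)

variable [DecidableRel G.Adj] {wt : Fin n → ℕ∞}

/-- The loop over the candidate sets finds a solution which is at least as good as `D`. -/
theorem spec_each_candidate {A B D S A₁ B₁ : Fin n → Bool} {w w₁ : Fin n → ℕ∞}
    (hA : CliqueComps G A) (hAB : ∀ x, A x = true → ¬ B x = true) (h : IsSol G A B w D)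
    (hS : ∀ x, S x = true ↔ A₁ x = true ∨ B₁ x = true)
    (hw : ∀ y, w y ≠ ⊤ → w y = w₁ y)
    (hsol : ∀ E, IsSol G A B w E → IsSol G A₁ B₁ w₁ E)
    (i : Tm (Ty.den n) (.opt (.prod .num .set))) :
    Spec (adjMat G) wt (.each (candidates A B w) i fun D best => improve S w₁ D best)
      (fun best => StoresLE best (weight w₁ D)) := by
  obtain ⟨E, hE, hcand⟩ := spec_candidates (wt := wt) h hA
  refine .each_reaches E hE (fun x s hs => hs.improve) fun s => ?_
  obtain ⟨hsolE, hle⟩ := hcand.isSol h hA hAB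
  obtain ⟨h₁, h₂⟩ := (hsol E hsolE).isEDOn hS
  refine (storesLE_improve h₁ h₂).mono ?_
  rwa [weight_eq_of_eqOn fun x hx => hw x (hsolE.fin x hx),
    weight_eq_of_eqOn fun x hx => hw x (h.fin x hx)] at hle

/-- The answer of the algorithm for unipolar graphs: an optimal solution, if there is one. -/
def IsOptimalAnswer (G : SimpleGraph (Fin n)) (A B : Fin n → Bool) (w : Fin n → ℕ∞)
    (r : Option (Fin n → Bool)) : Prop :=
  (∀ E, r = some E → IsSol G A B w E) ∧
    ∀ D, IsSol G A B w D → ∃ E, r = some E ∧ weight w E ≤ weight w D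

/-- Soundness comes from the test against `A₁ ∪ B₁`. For completeness, the loop reaches the
neighbour `a` of the good vertex in `D`, and a failed search for a good vertex shows that there is
no solution. -/
theorem spec_unipolarWED (hA : CliqueComps G A) (hN : NoMutualOvertaking G A B)
    (hAB : ∀ x, A x = true → ¬ B x = true) (hB : ∀ b, B b = true → w b = ⊤) :
    Spec (adjMat G) wt (unipolarWED (rep := Ty.den n) A B w) (IsOptimalAnswer G A B w) := by
  have hjoin := spec_joinReduction (G := G) (wt := wt) A B w
  refine .elim (fun hnone => ?_) fun I hI => ?_
  · rw [Spec, hnone] at hjoin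
    refine ⟨fun E hE => (by cases hE), fun D hD => ?_⟩
    obtain ⟨I, hI, -⟩ := hjoin.exists_of_isSol hD
    cases hI
  rw [Spec, hI] at hjoin
  replace hjoin : JoinReduced G A B w I := hjoin
  refine .lett_eq (.lett_eq (.lett_eq ?_))
  simp only [Tm.val]
  set A₁ := I.1 with hA₁
  set B₁ := I.2.1 with hB₁
  set w₁ := I.2.2 with hw₁
  have hA₁A : A₁ = A := hjoin.fst_eq_of_cliqueComps hA
  have hBsub : ∀ b, B₁ b = true → B b = true := fun b hb => ((hjoin.memB b).1 hb).1
  have hAcl : CliqueComps G A₁ := by rwa [hA₁A]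
  have hN₁ : NoMutualOvertaking G A₁ B₁ := by
    rw [hA₁A]
    exact fun b b' y y' hb hb' => hN b b' y y' (hBsub b hb) (hBsub b' hb')
  have hAB₁ : ∀ x, A₁ x = true → ¬ B₁ x = true := by
    rw [hA₁A]
    exact fun x hx hb => hAB x hx (hBsub x hb)
  have hw₁B : ∀ b, B₁ b = true → w₁ b = ⊤ := fun b hb =>
    (hjoin.weight_eq_or b).elim (fun h => h.trans (hB b (hBsub b hb))) id
  refine .lett (P := fun S : Ty.den n .set =>
    ∀ x, @Eq Bool (S x) true ↔ A₁ x = true ∨ B₁ x = true) (by intro x; simp) fun S hS => ?_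
  refine .lett (P := fun C : Ty.den n .mat => ∀ x y, @Eq Bool (C x y) true ↔ Conn G A₁ x y)
    (val_components A₁) fun C hC => ?_
  refine .lett (P := fun best : Ty.den n (.opt (.prod .num .set)) => IsStored G S w₁ best ∧
    ∀ D, IsSol G A₁ B₁ w₁ D → StoresLE best (weight w₁ D)) ?_ fun best hbest => ?_
  · have hnone : IsStored G S w₁ none := fun p hp => by cases hp
    refine .ite (fun hne => ?_) fun hempty => .and ?_ ?_
    · simp only [val_any, val_mem] at hne
      refine .elim (fun hfind => ?_) fun b hfind => ?_
      · refine ⟨hnone, fun D hD => ?_⟩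
        obtain ⟨b, hb, hgood⟩ := exists_good_vertex hD hAcl hN₁ hne
        rw [val_find_eq_none] at hfind
        refine absurd ?_ (hfind b)
        simp only [Tm.val, val_mem, val_all, val_imp, Bool.and_eq_true, Bool.not_eq_true',
          ← Bool.not_eq_true, val_arrow hC]
        exact ⟨hb, fun b' h => hgood b' h.1 fun e => h.2 (decide_eq_true e)⟩
      · have hb : B₁ b = true := by
          have := val_find_of_eq_some hfind
          simp only [Tm.val, val_mem, Bool.and_eq_true] at this
          exact this.1
        refine .and ?_ ?_
        · refine .loop_preserves hnone fun a s hs => .ite (fun _ => .lett_eq ?_) fun _ => hs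
          exact .elim (fun _ => hs) fun I₃ _ => .lett_eq (.lett_eq (.lett_eq
            (.each_preserves hs fun D s _ hs => hs.improve)))
        · intro D hD
          obtain ⟨a, ha, hab⟩ := hD.dom b (.inr hb)
          have hAa := hD.sub a ha
          have hab : G.Adj b a := (hab.resolve_left fun e => hAB₁ a hAa (e ▸ hb)).symm
          refine Spec.loop_reaches (P := fun best : Ty.den n (.opt (.prod .num .set)) =>
            StoresLE best (weight w₁ D)) a (fun a s hs => ?_) fun s => ?_
          · refine .ite (fun _ => .lett_eq ?_) fun _ => hs
            exact .elim (fun _ => hs) fun I₃ _ => .lett_eq (.lett_eq (.lett_eq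
              (.each_preserves hs fun D s _ hs => hs.improve)))
          · refine .ite (fun _ => ?_) fun hnot => ?_
            · refine .lett (P := fun A₂ : Ty.den n .set => ∀ x, @Eq Bool (A₂ x) true ↔
                x = a ∨ A₁ x = true ∧ ¬ Conn G A₁ a x ∧ ¬ G.Adj b x) ?_ fun A₂ hA₂ => ?_
              · intro x
                simp only [Tm.val, val_mem, val_entry, val_nb, Bool.and_eq_true,
                  Bool.or_eq_true, Bool.not_eq_true', ← Bool.not_eq_true, hC,
                  adjMat_eq_true]
                exact or_congr decide_eq_true_iff Iff.rfl
              have hsub : ∀ x, A₂ x = true → A₁ x = true := fun x hx => by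
                rcases (hA₂ x).1 hx with rfl | hx
                · exact hAa
                · exact hx.1
              have hA₂cl : CliqueComps G A₂ := cliqueComps_fix_neighbor hAcl hsub
              have hD₂ : IsSol G A₂ B₁ w₁ D := hD.fix_neighbor hAcl hb hab ha hA₂
              have hjoin₂ := spec_joinReduction (G := G) (wt := wt) A₂ B₁ w₁
              obtain ⟨I₃, hI₃, hjoin₃⟩ := hjoin₂.exists_of_isSol hD₂
              refine .elim (fun hn => by rw [hI₃] at hn; cases hn) fun I₄ hI₄ => ?_
              rw [hI₃, Option.some.injEq] at hI₄
              subst hI₄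
              refine .lett_eq (.lett_eq (.lett_eq ?_))
              simp only [Tm.val]
              have hfst := hjoin₃.fst_eq_of_cliqueComps hA₂cl
              -- The candidates come from the twice reduced instance but are tested in the graph
              -- after the first reduction. So both the second join-reduction and the fixing of `a`
              -- have to be undone.
              refine spec_each_candidate (by rwa [hfst]) ?_ (hjoin₃.isSol hD₂) hS
                (fun y hy => hjoin₃.weight_eq hy)
                (fun E hE => (hjoin₃.isSol_of_isSol hE).of_fix_neighbor hD₂ hD hAcl hsub) _
              rw [hfst]
              exact fun x hx hb => hAB₁ x (hsub x hx) ((hjoin₃.memB x).1 hb).1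
            · refine absurd ?_ hnot
              simp only [Tm.val, val_mem, val_nb, Bool.and_eq_true, val_isFinite,
                adjMat_eq_true]
              exact ⟨hAa, hab, hD.fin a ha⟩
    · exact .each_preserves hnone fun D s _ hs => hs.improve
    · exact fun D hD => spec_each_candidate hAcl hAB₁ hD hS (fun _ _ => rfl) (fun _ h => h) _
  · obtain ⟨hst, hle⟩ := hbest
    refine ⟨fun E hE => ?_, fun D hD => ?_⟩
    · rw [Tm.val] at hE
      cases best with
      | none => cases hE
      | some p =>
        obtain ⟨h₁, h₂, h₃⟩ := hst p rfl
        have : p.2 = E := by simpa using hE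
        subst this
        exact hjoin.isSol_of_isSol (h₂.isSol (h₁ ▸ h₃) hS hw₁B)
    · have hD₁ := hjoin.isSol hD
      obtain ⟨p, hp, hpD⟩ := hle D hD₁
      subst hp
      refine ⟨p.2, rfl, ?_⟩
      obtain ⟨h₁, h₂, h₃⟩ := hst p rfl
      rw [h₁] at hpD h₃
      rw [weight_ne_top] at h₃
      rwa [weight_eq_of_eqOn fun x hx => hjoin.weight_eq (h₃ x hx),
        weight_eq_of_eqOn fun x hx => hjoin.weight_eq (hD₁.fin x hx)] at hpD

end

section

variable {n : ℕ} {G : SimpleGraph (Fin n)} {A B D : Fin n → Bool} {w : Fin n → ℕ∞}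

/-! ## Component-reduction -/

/-- The component of `a` in `G[A]` is a clique. -/
def InCliqueComp (G : SimpleGraph (Fin n)) (A : Fin n → Bool) (a : Fin n) : Prop :=
  A a = true ∧ ∀ x y, Conn G A a x → Conn G A a y → x = y ∨ G.Adj x y

theorem InCliqueComp.congr {a a' : Fin n} (h : InCliqueComp G A a) (h' : Conn G A a a') :
    InCliqueComp G A a' :=
  ⟨h'.right, fun x y hx hy => h.2 x y (h'.trans hx) (h'.trans hy)⟩

/-- `Y` is what remains of the non-clique components without the neighbours of `b` and `q`. -/
def IsRest (G : SimpleGraph (Fin n)) (A : Fin n → Bool) (b q : Fin n) (Y : Fin n → Bool) : Prop :=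
  ∀ y, Y y = true ↔ A y = true ∧ ¬ InCliqueComp G A y ∧ ¬ G.Adj b y ∧ q ≠ y ∧ ¬ G.Adj q y

/-- What the answer of component-reduction means. -/
def ComponentReductionAnswer (G : SimpleGraph (Fin n)) (A : Fin n → Bool) (w : Fin n → ℕ∞)
    (b q : Fin n) (r : Option ((Fin n → Bool) × (Fin n → ℕ∞))) : Prop :=
  ∃ Y, IsRest G A b q Y ∧
    (r = none → ∃ y, Y y = true ∧ ∀ u, Conn G Y y u → ¬ IsUniversal G Y u) ∧
    ∀ R, r = some R → (∀ y, Y y = true → ∃ u, Conn G Y y u ∧ IsUniversal G Y u) ∧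
      (∀ a, R.1 a = true ↔
        q = a ∨ (InCliqueComp G A a ∧ ¬ Conn G A q a) ∨ IsUniversal G Y a) ∧
      (∀ a, R.1 a = true → R.2 a = w a) ∧ ∀ a, ¬ R.1 a = true → R.2 a = ⊤

section

variable [DecidableRel G.Adj] {wt : Fin n → ℕ∞}

theorem spec_componentReduction {C : Fin n → Fin n → Bool} {K : Fin n → Bool}
    (hC : ∀ x y, C x y = true ↔ Conn G A x y) (hK : ∀ a, K a = true ↔ InCliqueComp G A a)
    (b q : Fin n) :
    Spec (adjMat G) wt (componentReduction (rep := Ty.den n) A w C K b q)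
      (ComponentReductionAnswer G A w b q) := by
  refine .lett (P := fun Y : Ty.den n .set => IsRest G A b q Y) ?_ fun Y hY => ?_
  · intro y
    simp only [Tm.val, val_mem, val_nb, val_clnb, Bool.and_eq_true, Bool.or_eq_true,
      Bool.not_eq_true', ← Bool.not_eq_true, adjMat_eq_true, hK, not_or]
    exact and_congr_right fun _ => and_congr_right fun _ => and_congr_right fun _ =>
      and_congr_left fun _ => not_congr decide_eq_true_iff
  refine .lett (P := fun C : Ty.den n .mat => ∀ x y, @Eq Bool (C x y) true ↔ Conn G Y x y)
    (val_components Y) fun C₂ hC₂ => ?_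
  refine .lett (P := fun U : Ty.den n .set => ∀ u, @Eq Bool (U u) true ↔ IsUniversal G Y u)
    (val_universalVerts hC₂) fun U hU => ?_
  refine .ite (fun h => ?_) fun h => ?_
  · simp only [Tm.val, val_any, val_entry, val_mem, Bool.and_eq_true, Bool.not_eq_true',
      ← Bool.not_eq_true, hC₂, hU] at h
    obtain ⟨y, hy, hu⟩ := h
    exact ⟨Y, hY, fun _ => ⟨y, hy, fun u h h' => hu ⟨u, h, h'⟩⟩, fun R hR => by cases hR⟩
  · simp only [Tm.val, val_any, val_entry, val_mem, Bool.and_eq_true, Bool.not_eq_true',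
      ← Bool.not_eq_true, hC₂, hU] at h
    push Not at h
    refine .lett (P := fun A₂ : Ty.den n .set => ∀ a, @Eq Bool (A₂ a) true ↔
      q = a ∨ (InCliqueComp G A a ∧ ¬ Conn G A q a) ∨ IsUniversal G Y a) ?_ fun A₂ hA₂ => ?_
    · intro a
      simp only [Tm.val, val_mem, val_entry, Bool.and_eq_true, Bool.or_eq_true,
        Bool.not_eq_true', ← Bool.not_eq_true, hK, hC, hU]
      exact or_congr (decide_eq_true_iff.trans eq_comm) Iff.rfl
    · refine ⟨Y, hY, fun hR => (by cases hR), fun R hR => ?_⟩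
      simp only [Tm.val, Option.some.injEq] at hR
      subst hR
      refine ⟨h, hA₂, fun a ha => ?_, fun a ha => ?_⟩
      · exact (val_ite_pos (by simpa using ha) : Tm.val (adjMat G) wt (Tm.ite (mem A₂ a)
          (.get ♯w ♯a) (.const ⊤)) = _).trans rfl
      · exact (val_ite_neg (by simpa using ha) : Tm.val (adjMat G) wt (Tm.ite (mem A₂ a)
          (.get ♯w ♯a) (.const ⊤)) = _).trans rfl

end

theorem not_inCliqueComp_of_conn {a a' : Fin n} (h : ¬ InCliqueComp G A a)
    (h' : Conn G A a a') : ¬ InCliqueComp G A a' := fun hc => h (hc.congr h'.symm)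

/-- The situation of component-reduction: `q` is a neighbour of `b`, and `b` starts no induced path
with three vertices of `A` of which only the first is a neighbour of `b`. -/
structure ReductionBase (G : SimpleGraph (Fin n)) (A : Fin n → Bool) (b q : Fin n)
    (Y : Fin n → Bool) : Prop where
  rest : IsRest G A b q Y
  q_mem : A q = true
  adj : G.Adj b q
  noPath : ∀ y z z', A y = true → A z = true → A z' = true → G.Adj b y → ¬ G.Adj b z →
    ¬ G.Adj b z' → G.Adj y z → G.Adj z z' → G.Adj y z'

namespace ReductionBase

variable {b q : Fin n} {Y : Fin n → Bool} (S : ReductionBase G A b q Y)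

include S

theorem sub {y : Fin n} (hy : Y y = true) : A y = true := ((S.rest y).1 hy).1

/-- A neighbour of `b` that contacts a component of the rest has a join to it. -/
theorem join {y z z' : Fin n} (hy : A y = true) (hby : G.Adj b y) (hyz : G.Adj y z)
    (hz : Conn G Y z z') : G.Adj y z' := by
  refine hz.induction (P := fun z' => G.Adj y z') hyz fun s t hs ht hst hys => ?_
  have hsY := (S.rest s).1 hs.right
  have htY := (S.rest t).1 ht.right
  exact S.noPath y s t hy hsY.1 htY.1 hby hsY.2.2.1 htY.2.2.1 hys hst

/-- If `x` is not a neighbour of `b`, it could be missing from the rest only as a neighbour of `q`.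
But then `b, q, x, z` would be a forbidden path, as `q` misses `z`. -/
theorem neighbor {x z : Fin n} (hz : Y z = true) (hx : A x = true) (hxz : G.Adj x z) :
    G.Adj b x ∨ Conn G Y z x := by
  by_cases hbx : G.Adj b x
  · exact .inl hbx
  · have hzY := (S.rest z).1 hz
    refine .inr (.of_adj hz ((S.rest x).2 ⟨hx, ?_, hbx, ?_, fun hqx => ?_⟩) hxz.symm)
    · exact not_inCliqueComp_of_conn hzY.2.1 (.of_adj hzY.1 hx hxz.symm)
    · rintro rfl
      exact hbx S.adj
    · exact hzY.2.2.2.2 (S.noPath q x z (S.q_mem) hx hzY.1 S.adj hbx hzY.2.2.1 hqx hxz)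

variable {A₂ : Fin n → Bool} (hA₂ : ∀ a, A₂ a = true ↔
  q = a ∨ (InCliqueComp G A a ∧ ¬ Conn G A q a) ∨ IsUniversal G Y a)

include hA₂

theorem subset {a : Fin n} (ha : A₂ a = true) : A a = true := by
  rcases (hA₂ a).1 ha with rfl | h | h
  · exact S.q_mem
  · exact h.1.1
  · exact S.sub h.1

/-- A dominator in `A₂` of a vertex of the rest belongs to the rest. -/
theorem conn_of_dominates {z e : Fin n} (hz : Y z = true) (he : A₂ e = true)
    (hez : e = z ∨ G.Adj e z) : Conn G Y z e ∧ IsUniversal G Y e := by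
  have hzY := (S.rest z).1 hz
  have heA := S.subset hA₂ he
  have hze : Conn G A z e := by
    rcases hez with rfl | hez
    · exact .refl hzY.1
    · exact .of_adj hzY.1 heA hez.symm
  have hU : IsUniversal G Y e := by
    rcases (hA₂ e).1 he with rfl | h | h
    · rcases hez with rfl | hez
      · exact absurd rfl hzY.2.2.2.1
      · exact absurd hez hzY.2.2.2.2
    · exact absurd (h.1.congr hze.symm) hzY.2.1
    · exact h
  refine ⟨?_, hU⟩
  rcases hez with rfl | hez
  · exact .refl hz
  · exact (S.neighbor hz heA hez).resolve_left ((S.rest e).1 hU.1).2.2.1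

/-- `q` has no neighbour in the rest, so an edge of `G[A₂]` lies in an old clique component or in a
component of the rest, whose kept vertices are universal and hence pairwise adjacent. -/
theorem cliqueComps : CliqueComps G A₂ := by
  -- no edge joins different parts of `A₂`
  have key : ∀ x y, A₂ x = true → A₂ y = true → G.Adj x y →
      (InCliqueComp G A x ∧ InCliqueComp G A y) ∨ Conn G Y x y := by
    intro x y hx hy hxy
    have hcxy : Conn G A x y := .of_adj (S.subset hA₂ hx) (S.subset hA₂ hy) hxy
    rcases (hA₂ x).1 hx with rfl | h | h
    · rcases (hA₂ y).1 hy with rfl | h' | h'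
      · exact absurd hxy (G.loopless.irrefl _)
      · exact absurd hcxy h'.2
      · exact absurd hxy ((S.rest y).1 h'.1).2.2.2.2
    · exact .inl ⟨h.1, h.1.congr hcxy⟩
    · exact .inr (S.conn_of_dominates hA₂ h.1 hy (.inr hxy.symm)).1
  intro x y hxy
  have hA : Conn G A x y := hxy.mono fun z hz => S.subset hA₂ hz.right
  by_cases hK : InCliqueComp G A x
  · exact hK.2 x y (.refl hK.1) hA
  · have : x = y ∨ Conn G Y x y := by
      refine hxy.induction (P := fun y => x = y ∨ Conn G Y x y) (.inl rfl) ?_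
      intro s t hs ht hst ih
      have hst' : Conn G Y s t := (key s t hs.right ht.right hst).resolve_left fun h => by
        refine hK (h.1.congr ?_)
        exact (hs.mono fun z hz => S.subset hA₂ hz.right).symm
      rcases ih with rfl | ih
      · exact .inr hst'
      · exact .inr (ih.trans hst')
    rcases this with rfl | h
    · exact .inl rfl
    · have hu := (S.conn_of_dominates hA₂ h.left hxy.left (.inl rfl)).2
      exact (hu.2 y h).imp Eq.symm SimpleGraph.Adj.symm

end ReductionBase

/-- In addition, `q` is the neighbour of `b` in the solution `D`, and `b` contacts every non-clique
component. -/
structure ReductionSetup (G : SimpleGraph (Fin n)) (A B : Fin n → Bool) (w : Fin n → ℕ∞)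
    (D : Fin n → Bool) (b q : Fin n) (Y : Fin n → Bool) : Prop extends
    ReductionBase G A b q Y where
  sol : IsSol G A B w D
  mem : D q = true
  uniq : ∀ d, D d = true → G.Adj b d → d = q
  contact : ∀ a, A a = true → ¬ InCliqueComp G A a → ∃ y, Conn G A a y ∧ G.Adj b y

namespace ReductionSetup

variable {b q : Fin n} {Y : Fin n → Bool} (S : ReductionSetup G A B w D b q Y)

include S

/-- `b` contacts the surrounding component of `G[A]`, so some walk leaves the component of the rest;
the first vertex outside is a neighbour of `b` and therefore has a join. -/
theorem exists_join {z : Fin n} (hz : Y z = true) :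
    ∃ y, A y = true ∧ G.Adj b y ∧ ∀ z', Conn G Y z z' → G.Adj y z' := by
  have hzY := (S.rest z).1 hz
  obtain ⟨x, hzx, hbx⟩ := S.contact z hzY.1 hzY.2.1
  have hx : ¬ Conn G Y z x := fun h => ((S.rest x).1 h.right).2.2.1 hbx
  obtain ⟨s, t, hs, ht, hst, hzs, hzt⟩ :=
    hzx.exists_edge (P := fun x => Conn G Y z x) (.refl hz) hx
  have hbt : G.Adj b t := (S.neighbor hzs.right ht.right hst.symm).resolve_right
    fun h => hzt (hzs.trans h)
  exact ⟨t, ht.right, hbt, fun z' hz' => S.join ht.right hbt hst.symm (hzs.symm.trans hz')⟩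

/-- The vertex with a join to the component is dominated only once. -/
theorem sol_unique {d e : Fin n} (hd : D d = true) (he : D e = true) (h : Conn G Y d e) :
    d = e := by
  obtain ⟨y, hy, -, hj⟩ := S.exists_join h.left
  exact S.sol.uniq y (.inl hy) d e hd he (.inr (hj d (.refl h.left)).symm) (.inr (hj e h).symm)

/-- A dominator outside the component would be a neighbour of `b`, hence equal to `q`, but `q` has
no neighbour in the rest. -/
theorem exists_dominator {z : Fin n} (hz : Y z = true) :
    ∃ d, D d = true ∧ (d = z ∨ G.Adj d z) ∧ Conn G Y z d := by
  obtain ⟨d, hd, hdz⟩ := S.sol.dom z (.inl (S.sub hz))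
  refine ⟨d, hd, hdz, ?_⟩
  rcases hdz with rfl | hdz
  · exact .refl hz
  · refine (S.neighbor hz (S.sol.sub d hd) hdz).resolve_left fun hbd => ?_
    obtain rfl := S.uniq d hd hbd
    exact ((S.rest z).1 hz).2.2.2.2 hdz

theorem isUniversal {d : Fin n} (hd : D d = true) (hdY : Y d = true) : IsUniversal G Y d := by
  refine ⟨hdY, fun y hy => ?_⟩
  obtain ⟨e, he, hey, hye⟩ := S.exists_dominator hy.right
  rw [S.sol_unique hd he (hy.trans hye)]
  exact hey.imp Eq.symm SimpleGraph.Adj.symm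

theorem exists_universal {z : Fin n} (hz : Y z = true) :
    ∃ u, Conn G Y z u ∧ IsUniversal G Y u := by
  obtain ⟨d, hd, -, hzd⟩ := S.exists_dominator hz
  exact ⟨d, hzd, S.isUniversal hd hzd.right⟩

theorem not_adj_of_mem {d : Fin n} (hd : D d = true) : ¬ G.Adj q d := fun h => by
  have := S.sol.uniq d (.inl (S.sol.sub d hd)) q d S.mem hd (.inr h) (.inl rfl)
  exact G.loopless.irrefl d (this ▸ h)

variable {A₂ : Fin n → Bool} (hA₂ : ∀ a, A₂ a = true ↔
  q = a ∨ (InCliqueComp G A a ∧ ¬ Conn G A q a) ∨ IsUniversal G Y a)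

include hA₂

theorem sol_subset {d : Fin n} (hd : D d = true) : A₂ d = true := by
  rw [hA₂]
  by_cases hqd : q = d
  · exact .inl hqd
  · refine .inr ?_
    by_cases hK : InCliqueComp G A d
    · refine .inl ⟨hK, fun hc => ?_⟩
      exact ((hK.2 q d hc.symm (.refl hK.1)).resolve_left hqd) |> S.not_adj_of_mem hd
    · exact .inr (S.isUniversal hd ((S.rest d).2 ⟨S.sol.sub d hd, hK,
        fun h => hqd (S.uniq d hd h).symm, hqd, S.not_adj_of_mem hd⟩))

variable {w₂ : Fin n → ℕ∞} (hw₂ : ∀ a, A₂ a = true → w₂ a = w a)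

include hw₂

theorem isSol : IsSol G A₂ B w₂ D :=
  S.sol.of_subset (fun _ => S.subset hA₂) (fun _ => id) (fun _ => S.sol_subset hA₂)
    fun d hd => hw₂ d (S.sol_subset hA₂ hd)

/-- The discarded vertices are compared with `D`. Both `D` and `E` contain `q` and have exactly one
vertex in each component of the rest, and a discarded neighbour of `b` is adjacent to all or none of
such a component. -/
theorem isSol_of_isSol {E : Fin n → Bool} (h : IsSol G A₂ B w₂ E) : IsSol G A B w E := by
  have hqA : A q = true := S.sol.sub q S.mem
  have hq₂ : A₂ q = true := (hA₂ q).2 (.inl rfl)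
  have hEA : ∀ e, E e = true → A e = true := fun e he => S.subset hA₂ (h.sub e he)
  have hq : E q = true := by
    obtain ⟨e, he, heq⟩ := h.dom q (.inl hq₂)
    rcases heq with rfl | heq
    · exact he
    · rcases (hA₂ e).1 (h.sub e he) with rfl | h' | h'
      · exact he
      · exact absurd (.of_adj hqA h'.1.1 heq.symm) h'.2
      · exact absurd heq.symm ((S.rest e).1 h'.1).2.2.2.2
  -- each component of the rest has a unique member of `E`
  have hex : ∀ z, Y z = true → ∃ e, E e = true ∧ Conn G Y z e ∧ IsUniversal G Y e := by
    intro z hz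
    obtain ⟨u, hzu, hu⟩ := S.exists_universal hz
    obtain ⟨e, he, heu⟩ := h.dom u (.inl ((hA₂ u).2 (.inr (.inr hu))))
    obtain ⟨hue, hU⟩ := S.conn_of_dominates hA₂ hu.1 (h.sub e he) heu
    exact ⟨e, he, hzu.trans hue, hU⟩
  have huniq : ∀ d e, E d = true → E e = true → Conn G Y d e → d = e := by
    intro d e hd he hde
    have hU := (S.conn_of_dominates hA₂ hde.left (h.sub d hd) (.inl rfl)).2
    exact (h.uniq d (.inl (h.sub d hd)) e d he hd (hU.2 e hde) (.inl rfl)).symm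
  -- A dominator `e ≠ q` of `x` lies in the rest. As `x` has a join to the component of `e`, the
  -- member of `D` there dominates `x` too.
  have hne : ∀ x e, A x = true → ¬ (InCliqueComp G A x) → G.Adj b x →
      E e = true → q ≠ e → (e = x ∨ G.Adj e x) → Conn G A x e →
      ∃ d, D d = true ∧ G.Adj d x ∧ Conn G Y e d := by
    intro x e hx hK hbx he hqe hex hc
    have hU : IsUniversal G Y e := by
      rcases (hA₂ e).1 (h.sub e he) with h' | h' | h'
      · exact absurd h' hqe
      · exact absurd (h'.1.congr hc.symm) hK
      · exact h'
    have hexa : G.Adj e x := hex.resolve_left fun h' =>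
      ((S.rest e).1 hU.1).2.2.1 (h' ▸ hbx)
    obtain ⟨d, hd, -, hed⟩ := S.exists_dominator hU.1
    exact ⟨d, hd, (S.join hx hbx hexa.symm hed).symm, hed⟩
  have hall : ∀ x, A x = true ∨ B x = true → (∃ d, E d = true ∧ (d = x ∨ G.Adj d x)) ∧
      ∀ d e, E d = true → E e = true → (d = x ∨ G.Adj d x) → (e = x ∨ G.Adj e x) → d = e := by
    intro x hx
    by_cases hx₂ : A₂ x = true ∨ B x = true
    · exact ⟨h.dom x hx₂, h.uniq x hx₂⟩
    have hxA : A x = true := hx.resolve_right fun hb => hx₂ (.inr hb)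
    have hx₂' : ¬ A₂ x = true := fun h' => hx₂ (.inl h')
    rw [hA₂, not_or, not_or] at hx₂'
    obtain ⟨hqx, hxK, hxU⟩ := hx₂'
    have hconn : ∀ e, E e = true → (e = x ∨ G.Adj e x) → Conn G A x e := by
      rintro e he (rfl | hex)
      · exact .refl hxA
      · exact .of_adj hxA (hEA e he) hex.symm
    by_cases hK : InCliqueComp G A x
    · have hcq : Conn G A q x := by
        by_contra hc
        exact hxK ⟨hK, hc⟩
      have hqe : ∀ e, E e = true → (e = x ∨ G.Adj e x) → e = q := by
        intro e he hex
        have hxe := hconn e he hex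
        rcases (hA₂ e).1 (h.sub e he) with h' | h' | h'
        · exact h'.symm
        · exact absurd (hcq.trans hxe) h'.2
        · exact absurd (hK.congr hxe) ((S.rest e).1 h'.1).2.1
      refine ⟨⟨q, hq, hK.2 q x hcq.symm (.refl hxA)⟩, fun d e hd he hdx hex => ?_⟩
      rw [hqe d hd hdx, hqe e he hex]
    by_cases hY : Y x = true
    · obtain ⟨e, he, hxe, hU⟩ := hex x hY
      refine ⟨⟨e, he, (hU.2 x hxe.symm).imp Eq.symm SimpleGraph.Adj.symm⟩,
        fun d d' hd hd' hdx hdx' => ?_⟩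
      exact huniq d d' hd hd' ((S.conn_of_dominates hA₂ hY (h.sub d hd) hdx).1.symm.trans
        (S.conn_of_dominates hA₂ hY (h.sub d' hd') hdx').1)
    -- For a neighbour of `q`, a dominator in `E` other than `q` would give `D` a second dominator
    -- of `x` besides `q`.
    by_cases hqx' : G.Adj q x
    · have hqe : ∀ e, E e = true → (e = x ∨ G.Adj e x) → e = q := by
        intro e he hex
        by_contra hne'
        have hbx : G.Adj b x := by
          rcases (hA₂ e).1 (h.sub e he) with h' | h' | h'
          · exact absurd h'.symm hne'
          · exact absurd (h'.1.congr (hconn e he hex).symm) hK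
          · have hex' : G.Adj e x := hex.resolve_left fun e' => hY (e' ▸ h'.1)
            exact (S.neighbor h'.1 hxA hex'.symm).resolve_right fun hc => hY hc.right
        obtain ⟨d, hd, hdx, hed⟩ := hne x e hxA hK hbx he (Ne.symm hne') hex
          (hconn e he hex)
        have := S.sol.uniq x (.inl hxA) d q hd S.mem (.inr hdx) (.inr hqx')
        subst this
        exact ((S.rest d).1 hed.right).2.2.2.1 rfl
      refine ⟨⟨q, hq, .inr hqx'⟩, fun d e hd he hdx hex => ?_⟩
      rw [hqe d hd hdx, hqe e he hex]
    -- What is left are neighbours of `b` outside `N[q]`. The dominator of `x` in `D` lies in the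
    -- rest, and the member of `E` in its component takes over its role.
    · have hbx : G.Adj b x := by
        by_contra hbx
        exact hY ((S.rest x).2 ⟨hxA, hK, hbx, hqx, hqx'⟩)
      obtain ⟨d, hd, hdx⟩ := S.sol.dom x (.inl hxA)
      have hdx : G.Adj d x := hdx.resolve_left fun e => hqx (S.uniq x (e ▸ hd) hbx).symm
      have hdq : q ≠ d := fun e => hqx' (e ▸ hdx)
      have hdY : Y d = true := by
        rcases (hA₂ d).1 (S.sol_subset hA₂ hd) with h' | h' | h'
        · exact absurd h' hdq
        · exact absurd (h'.1.congr (.of_adj h'.1.1 hxA hdx)) hK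
        · exact h'.1
      obtain ⟨e, he, hde, -⟩ := hex d hdY
      refine ⟨⟨e, he, .inr (S.join hxA hbx hdx.symm hde).symm⟩, fun f f' hf hf' hfx hfx' => ?_⟩
      have key : ∀ f, E f = true → (f = x ∨ G.Adj f x) → f = e := by
        intro f hf hfx
        have hqf : q ≠ f := by
          rintro rfl
          rcases hfx with rfl | hfx
          · exact hqx rfl
          · exact hqx' hfx
        obtain ⟨d', hd', hdx', hfd⟩ := hne x f hxA hK hbx hf hqf hfx (hconn f hf hfx)
        have := S.sol.uniq x (.inl hxA) d' d hd' hd (.inr hdx') (.inr hdx)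
        subst this
        exact huniq f e hf he (hfd.trans hde)
      rw [key f hf hfx, key f' hf' hfx']
  exact ⟨hEA, fun x hx => (hall x hx).1, fun x hx => (hall x hx).2,
    fun e he => hw₂ e (h.sub e he) ▸ h.fin e he⟩

end ReductionSetup

end

section

variable {n : ℕ} {G : SimpleGraph (Fin n)} {A B D : Fin n → Bool} {w : Fin n → ℕ∞}

/-! ## Induced paths and distance levels -/

theorem P6Free.no_path {V : Type} {G : SimpleGraph V} (hG : P6Free G) {a b c d e f : V}
    (hab : G.Adj a b) (hbc : G.Adj b c) (hcd : G.Adj c d) (hde : G.Adj d e) (hef : G.Adj e f)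
    (hac : ¬ G.Adj a c) (had : ¬ G.Adj a d) (hae : ¬ G.Adj a e) (haf : ¬ G.Adj a f)
    (hbd : ¬ G.Adj b d) (hbe : ¬ G.Adj b e) (hbf : ¬ G.Adj b f) (hce : ¬ G.Adj c e)
    (hcf : ¬ G.Adj c f) (hdf : ¬ G.Adj d f) : False := by
  have hrel : ∀ i j, G.Adj (![a, b, c, d, e, f] i) (![a, b, c, d, e, f] j) ↔
      (SimpleGraph.pathGraph 6).Adj i j := by
    intro i j
    rw [SimpleGraph.pathGraph_adj]
    fin_cases i <;> fin_cases j <;> simp [*, G.adj_comm]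
  refine hG ⟨⟨⟨![a, b, c, d, e, f], fun i j hij => ?_⟩, hrel _ _⟩⟩
  -- The six vertices are distinct: equal ones would have the same neighbours on the path, but no
  -- two vertices of `P₆` do.
  have htwin : ∀ k, (SimpleGraph.pathGraph 6).Adj i k ↔ (SimpleGraph.pathGraph 6).Adj j k :=
    fun k => by rw [← hrel, ← hrel, hij]
  simp only [SimpleGraph.pathGraph_adj] at htwin
  clear hij
  revert i j
  decide

/-- `A` consists of the vertices at distance at least three from `v`, and `N` of those at
distance two. -/
structure IsLevels (G : SimpleGraph (Fin n)) (v : Fin n) (N A : Fin n → Bool) : Prop where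
  far : ∀ a, A a = true → a ≠ v ∧ ¬ G.Adj v a ∧ ∀ x, G.Adj v x → ¬ G.Adj x a
  two : ∀ b, N b = true → b ≠ v ∧ ¬ G.Adj v b ∧ ∃ x, G.Adj v x ∧ G.Adj x b
  cover : ∀ u, u = v ∨ G.Adj v u ∨ N u = true ∨ A u = true
  contact : ∀ a, A a = true → ∃ x b, Conn G A a x ∧ N b = true ∧ G.Adj b x

/-- By connectedness, a vertex outside the levels would yield one adjacent to `N₄`, and a shortest
path to it from `v` would be an induced `P₆`. -/
theorem isLevels_of_connected (hG : P6Free G) (hconn : G.Connected) {v : Fin n}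
    {N₂ N₃ N₄ : Fin n → Bool}
    (h₂ : ∀ u, N₂ u = true ↔ u ≠ v ∧ ¬ G.Adj v u ∧ ∃ x, G.Adj v x ∧ G.Adj x u)
    (h₃ : ∀ u, N₃ u = true ↔ ¬ G.Adj v u ∧ ¬ N₂ u = true ∧ ∃ x, N₂ x = true ∧ G.Adj x u)
    (h₄ : ∀ u, N₄ u = true ↔
      ¬ N₂ u = true ∧ ¬ N₃ u = true ∧ ∃ x, N₃ x = true ∧ G.Adj x u)
    (hA : ∀ u, A u = true ↔ N₃ u = true ∨ N₄ u = true) : IsLevels G v N₂ A := by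
  have far₃ : ∀ a, N₃ a = true → a ≠ v ∧ ¬ G.Adj v a ∧ ∀ x, G.Adj v x → ¬ G.Adj x a := by
    intro a ha
    obtain ⟨h, h', x, hx, hxa⟩ := (h₃ a).1 ha
    have hav : a ≠ v := fun e => ((h₂ x).1 hx).2.1 (e ▸ hxa.symm)
    exact ⟨hav, h, fun x hvx hxa => h' ((h₂ a).2 ⟨hav, h, x, hvx, hxa⟩)⟩
  have far₄ : ∀ a, N₄ a = true → a ≠ v ∧ ¬ G.Adj v a ∧ ∀ x, G.Adj v x → ¬ G.Adj x a := by
    intro a ha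
    obtain ⟨h, h', x, hx, hxa⟩ := (h₄ a).1 ha
    have hx₃ := far₃ x hx
    have hav : a ≠ v := fun e => hx₃.2.1 (e ▸ hxa.symm)
    have hva : ¬ G.Adj v a := fun hva => hx₃.2.2 a hva hxa.symm
    exact ⟨hav, hva, fun x hvx hxa => h ((h₂ a).2 ⟨hav, hva, x, hvx, hxa⟩)⟩
  have hsub : ∀ {x y}, (x = v ∨ G.Adj v x ∨ N₂ x = true ∨ A x = true) → G.Adj x y →
      (y = v ∨ G.Adj v y ∨ N₂ y = true ∨ A y = true) := by
    intro x y hx hxy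
    by_contra hy
    push Not at hy
    obtain ⟨hyv, hvy, hy₂, hyA⟩ := hy
    have hy₃ : ¬ N₃ y = true := fun h => hyA ((hA y).2 (.inl h))
    have hy₄ : ¬ N₄ y = true := fun h => hyA ((hA y).2 (.inr h))
    have n₁ : ∀ x, G.Adj v x → ¬ G.Adj x y := fun x hvx hxy =>
      hy₂ ((h₂ y).2 ⟨hyv, hvy, x, hvx, hxy⟩)
    have n₂ : ∀ x, N₂ x = true → ¬ G.Adj x y := fun x hx hxy =>
      hy₃ ((h₃ y).2 ⟨hvy, hy₂, x, hx, hxy⟩)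
    have n₃ : ∀ x, N₃ x = true → ¬ G.Adj x y := fun x hx hxy =>
      hy₄ ((h₄ y).2 ⟨hy₂, hy₃, x, hx, hxy⟩)
    rcases hx with rfl | hx | hx | hx
    · exact hvy hxy
    · exact n₁ x hx hxy
    · exact n₂ x hx hxy
    rcases (hA x).1 hx with hx₃ | hx₄
    · exact n₃ x hx₃ hxy
    obtain ⟨h, h', z, hz, hzx⟩ := (h₄ x).1 hx₄
    obtain ⟨hz', hz'', t, ht, htz⟩ := (h₃ z).1 hz
    obtain ⟨ht', ht'', s, hs, hst⟩ := (h₂ t).1 ht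
    have fz := far₃ z hz
    have fx := far₄ x hx₄
    -- The path `v, s, t, z, x, y`, with one vertex at each distance from `v`.
    refine hG.no_path hs hst htz hzx hxy ht'' fz.2.1 fx.2.1 hvy (fz.2.2 s hs) (fx.2.2 s hs)
      (n₁ s hs) (fun htx => h' ((h₃ x).2 ⟨fx.2.1, h, t, ht, htx⟩)) (n₂ t ht) (n₃ z hz)
  refine ⟨fun a ha => ((hA a).1 ha).elim (far₃ a) (far₄ a), fun b hb => (h₂ b).1 hb,
    fun u => ?_, fun a ha => ?_⟩
  · obtain ⟨p⟩ := hconn.preconnected v u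
    suffices ∀ x y (p : G.Walk x y), (x = v ∨ G.Adj v x ∨ N₂ x = true ∨ A x = true) →
        (y = v ∨ G.Adj v y ∨ N₂ y = true ∨ A y = true) from this v u p (.inl rfl)
    intro x y p
    induction p with
    | nil => exact id
    | cons h _ ih => exact fun hx => ih (hsub hx h)
  · have key : ∀ a, N₃ a = true → ∃ b, N₂ b = true ∧ G.Adj b a := fun a ha =>
      ((h₃ a).1 ha).2.2
    rcases (hA a).1 ha with h | h
    · obtain ⟨b, hb, hba⟩ := key a h
      exact ⟨a, b, .refl ha, hb, hba⟩
    · obtain ⟨-, -, x, hx, hxa⟩ := (h₄ a).1 h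
      obtain ⟨b, hb, hbx⟩ := key x hx
      exact ⟨x, b, .of_adj ha ((hA x).2 (.inl hx)) hxa.symm, hb, hbx⟩

namespace IsLevels

variable {v : Fin n} {N : Fin n → Bool} (h : IsLevels G v N A)

include h

theorem disjoint (x : Fin n) (hx : A x = true) : ¬ N x = true := fun hN => by
  obtain ⟨-, -, y, hvy, hyx⟩ := h.two x hN
  exact (h.far x hx).2.2 y hvy hyx

/-- Going back from `b` to `v` through a common neighbour `x` gives the induced path `v, x, b, y, z,
z'`. -/
theorem no_path (hG : P6Free G) {b y z z' : Fin n} (hb : N b = true) (hy : A y = true)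
    (hz : A z = true) (hz' : A z' = true) (hby : G.Adj b y) (hbz : ¬ G.Adj b z)
    (hbz' : ¬ G.Adj b z') (hyz : G.Adj y z) (hzz' : G.Adj z z') : G.Adj y z' := by
  by_contra hyz'
  obtain ⟨-, hvb, x, hvx, hxb⟩ := h.two b hb
  have fy := h.far y hy
  have fz := h.far z hz
  have fz' := h.far z' hz'
  exact hG.no_path hvx hxb hby hyz hzz' hvb fy.2.1 fz.2.1 fz'.2.1 (fy.2.2 x hvx) (fz.2.2 x hvx)
    (fz'.2.2 x hvx) hbz hbz' hyz'

/-- Two vertices at distance two from `v` that have private neighbours in different components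
cannot both distinguish these components. -/
theorem no_pattern (hG : P6Free G) {b b' y z y' z' : Fin n} (hb : N b = true) (hb' : N b' = true)
    (hy : A y = true) (hz : A z = true) (hy' : A y' = true) (hz' : A z' = true)
    (hby : G.Adj b y) (hbz : ¬ G.Adj b z) (hby' : ¬ G.Adj b y') (hbz' : ¬ G.Adj b z')
    (hb'y' : G.Adj b' y') (hb'z' : ¬ G.Adj b' z') (hb'y : ¬ G.Adj b' y) (hb'z : ¬ G.Adj b' z)
    (hyz : G.Adj y z) (hyz' : G.Adj y' z') (h₁ : ¬ G.Adj y y') (h₂ : ¬ G.Adj y z')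
    (h₃ : ¬ G.Adj z y') (h₄ : ¬ G.Adj z z') : False := by
  obtain ⟨-, hvb, x, hvx, hxb⟩ := h.two b hb
  obtain ⟨-, hvb', x', hvx', hxb'⟩ := h.two b' hb'
  have fy := h.far y hy
  have fz := h.far z hz
  have fy' := h.far y' hy'
  have fz' := h.far z' hz'
  have rev : ∀ {s t}, ¬ G.Adj s t → ¬ G.Adj t s := fun hst hts => hst hts.symm
  -- A shortest connection of `b` and `b'` through `v`, `x`, `x'` is extended to six vertices. The
  -- paths are `z y b b' y' z'`, `z y b x b' y'`, `z y b x' b' y'`, `y b x x' b' y'` and `y b x v x'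
  -- b'`.
  by_cases hbb : G.Adj b b'
  · exact hG.no_path hyz.symm hby.symm hbb hb'y' hyz' (rev hbz) (rev hb'z) h₃ h₄ (rev hb'y) h₁ h₂
      hby' hbz' hb'z'
  by_cases hxb'' : G.Adj x b'
  · exact hG.no_path hyz.symm hby.symm hxb.symm hxb'' hb'y' (rev hbz) (rev (fz.2.2 x hvx))
      (rev hb'z) h₃ (rev (fy.2.2 x hvx)) (rev hb'y) h₁ hbb hby' (fy'.2.2 x hvx)
  by_cases hx'b : G.Adj x' b
  · exact hG.no_path hyz.symm hby.symm hx'b.symm hxb' hb'y' (rev hbz) (rev (fz.2.2 x' hvx'))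
      (rev hb'z) h₃ (rev (fy.2.2 x' hvx')) (rev hb'y) h₁ hbb hby' (fy'.2.2 x' hvx')
  by_cases hxx : G.Adj x x'
  · exact hG.no_path hby.symm hxb.symm hxx hxb' hb'y' (rev (fy.2.2 x hvx))
      (rev (fy.2.2 x' hvx')) (rev hb'y) h₁ (rev hx'b) hbb hby' hxb'' (fy'.2.2 x hvx)
      (fy'.2.2 x' hvx')
  · exact hG.no_path hby.symm hxb.symm hvx.symm hvx' hxb' (rev (fy.2.2 x hvx)) (rev fy.2.1)
      (rev (fy.2.2 x' hvx')) (rev hb'y) (rev hvb) (rev hx'b) hbb hxx hxb'' hvb'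

/-- Edges witnessing mutual overtaking in different components form the forbidden pattern. Subsets
are allowed so that the statement applies after any of the reductions. -/
theorem noMutualOvertaking (hG : P6Free G) {A' N' : Fin n → Bool}
    (hA' : ∀ x, A' x = true → A x = true) (hN' : ∀ x, N' x = true → N x = true) :
    NoMutualOvertaking G A' N' := by
  rintro b b' y y' hb hb' ⟨hy, z, hyz, hyz_adj, h₁, h₂, h₃, h₄⟩ ⟨hy', z', hyz', hyz'_adj, h₁', h₂',
    h₃', h₄'⟩
  by_contra hc
  have cross : ∀ s t, Conn G A' y s → Conn G A' y' t → ¬ G.Adj s t := fun s t hs ht hst =>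
    hc ((hs.trans (.of_adj hs.right ht.right hst)).trans ht.symm)
  exact h.no_pattern hG (hN' b' hb') (hN' b hb) (hA' y hy) (hA' z hyz.right) (hA' y' hy')
    (hA' z' hyz'.right) h₃ h₄ h₁' h₂' h₃' h₄' h₁ h₂ hyz_adj hyz'_adj
    (cross _ _ (.refl hy) (.refl hy')) (cross _ _ (.refl hy) hyz')
    (cross _ _ hyz (.refl hy')) (cross _ _ hyz hyz')

variable {I : (Fin n → Bool) × (Fin n → Bool) × (Fin n → ℕ∞)} (hI : JoinReduced G A N w I)

include hI

-- A joined component is reduced to pairwise adjacent universal vertices. So a component that is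
-- still not a clique is an original one, without a join and left intact.
omit h in
theorem conn_of_not_inCliqueComp {a y : Fin n} (ha : I.1 a = true)
    (hK : ¬ InCliqueComp G I.1 a) (hy : Conn G A a y) :
    Conn G I.1 a y ∧ ∀ b, N b = true → ¬ Joins G A b a := by
  have hsub : ∀ x, I.1 x = true → A x = true := fun x hx => ((hI.memA x).1 hx).1
  have hnj : ∀ b, N b = true → ¬ Joins G A b a := by
    intro b hb hj
    refine hK ⟨ha, fun x y hx hy => ?_⟩
    have up : ∀ {s t}, Conn G I.1 s t → Conn G A s t := fun hst =>
      hst.mono fun z hz => hsub z hz.right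
    have hu := ((hI.memA x).1 hx.right).2 b hb (hj.congr (up hx))
    exact (hu.2 y (up (hx.symm.trans hy))).imp Eq.symm SimpleGraph.Adj.symm
  exact ⟨hy.mono fun z hz => (hI.memA z).2 ⟨hz.right, fun b hb hj =>
    absurd (hj.congr hz.symm) (hnj b hb)⟩, hnj⟩

/-- Some vertex at distance two from `v` contacts all non-clique components. -/
theorem exists_contact (hG : P6Free G) (hne : ∃ a, I.1 a = true ∧ ¬ InCliqueComp G I.1 a) :
    ∃ b, N b = true ∧ ∀ a, I.1 a = true → ¬ InCliqueComp G I.1 a →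
      ∃ y, Conn G I.1 a y ∧ G.Adj b y := by
  classical
  have hsub : ∀ x, I.1 x = true → A x = true := fun x hx => ((hI.memA x).1 hx).1
  let cs : Fin n → Finset (Fin n) := fun a =>
    Finset.univ.filter fun b => N b = true ∧ ∃ y, Conn G I.1 a y ∧ G.Adj b y
  have hcs : ∀ a b, b ∈ cs a ↔ N b = true ∧ ∃ y, Conn G I.1 a y ∧ G.Adj b y := by simp [cs]
  -- No `b` has a join to such a component, so contacting it means distinguishing one of its edges.
  have hdist : ∀ a b, I.1 a = true → ¬ InCliqueComp G I.1 a → b ∈ cs a →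
      ∃ y z, Conn G I.1 a y ∧ Conn G I.1 a z ∧ G.Adj y z ∧ G.Adj b y ∧ ¬ G.Adj b z := by
    intro a b ha hK hb
    obtain ⟨hNb, y, hay, hby⟩ := (hcs a b).1 hb
    have hnj := (conn_of_not_inCliqueComp hI ha hK (.refl (hsub a ha))).2 b hNb
    have : ∃ z, Conn G A a z ∧ ¬ G.Adj b z := by
      by_contra hcon
      push Not at hcon
      exact hnj ⟨hsub a ha, hcon⟩
    obtain ⟨z, haz, hbz⟩ := this
    have haz' := (conn_of_not_inCliqueComp hI ha hK haz).1
    obtain ⟨s, t, hs, ht, hst, hbs, hbt⟩ :=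
      (hay.symm.trans haz').exists_edge (P := fun x => G.Adj b x) hby hbz
    exact ⟨s, t, hay.trans hs, hay.trans ht, hst, hbs, hbt⟩
  -- Two incomparable contact sets would provide vertices with private edges in different
  -- components, the pattern excluded by `no_pattern`.
  have htotal : ∀ a a', I.1 a = true → ¬ InCliqueComp G I.1 a → I.1 a' = true →
      ¬ InCliqueComp G I.1 a' → cs a ⊆ cs a' ∨ cs a' ⊆ cs a := by
    intro a a' ha hK ha' hK'
    by_contra hcon
    rw [not_or, Finset.not_subset, Finset.not_subset] at hcon
    obtain ⟨⟨b, hb, hba'⟩, b', hb', hb'a⟩ := hcon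
    obtain ⟨y, z, hy, hz, hyz, hby, hbz⟩ := hdist a b ha hK hb
    obtain ⟨y', z', hy', hz', hyz', hby', hbz'⟩ := hdist a' b' ha' hK' hb'
    have hNb := ((hcs a b).1 hb).1
    have hNb' := ((hcs a' b').1 hb').1
    have hn : ∀ t, Conn G I.1 a' t → ¬ G.Adj b t := fun t ht hbt =>
      hba' ((hcs a' b).2 ⟨hNb, t, ht, hbt⟩)
    have hn' : ∀ t, Conn G I.1 a t → ¬ G.Adj b' t := fun t ht hbt =>
      hb'a ((hcs a b').2 ⟨hNb', t, ht, hbt⟩)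
    have cross : ∀ s t, Conn G I.1 a s → Conn G I.1 a' t → ¬ G.Adj s t := by
      intro s t hs ht hst
      exact hn y ((ht.trans (.of_adj ht.right hs.right hst.symm)).trans
        (hs.symm.trans hy)) hby
    exact h.no_pattern hG hNb hNb' (hsub y hy.right) (hsub z hz.right) (hsub y' hy'.right)
      (hsub z' hz'.right) hby hbz (hn y' hy') (hn z' hz') hby' hbz' (hn' y hy) (hn' z hz) hyz hyz'
      (cross _ _ hy hy') (cross _ _ hy hz') (cross _ _ hz hy') (cross _ _ hz hz')
  -- The smallest contact set lies in all the others, and it is nonempty because every component of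
  -- `G[A]` has a neighbour in `N`.
  obtain ⟨a₀, ha₀, hmin⟩ := Finset.exists_min_image
    (Finset.univ.filter fun a => I.1 a = true ∧ ¬ InCliqueComp G I.1 a) (fun a => (cs a).card)
    (by obtain ⟨a, ha⟩ := hne; exact ⟨a, by simpa using ha⟩)
  simp only [Finset.mem_filter, Finset.mem_univ, true_and] at ha₀ hmin
  have hsubset : ∀ a, I.1 a = true → ¬ InCliqueComp G I.1 a → cs a₀ ⊆ cs a := by
    intro a ha hK
    rcases htotal a₀ a ha₀.1 ha₀.2 ha hK with h' | h'
    · exact h'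
    · exact (Finset.eq_of_subset_of_card_le h' (hmin a ⟨ha, hK⟩)).symm.subset
  obtain ⟨x, b, hax, hb, hbx⟩ := h.contact a₀ (hsub a₀ ha₀.1)
  refine ⟨b, hb, fun a ha hK => ((hcs a b).1 (hsubset a ha hK ?_)).2⟩
  exact (hcs a₀ b).2 ⟨hb, x, (conn_of_not_inCliqueComp hI ha₀.1 ha₀.2 hax).1, hbx⟩

end IsLevels

end

section

variable {n : ℕ} {G : SimpleGraph (Fin n)} {A B D : Fin n → Bool} {w : Fin n → ℕ∞}

/-! ## Correctness of the algorithm for `P₆`-free graphs -/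

/-- A vertex of `D` in `N₁` would be dominated by itself and by `v`; one at distance two would share
with `v` a dominated vertex in `N₁`. -/
theorem IsLevels.isSol {v : Fin n} {N : Fin n → Bool} {w₀ : Fin n → ℕ∞}
    (h : IsLevels G v N A) (hw₀ : ∀ x, ¬ N x = true → w₀ x = w x)
    (hD : IsEDOn G (fun _ => true) D) (hv : D v = true) (hw : weight w D ≠ ⊤) :
    IsSol G A N w₀ (fun x => D x && !decide (x = v)) := by
  have hDv : ∀ x, (D x && !decide (x = v)) = true ↔ D x = true ∧ x ≠ v := by simp
  have huniq : ∀ x d e, D d = true → D e = true → (d = x ∨ G.Adj d x) → (e = x ∨ G.Adj e x) →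
      d = e := fun x d e hd he hdx hex => (hD.2 x rfl).unique ⟨hd, hdx⟩ ⟨he, hex⟩
  have hA : ∀ d, D d = true → d ≠ v → A d = true := by
    intro d hd hdv
    rcases h.cover d with h' | h' | h' | h'
    · exact absurd h' hdv
    · exact absurd (huniq d d v hd hv (.inl rfl) (.inr h')) hdv
    · obtain ⟨-, -, x, hvx, hxd⟩ := h.two d h'
      exact absurd (huniq x d v hd hv (.inr hxd.symm) (.inr hvx)) hdv
    · exact h'
  refine ⟨fun d hd => hA d ((hDv d).1 hd).1 ((hDv d).1 hd).2, fun x hx => ?_,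
    fun x _ d e hd he => huniq x d e ((hDv d).1 hd).1 ((hDv e).1 he).1, fun d hd => ?_⟩
  · obtain ⟨d, ⟨hd, hdx⟩, -⟩ := hD.2 x rfl
    refine ⟨d, (hDv d).2 ⟨hd, ?_⟩, hdx⟩
    rintro rfl
    have hx' : x ≠ d ∧ ¬ G.Adj d x := by
      rcases hx with hx | hx
      · exact ⟨(h.far x hx).1, (h.far x hx).2.1⟩
      · exact ⟨(h.two x hx).1, (h.two x hx).2.1⟩
    rcases hdx with rfl | hdx
    · exact hx'.1 rfl
    · exact hx'.2 hdx
  · have hd' := (hDv d).1 hd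
    rw [hw₀ d (h.disjoint d (hA d hd'.1 hd'.2))]
    exact weight_ne_top.1 hw d hd'.1

/-- `v` takes care of exactly `N[v]`, and no vertex of `A` reaches `N[v]`, being at distance at
least three from `v`. -/
theorem IsLevels.isEDOn {v : Fin n} {N E : Fin n → Bool} {w₀ : Fin n → ℕ∞}
    (h : IsLevels G v N A) (hE : IsSol G A N w₀ E) :
    IsEDOn G (fun _ => true) (fun x => E x || decide (x = v)) := by
  have hEv : ∀ x, (E x || decide (x = v)) = true ↔ E x = true ∨ x = v := by simp
  refine ⟨fun _ _ => rfl, fun x _ => ?_⟩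
  simp only [hEv]
  by_cases hx : x = v ∨ G.Adj v x
  · refine ⟨v, ⟨.inr rfl, hx.imp Eq.symm id⟩, ?_⟩
    rintro e ⟨he | he, hex⟩
    · have hfar := h.far e (hE.sub e he)
      rcases hx with rfl | hx
      · rcases hex with rfl | hex
        · exact absurd rfl hfar.1
        · exact absurd hex.symm hfar.2.1
      · rcases hex with rfl | hex
        · exact absurd hx hfar.2.1
        · exact absurd hex.symm (hfar.2.2 x hx)
    · exact he
  · have hx' : A x = true ∨ N x = true := by
      rcases h.cover x with h' | h' | h' | h'
      · exact absurd (.inl h') hx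
      · exact absurd (.inr h') hx
      · exact .inr h'
      · exact .inl h'
    obtain ⟨d, hd, hdx⟩ := hE.dom x hx'
    refine ⟨d, ⟨.inl hd, hdx⟩, ?_⟩
    rintro e ⟨he | rfl, hex⟩
    · exact hE.uniq x hx' e d he hd hex hdx
    · exact absurd (hex.imp Eq.symm id) hx

/-- `best'` is a correct update of `best`. -/
structure IsUpdate (G : SimpleGraph (Fin n)) (w : Fin n → ℕ∞)
    (best best' : Option (ℕ∞ × (Fin n → Bool))) : Prop where
  stored : IsStored G (fun _ => true) w best → IsStored G (fun _ => true) w best'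
  mono : ∀ c, StoresLE best c → StoresLE best' c

theorem IsUpdate.refl (best : Option (ℕ∞ × (Fin n → Bool))) : IsUpdate G w best best :=
  ⟨id, fun _ => id⟩

variable [DecidableRel G.Adj] {wt : Fin n → ℕ∞}

/-- A round of the algorithm collects a solution as good as `D`. -/
theorem spec_solutions (hG : P6Free G) {v : Fin n} {N : Fin n → Bool} (h : IsLevels G v N A)
    {w₀ : Fin n → ℕ∞} (hw₀ : ∀ x, ¬ N x = true → w₀ x = w x) (hwN : ∀ x, N x = true → w₀ x = ⊤)
    {I : (Fin n → Bool) × (Fin n → Bool) × (Fin n → ℕ∞)} (hI : JoinReduced G A N w₀ I)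
    {C : Fin n → Fin n → Bool} {K : Fin n → Bool}
    (hC : ∀ x y, C x y = true ↔ Conn G I.1 x y)
    (hK : ∀ a, K a = true ↔ InCliqueComp G I.1 a) (hD : IsSol G A N w₀ D) :
    Spec (adjMat G) wt (.ite (any fun a => mem I.1 a &ₜ ∼ₜ (mem K a))
      (.elim
        (find fun b => mem N b &ₜ all fun a =>
          imp (mem I.1 a &ₜ ∼ₜ (mem K a)) (any fun y => entry C a y &ₜ nb b y)) .nil fun b =>
        .loop .nil fun q L =>
          .ite (mem I.1 q &ₜ nb b q &ₜ isFinite (.get ♯I.2.2 ♯q))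
            (.elim (componentReduction I.1 I.2.2 C K b q) ♯L fun R =>
              .lett (.fst ♯R) fun A₂ =>
              .lett (.snd ♯R) fun w₂ =>
              .elim (unipolarWED A₂ I.2.1 w₂) ♯L fun D => .cons ♯D ♯L)
            ♯L)
      (.elim (unipolarWED I.1 I.2.1 I.2.2) .nil fun D => .cons ♯D .nil) :
        Tm (Ty.den n) (.list .set))
      (fun L => ∃ E ∈ L, IsSol G A N w₀ E ∧ weight w E ≤ weight w D) := by
  have hsubA : ∀ x, I.1 x = true → A x = true := fun x hx => ((hI.memA x).1 hx).1
  have hsubN : ∀ x, I.2.1 x = true → N x = true := fun x hx => ((hI.memB x).1 hx).1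
  have hD₁ := hI.isSol hD
  have hwE : ∀ E, IsSol G I.1 I.2.1 I.2.2 E → weight I.2.2 E = weight w E := fun E hE =>
    weight_eq_of_eqOn fun x hx => by
      rw [hI.weight_eq (hE.fin x hx), hw₀ x (h.disjoint x (hsubA x (hE.sub x hx)))]
  refine .ite (fun hne => ?_) fun hcl => ?_
  · simp only [Tm.val, val_any, val_mem, Bool.and_eq_true, Bool.not_eq_true',
      ← Bool.not_eq_true, hK] at hne
    refine .elim (fun hnone => ?_) fun b hsome => ?_
    · exfalso
      obtain ⟨b, hb, hcon⟩ := h.exists_contact hI hG hne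
      rw [val_find_eq_none] at hnone
      refine hnone b ?_
      simp only [Tm.val, val_any, val_all, val_imp, val_mem, val_entry, val_nb, Bool.and_eq_true,
        Bool.not_eq_true', ← Bool.not_eq_true, hK, hC, adjMat_eq_true]
      exact ⟨hb, fun a ha => hcon a ha.1 ha.2⟩
    have hb := val_find_of_eq_some hsome
    simp only [Tm.val, val_any, val_all, val_imp, val_mem, val_entry, val_nb, Bool.and_eq_true,
      Bool.not_eq_true', ← Bool.not_eq_true, hK, hC, adjMat_eq_true] at hb
    obtain ⟨hbN, hcon⟩ := hb
    -- `b` is taken from `N` and may have been deleted by join-reduction, so its unique dominator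
    -- `q` is obtained from the instance before reduction.
    obtain ⟨q, hq, hqb⟩ := hD.dom b (.inr hbN)
    have hbq : G.Adj b q :=
      (hqb.resolve_left fun e => h.disjoint q (hD.sub q hq) (e ▸ hbN)).symm
    refine Spec.loop_reaches (P := fun L : Ty.den n (.list .set) =>
      ∃ E ∈ L, IsSol G A N w₀ E ∧ weight w E ≤ weight w D) q (fun q' L hL => ?_) fun L => ?_
    · refine .ite (fun _ => .elim (fun _ => hL) fun R _ => .lett_eq (.lett_eq
        (.elim (fun _ => hL) fun E _ => ?_))) fun _ => hL
      obtain ⟨E', hE', hE''⟩ := hL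
      exact ⟨E', List.mem_cons_of_mem _ hE', hE''⟩
    refine .ite (fun _ => ?_) fun hnot => ?_
    · obtain ⟨Y, hY, hnone, hsome⟩ := spec_componentReduction (wt := wt) (w := I.2.2) hC hK b q
      have S : ReductionSetup G I.1 I.2.1 I.2.2 D b q Y :=
        ⟨⟨hY, hD₁.sub q hq, hbq, fun y z z' hy hz hz' =>
            h.no_path hG hbN (hsubA y hy) (hsubA z hz) (hsubA z' hz')⟩, hD₁, hq,
          fun d hd hbd => hD.neighbor_unique hbN hd hq hbd hbq,
          fun a ha hKa => hcon a ⟨ha, hKa⟩⟩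
      refine .elim (fun hv => ?_) fun R hR => .lett_eq (.lett_eq ?_)
      · obtain ⟨y, hy, hu⟩ := hnone hv
        obtain ⟨u, hu₁, hu₂⟩ := S.exists_universal hy
        exact absurd hu₂ (hu u hu₁)
      obtain ⟨-, hA₂, hw₂, hw₂'⟩ := hsome R hR
      simp only [Tm.val]
      have hsub₂ : ∀ x, R.1 x = true → A x = true := fun x hx => hsubA x (S.subset hA₂ hx)
      have huni : Spec (adjMat G) wt (unipolarWED (rep := Ty.den n) R.1 I.2.1 R.2) _ :=
        spec_unipolarWED (S.cliqueComps hA₂) (h.noMutualOvertaking hG hsub₂ hsubN)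
        (fun x hx hx' => h.disjoint x (hsub₂ x hx) (hsubN x hx'))
        fun x hx => hw₂' x fun hx' => h.disjoint x (hsub₂ x hx') (hsubN x hx)
      have hD₂ : IsSol G R.1 I.2.1 R.2 D := S.isSol hA₂ hw₂
      obtain ⟨E, hE, hED⟩ := huni.2 D hD₂
      have hsolE := huni.1 E hE
      refine .elim (fun hn => ?_) fun E' hE' => ?_
      · rw [hE] at hn
        cases hn
      · rw [hE, Option.some.injEq] at hE'
        subst hE'
        have hE₁ := S.isSol_of_isSol hA₂ hw₂ hsolE
        refine ⟨E, List.mem_cons_self, hI.isSol_of_isSol hE₁, ?_⟩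
        rwa [weight_eq_of_eqOn fun x hx => hw₂ x (hsolE.sub x hx),
          weight_eq_of_eqOn (w := R.2) fun x hx => hw₂ x (hD₂.sub x hx), hwE E hE₁,
          hwE D hD₁] at hED
    · refine absurd ?_ hnot
      simp only [Tm.val, val_mem, val_nb, Bool.and_eq_true, val_isFinite, adjMat_eq_true]
      exact ⟨hD₁.sub q hq, hbq, hD₁.fin q hq⟩
  · simp only [Tm.val, val_any, val_mem, Bool.and_eq_true, Bool.not_eq_true',
      ← Bool.not_eq_true, hK] at hcl
    push Not at hcl
    have hcliques : CliqueComps G I.1 := fun x y hxy =>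
      (hcl x hxy.left).2 x y (.refl hxy.left) hxy
    have huni : Spec (adjMat G) wt (unipolarWED (rep := Ty.den n) I.1 I.2.1 I.2.2) _ :=
      spec_unipolarWED hcliques (h.noMutualOvertaking hG hsubA hsubN)
      (fun x hx hx' => h.disjoint x (hsubA x hx) (hsubN x hx'))
      fun x hx => (hI.weight_eq_or x).elim (fun e => e.trans (hwN x (hsubN x hx))) id
    obtain ⟨E, hE, hED⟩ := huni.2 D hD₁
    have hsolE := huni.1 E hE
    refine .elim (fun hn => ?_) fun E' hE' => ?_
    · rw [hE] at hn
      cases hn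
    · rw [hE, Option.some.injEq] at hE'
      subst hE'
      refine ⟨E, List.mem_cons_self, hI.isSol_of_isSol hsolE, ?_⟩
      rwa [hwE E hsolE, hwE D hD₁] at hED

theorem spec_wedRound (hG : P6Free G) (hconn : G.Connected) (w : Fin n → ℕ∞) (v : Fin n)
    (best : Option (ℕ∞ × (Fin n → Bool))) :
    Spec (adjMat G) wt (wedRound (rep := Ty.den n) w v best) (fun best' =>
      IsUpdate G w best best' ∧ ∀ D, IsEDOn G (fun _ => true) D → weight w D ≠ ⊤ → D v = true →
        StoresLE best' (weight w D)) := by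
  refine .lett (P := fun S : Ty.den n .set => ∀ u, @Eq Bool (S u) true ↔ G.Adj v u)
    (by intro u; simp) fun N₁ h₁ => ?_
  refine .lett (P := fun S : Ty.den n .set => ∀ u, @Eq Bool (S u) true ↔
    u ≠ v ∧ ¬ G.Adj v u ∧ ∃ x, G.Adj v x ∧ G.Adj x u) ?_ fun N₂ h₂ => ?_
  · intro u
    simp only [Tm.val, val_any, val_mem, val_nb, Bool.and_eq_true, Bool.not_eq_true',
      ← Bool.not_eq_true, h₁, adjMat_eq_true]
    exact and_congr (not_congr decide_eq_true_iff) Iff.rfl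
  refine .lett (P := fun S : Ty.den n .set => ∀ u, @Eq Bool (S u) true ↔
    ¬ G.Adj v u ∧ ¬ N₂ u = true ∧ ∃ x, N₂ x = true ∧ G.Adj x u) ?_ fun N₃ h₃ => ?_
  · intro u
    simp only [Tm.val, val_any, val_mem, val_nb, Bool.and_eq_true, Bool.not_eq_true',
      ← Bool.not_eq_true, h₁, adjMat_eq_true]
  refine .lett (P := fun S : Ty.den n .set => ∀ u, @Eq Bool (S u) true ↔
    ¬ N₂ u = true ∧ ¬ N₃ u = true ∧ ∃ x, N₃ x = true ∧ G.Adj x u) ?_ fun N₄ h₄ => ?_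
  · intro u
    simp only [Tm.val, val_any, val_mem, val_nb, Bool.and_eq_true, Bool.not_eq_true',
      ← Bool.not_eq_true, adjMat_eq_true]
  refine .lett (P := fun S : Ty.den n .set => ∀ u, @Eq Bool (S u) true ↔
    N₃ u = true ∨ N₄ u = true) (by intro u; simp) fun A hA => ?_
  have hlev : IsLevels G v N₂ A := isLevels_of_connected hG hconn h₂ h₃ h₄ hA
  refine .lett (P := fun w₀ : Ty.den n .wts => (∀ x, ¬ N₂ x = true → w₀ x = w x) ∧
    ∀ x, N₂ x = true → w₀ x = (⊤ : ℕ∞)) ⟨fun x hx => ?_, fun x hx => ?_⟩ fun w₀ hw₀ => ?_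
  · exact (val_ite_neg (by simpa using hx) : Tm.val (adjMat G) wt (Tm.ite (mem N₂ x)
      (.const ⊤) (.get ♯w ♯x)) = _).trans rfl
  · exact (val_ite_pos (by simpa using hx) : Tm.val (adjMat G) wt (Tm.ite (mem N₂ x)
      (.const ⊤) (.get ♯w ♯x)) = _).trans rfl
  obtain ⟨hw₀, hwN⟩ := hw₀
  have hjoin := spec_joinReduction (G := G) (wt := wt) A N₂ w₀
  refine .elim (fun hnone => ⟨IsUpdate.refl best, fun D hD hwD hv => ?_⟩) fun I hI => ?_
  · obtain ⟨I, hI, -⟩ := hjoin.exists_of_isSol (hlev.isSol hw₀ hD hv hwD)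
    rw [hnone] at hI
    cases hI
  rw [Spec, hI] at hjoin
  replace hjoin : JoinReduced G A N₂ w₀ I := hjoin
  refine .lett_eq (.lett_eq (.lett_eq ?_))
  simp only [Tm.val]
  refine .lett (P := fun C : Ty.den n .mat => ∀ x y, @Eq Bool (C x y) true ↔ Conn G I.1 x y)
    (val_components _) fun C hC => ?_
  refine .lett (P := fun K : Ty.den n .set => ∀ a, @Eq Bool (K a) true ↔ InCliqueComp G I.1 a)
    (val_cliqueComponents hC) fun K hK => ?_
  refine .lett (P := fun L : Ty.den n (.list .set) => ∀ D, IsSol G A N₂ w₀ D →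
    ∃ E ∈ L, IsSol G A N₂ w₀ E ∧ weight w E ≤ weight w D)
    (fun D hD => spec_solutions hG hlev hw₀ hwN hjoin hC hK hD) fun L hL => ?_
  refine .lett_eq ?_
  refine .and ⟨fun hst => ?_, fun c hc => ?_⟩ fun D hD hwD hv => ?_
  · exact Spec.each_preserves (P := fun best : Ty.den n (.opt (.prod .num .set)) =>
      IsStored G (fun _ => true) w best) hst fun E s _ hs => .lett_eq hs.improve
  · exact Spec.each_preserves (P := fun best : Ty.den n (.opt (.prod .num .set)) =>
      StoresLE best c) hc fun E s _ hs => .lett_eq hs.improve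
  · obtain ⟨E, hE, hsolE, hle⟩ := hL _ (hlev.isSol hw₀ hD hv hwD)
    refine Spec.each_reaches (P := fun best : Ty.den n (.opt (.prod .num .set)) =>
      StoresLE best (weight w D)) E hE (fun E s hs => .lett_eq hs.improve) fun s => .lett_eq ?_
    rw [val_insertVert]
    have hEv : E v = false := by
      rw [← Bool.not_eq_true]
      exact fun h => (hlev.far v (hsolE.sub v h)).1 rfl
    have hDw : weight w D = w v + weight w fun x => D x && !decide (x = v) := by
      rw [← weight_insert w _ (by simp)]
      congr 1
      funext x
      by_cases hx : x = v <;> simp [hx, hv]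
    have hfin : weight w (fun x => E x || decide (x = v)) ≤ weight w D := by
      rw [weight_insert w E hEv, hDw]
      gcongr
    exact (storesLE_improve (hlev.isEDOn hsolE) (ne_top_of_le_ne_top hwD hfin)).mono hfin

theorem isWEDAnswer_wedOutput (hG : P6Free G) (hconn : G.Connected) (w : Fin n → ℕ∞) :
    IsWEDAnswer G w (wedOutput G w) := by
  suffices Spec (adjMat G) w (wedAlgorithm (rep := Ty.den n)) (IsWEDAnswer G w) from this
  refine .lett (P := fun w' : Ty.den n .wts => w' = w) rfl fun w' hw' => .lett_eq ?_
  subst hw'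
  refine .elim (fun hnone => ?_) fun v₀ _ => ?_
  · exfalso
    have := hconn.nonempty.some
    refine Spec.loop_reaches (P := fun m : Ty.den n (.opt .vert) => m ≠ none) this
      (fun x s hs => ?_) (fun s => ?_) hnone
    all_goals
      refine .elim (fun _ => ?_) fun y hy => .ite (fun _ => ?_) fun _ => ?_
      · exact Option.some_ne_none _
      · rw [Tm.val] at hy
        rw [Spec, Tm.val, hy]
        exact Option.some_ne_none _
      · exact Option.some_ne_none _
  refine .lett (P := fun best : Ty.den n (.opt (.prod .num .set)) =>
    IsStored G (fun _ => true) w' best ∧ ∀ D, IsEDOn G (fun _ => true) D → weight w' D ≠ ⊤ →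
      StoresLE best (weight w' D)) (.and ?_ fun D hD hwD => ?_) fun best hbest => ?_
  · exact .loop_preserves (fun p hp => by cases hp) fun v s hs => .ite
      (fun _ => (spec_wedRound hG hconn w' v s).1.stored hs) fun _ => hs
  -- The round that finds `D` is that of the dominator of `v₀` in `D`.
  · obtain ⟨v, ⟨hv, hvv⟩, -⟩ := hD.2 v₀ rfl
    refine Spec.loop_reaches (P := fun best : Ty.den n (.opt (.prod .num .set)) =>
      StoresLE best (weight w' D)) v (fun v s hs => .ite
      (fun _ => (spec_wedRound hG hconn w' v s).1.mono _ hs) fun _ => hs) fun s => .ite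
      (fun _ => (spec_wedRound hG hconn w' v s).2 D hD hwD hv) fun hn => absurd ?_ hn
    simpa using hvv
  · obtain ⟨hst, hle⟩ := hbest
    have hED : ∀ D : Finset (Fin n), IsEfficientDominating G D →
        IsEDOn G (fun _ => true) (fun x => decide (x ∈ D)) ∧
          setWeight w' D = weight w' fun x => decide (x ∈ D) := by
      intro D hD
      have hD' : D = Finset.univ.filter fun x => decide (x ∈ D) = true := by ext; simp
      refine ⟨(isEDOn_univ fun _ => rfl).2 (by rwa [← hD']), ?_⟩
      rw [← setWeight_filter, ← hD']
    cases best with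
    | none =>
      intro D hD
      obtain ⟨h₁, h₂⟩ := hED D hD
      by_contra hne
      rw [h₂] at hne
      obtain ⟨p, hp, -⟩ := hle _ h₁ hne
      cases hp
    | some p =>
      obtain ⟨h₁, h₂, h₃⟩ := hst p rfl
      refine ⟨(isEDOn_univ fun _ => rfl).1 h₂, ?_, fun D hD => ?_⟩
      · rw [setWeight_filter]
        exact lt_top_iff_ne_top.2 (h₁ ▸ h₃)
      · rw [setWeight_filter]
        obtain ⟨h₄, h₅⟩ := hED D hD
        rw [h₅]
        by_cases hne : weight w' (fun x => decide (x ∈ D)) = ⊤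
        · rw [hne]
          exact le_top
        · obtain ⟨p', hp', hle'⟩ := hle _ h₄ hne
          cases hp'
          exact h₁ ▸ hle'

end

section

/-! ## Bounding the number of steps -/

section Cost

variable {n : ℕ} {g : Fin n → Fin n → Bool} {wt : Fin n → ℕ∞} {σ τ : Ty}

theorem loopCost_le_sum {α σ : Type} {step : α → σ → σ} {c : α → σ → ℕ} {f : α → ℕ}
    (h : ∀ a s, c a s ≤ f a) (l : List α) (s : σ) :
    loopCost step c l s ≤ (l.map fun a => 1 + f a).sum := by
  induction l generalizing s with
  | nil => simp [loopCost]
  | cons a l ih =>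
    simp only [loopCost, List.map_cons, List.sum_cons]
    have := ih (step a s)
    have := h a s
    omega

theorem loopCost_le {α σ : Type} {step : α → σ → σ} {c : α → σ → ℕ} {b : ℕ}
    (h : ∀ a s, c a s ≤ b) (l : List α) (s : σ) :
    loopCost step c l s ≤ l.length * (1 + b) := by
  simpa using loopCost_le_sum h l s

/-- For loops whose state is a growing list: the bound on one iteration is needed only while the
list is short, and each iteration adds at most one entry. -/
theorem loopCost_le_of_measure {α σ : Type} {step : α → σ → σ} {c : α → σ → ℕ} {b M : ℕ}
    (μ : σ → ℕ) (hμ : ∀ a s, μ (step a s) ≤ μ s + 1) (h : ∀ a s, μ s ≤ M → c a s ≤ b)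
    (l : List α) (s : σ) (hs : μ s + l.length ≤ M) :
    loopCost step c l s ≤ l.length * (1 + b) := by
  induction l generalizing s with
  | nil => simp [loopCost]
  | cons a l ih =>
    simp only [loopCost, List.length_cons] at hs ⊢
    have h₁ := ih (step a s) (by have := hμ a s; omega)
    have h₂ := h a s (by omega)
    rw [Nat.succ_mul]
    omega

theorem foldl_measure_le {α σ : Type} {step : σ → α → σ} (μ : σ → ℕ) {k : ℕ}
    (hμ : ∀ s a, μ (step s a) ≤ μ s + k) (l : List α) (s : σ) :
    μ (l.foldl step s) ≤ μ s + l.length * k := by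
  induction l generalizing s with
  | nil => simp
  | cons a l ih =>
    have := ih (step s a)
    have := hμ s a
    simp only [List.foldl_cons, List.length_cons]
    rw [Nat.succ_mul]
    omega

/-- The term `t` is executed in at most `b` steps; the bound is found by instance search. -/
class CostLe (g : Fin n → Fin n → Bool) (wt : Fin n → ℕ∞) (t : Tm (Ty.den n) τ)
    (b : outParam ℕ) : Prop where
  le : t.cost g wt ≤ b

variable {a b c : ℕ}

instance (x : Ty.den n τ) : CostLe g wt (.var x) 1 := ⟨le_rfl⟩

instance {t : Tm (Ty.den n) σ} {k : Ty.den n σ → Tm (Ty.den n) τ} [ht : CostLe g wt t a]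
    [hk : ∀ x, CostLe g wt (k x) b] : CostLe g wt (.lett t k) (1 + a + b) :=
  ⟨Nat.add_le_add (Nat.add_le_add_left ht.le 1) (hk _).le⟩

instance : CostLe g wt .tt 1 := ⟨le_rfl⟩

instance : CostLe g wt .ff 1 := ⟨le_rfl⟩

instance {t : Tm (Ty.den n) .bool} [ht : CostLe g wt t a] : CostLe g wt (.not t) (1 + a) :=
  ⟨Nat.add_le_add_left ht.le 1⟩

instance {s t : Tm (Ty.den n) .bool} [hs : CostLe g wt s a] [ht : CostLe g wt t b] :
    CostLe g wt (.and s t) (1 + a + b) :=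
  ⟨Nat.add_le_add (Nat.add_le_add_left hs.le 1) ht.le⟩

instance {s t : Tm (Ty.den n) .bool} [hs : CostLe g wt s a] [ht : CostLe g wt t b] :
    CostLe g wt (.or s t) (1 + a + b) :=
  ⟨Nat.add_le_add (Nat.add_le_add_left hs.le 1) ht.le⟩

/-- The branches contribute their sum rather than the maximum, so that all bounds remain polynomials
in `n` to which `linarith` applies. -/
theorem cost_ite_le {t : Tm (Ty.den n) .bool} {s s' : Tm (Ty.den n) τ} (ht : t.cost g wt ≤ a)
    (hs : @Eq Bool (t.val g wt) true → s.cost g wt ≤ b)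
    (hs' : ¬ @Eq Bool (t.val g wt) true → s'.cost g wt ≤ c) :
    (Tm.ite t s s').cost g wt ≤ 1 + a + (b + c) := by
  rw [Tm.cost]
  refine Nat.add_le_add (Nat.add_le_add_left ht 1) ?_
  split_ifs with h
  · exact (hs h).trans (Nat.le_add_right b c)
  · exact (hs' h).trans (Nat.le_add_left c b)

instance {t : Tm (Ty.den n) .bool} {s s' : Tm (Ty.den n) τ} [ht : CostLe g wt t a]
    [hs : CostLe g wt s b] [hs' : CostLe g wt s' c] :
    CostLe g wt (.ite t s s') (1 + a + (b + c)) :=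
  ⟨cost_ite_le ht.le (fun _ => hs.le) fun _ => hs'.le⟩

instance {s t : Tm (Ty.den n) .vert} [hs : CostLe g wt s a] [ht : CostLe g wt t b] :
    CostLe g wt (.eqv s t) (1 + a + b) :=
  ⟨Nat.add_le_add (Nat.add_le_add_left hs.le 1) ht.le⟩

instance {s t : Tm (Ty.den n) .vert} [hs : CostLe g wt s a] [ht : CostLe g wt t b] :
    CostLe g wt (.adj s t) (1 + a + b) :=
  ⟨Nat.add_le_add (Nat.add_le_add_left hs.le 1) ht.le⟩

instance {t : Tm (Ty.den n) .vert} [ht : CostLe g wt t a] : CostLe g wt (.wt t) (1 + a) :=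
  ⟨Nat.add_le_add_left ht.le 1⟩

instance (x : ℕ∞) : CostLe g wt (.const x) 1 := ⟨le_rfl⟩

instance {s t : Tm (Ty.den n) .num} [hs : CostLe g wt s a] [ht : CostLe g wt t b] :
    CostLe g wt (.add s t) (1 + a + b) :=
  ⟨Nat.add_le_add (Nat.add_le_add_left hs.le 1) ht.le⟩

instance {s t : Tm (Ty.den n) .num} [hs : CostLe g wt s a] [ht : CostLe g wt t b] :
    CostLe g wt (.le s t) (1 + a + b) :=
  ⟨Nat.add_le_add (Nat.add_le_add_left hs.le 1) ht.le⟩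

instance {s : Tm (Ty.den n) σ} {t : Tm (Ty.den n) τ} [hs : CostLe g wt s a]
    [ht : CostLe g wt t b] : CostLe g wt (.pair s t) (1 + a + b) :=
  ⟨Nat.add_le_add (Nat.add_le_add_left hs.le 1) ht.le⟩

instance {t : Tm (Ty.den n) (.prod σ τ)} [ht : CostLe g wt t a] : CostLe g wt (.fst t) (1 + a) :=
  ⟨Nat.add_le_add_left ht.le 1⟩

instance {t : Tm (Ty.den n) (.prod σ τ)} [ht : CostLe g wt t a] : CostLe g wt (.snd t) (1 + a) :=
  ⟨Nat.add_le_add_left ht.le 1⟩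

instance : CostLe g wt (.none : Tm (Ty.den n) (.opt τ)) 1 := ⟨le_rfl⟩

instance {t : Tm (Ty.den n) τ} [ht : CostLe g wt t a] : CostLe g wt (.some t) (1 + a) :=
  ⟨Nat.add_le_add_left ht.le 1⟩

theorem cost_elim_le {t : Tm (Ty.den n) (.opt σ)} {d : Tm (Ty.den n) τ}
    {k : Ty.den n σ → Tm (Ty.den n) τ} (ht : t.cost g wt ≤ a)
    (hd : t.val g wt = none → d.cost g wt ≤ b)
    (hk : ∀ x, t.val g wt = some x → (k x).cost g wt ≤ c) :
    (Tm.elim t d k).cost g wt ≤ 1 + a + (b + c) := by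
  rw [Tm.cost]
  refine Nat.add_le_add (Nat.add_le_add_left ht 1) ?_
  generalize t.val g wt = v at hd hk
  cases v with
  | none => exact (hd rfl).trans (Nat.le_add_right b c)
  | some x => exact (hk x rfl).trans (Nat.le_add_left c b)

instance {t : Tm (Ty.den n) (.opt σ)} {d : Tm (Ty.den n) τ} {k : Ty.den n σ → Tm (Ty.den n) τ}
    [ht : CostLe g wt t a] [hd : CostLe g wt d b] [hk : ∀ x, CostLe g wt (k x) c] :
    CostLe g wt (.elim t d k) (1 + a + (b + c)) :=
  ⟨cost_elim_le ht.le (fun _ => hd.le) fun x _ => (hk x).le⟩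

instance {f : Ty.den n .vert → Tm (Ty.den n) τ} [hf : ∀ x, CostLe g wt (f x) a] :
    CostLe g wt (.tab f) (1 + n * (1 + a)) := by
  refine ⟨?_⟩
  rw [Tm.cost]
  refine Nat.add_le_add_left ?_ 1
  calc _ ≤ ∑ _x : Fin n, (1 + a) := Finset.sum_le_sum fun x _ => Nat.add_le_add_left (hf x).le 1
    _ = _ := by simp

instance {s : Tm (Ty.den n) (.arr τ)} {t : Tm (Ty.den n) .vert} [hs : CostLe g wt s a]
    [ht : CostLe g wt t b] : CostLe g wt (.get s t) (1 + a + b) :=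
  ⟨Nat.add_le_add (Nat.add_le_add_left hs.le 1) ht.le⟩

instance : CostLe g wt (.nil : Tm (Ty.den n) (.list τ)) 1 := ⟨le_rfl⟩

instance {s : Tm (Ty.den n) τ} {t : Tm (Ty.den n) (.list τ)} [hs : CostLe g wt s a]
    [ht : CostLe g wt t b] : CostLe g wt (.cons s t) (1 + a + b) :=
  ⟨Nat.add_le_add (Nat.add_le_add_left hs.le 1) ht.le⟩

theorem cost_loop_le {i : Tm (Ty.den n) σ} {k : Ty.den n .vert → Ty.den n σ → Tm (Ty.den n) σ}
    (hi : i.cost g wt ≤ a) (hk : ∀ x s, (k x s).cost g wt ≤ b) :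
    (Tm.loop i k).cost g wt ≤ 1 + a + n * (1 + b) := by
  rw [Tm.cost]
  refine Nat.add_le_add (Nat.add_le_add_left hi 1) ?_
  simpa using loopCost_le (fun x s => hk x s) (List.finRange n) _

instance {i : Tm (Ty.den n) σ} {k : Ty.den n .vert → Ty.den n σ → Tm (Ty.den n) σ}
    [hi : CostLe g wt i a] [hk : ∀ x s, CostLe g wt (k x s) b] :
    CostLe g wt (.loop i k) (1 + a + n * (1 + b)) :=
  ⟨cost_loop_le hi.le fun x s => (hk x s).le⟩

/-- The number of iterations depends on the value of the list, so a bound on its length has to be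
supplied and cannot be composed from the syntax alone. -/
theorem cost_each_le {l : Tm (Ty.den n) (.list τ)} {i : Tm (Ty.den n) σ}
    {k : Ty.den n τ → Ty.den n σ → Tm (Ty.den n) σ} {m : ℕ} (hm : (l.val g wt).length ≤ m)
    (hl : l.cost g wt ≤ a) (hi : i.cost g wt ≤ b) (hk : ∀ x s, (k x s).cost g wt ≤ c) :
    (Tm.each l i k).cost g wt ≤ 1 + a + b + m * (1 + c) := by
  rw [Tm.cost]
  refine Nat.add_le_add (Nat.add_le_add (Nat.add_le_add_left hl 1) hi) ?_
  exact (loopCost_le (fun x s => hk x s) _ _).trans (Nat.mul_le_mul_right _ hm)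

theorem cost_lett_le {t : Tm (Ty.den n) σ} {k : Ty.den n σ → Tm (Ty.den n) τ}
    {P : Ty.den n σ → Prop} (ht : t.cost g wt ≤ a) (h : Spec g wt t P)
    (hk : ∀ x, P x → (k x).cost g wt ≤ b) : (Tm.lett t k).cost g wt ≤ 1 + a + b :=
  Nat.add_le_add (Nat.add_le_add_left ht 1) (hk _ h)

theorem cost_lett_eq_le {t : Tm (Ty.den n) σ} {k : Ty.den n σ → Tm (Ty.den n) τ}
    (ht : t.cost g wt ≤ a) (hk : (k (t.val g wt)).cost g wt ≤ b) :
    (Tm.lett t k).cost g wt ≤ 1 + a + b :=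
  Nat.add_le_add (Nat.add_le_add_left ht 1) hk

/-! ### Subroutines -/

instance {s t : Tm (Ty.den n) .bool} [CostLe g wt s a] [CostLe g wt t b] :
    CostLe g wt (imp s t) (1 + (1 + a) + b) := by
  unfold imp; infer_instance

instance {p : Ty.den n .vert → Tm (Ty.den n) .bool} [∀ x, CostLe g wt (p x) a] :
    CostLe g wt (any p) (1 + 1 + n * (1 + (1 + 1 + a))) := by
  unfold any; infer_instance

instance {p : Ty.den n .vert → Tm (Ty.den n) .bool} [∀ x, CostLe g wt (p x) a] :
    CostLe g wt (all p) (1 + 1 + n * (1 + (1 + 1 + a))) := by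
  unfold all; infer_instance

instance {p : Ty.den n .vert → Tm (Ty.den n) .bool} [∀ x, CostLe g wt (p x) a] :
    CostLe g wt (count p) (1 + 1 + n * (1 + (1 + a + (3 + 1)))) := by
  unfold count; infer_instance

instance {p : Ty.den n .vert → Tm (Ty.den n) .bool} [∀ x, CostLe g wt (p x) a] :
    CostLe g wt (find p) (1 + 1 + n * (1 + (1 + a + (2 + 1)))) := by
  unfold find; infer_instance

instance {s t : Tm (Ty.den n) .num} [CostLe g wt s a] [CostLe g wt t b] :
    CostLe g wt (eqNum s t) (1 + a + (1 + b + 7)) := by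
  unfold eqNum; infer_instance

instance {t : Tm (Ty.den n) .num} [CostLe g wt t a] : CostLe g wt (isFinite t) (1 + (2 + a)) := by
  unfold isFinite; infer_instance

instance (A : Ty.den n .set) (x : Ty.den n .vert) : CostLe g wt (mem (rep := Ty.den n) A x) 3 := by
  unfold mem; infer_instance

instance (M : Ty.den n .mat) (x y : Ty.den n .vert) :
    CostLe g wt (entry (rep := Ty.den n) M x y) 5 := by
  unfold entry; infer_instance

instance (x y : Ty.den n .vert) : CostLe g wt (nb (rep := Ty.den n) x y) 3 := by
  unfold nb; infer_instance

instance (x y : Ty.den n .vert) : CostLe g wt (clnb (rep := Ty.den n) x y) 7 := by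
  unfold clnb; infer_instance

instance (D : Ty.den n .set) (x : Ty.den n .vert) :
    CostLe g wt (insertVert (rep := Ty.den n) D x) (1 + n * 8) := by
  unfold insertVert; infer_instance

end Cost

end

/-! ### Polynomial bounds for the subroutines -/

section

section Cost

variable {n : ℕ} [NeZero n] {g : Fin n → Fin n → Bool} {wt : Fin n → ℕ∞} {σ τ : Ty}

omit [NeZero n] in
theorem CostLe.mono {t : Tm (Ty.den n) τ} {a b : ℕ} [h : CostLe g wt t a] (hab : a ≤ b) :
    CostLe g wt t b :=
  ⟨h.le.trans hab⟩

theorem pow_le_pow_chain (n : ℕ) [NeZero n] :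
    1 ≤ n ∧ n ≤ n ^ 2 ∧ n ^ 2 ≤ n ^ 3 ∧ n ^ 3 ≤ n ^ 4 ∧ n ^ 4 ≤ n ^ 5 ∧ n ^ 5 ≤ n ^ 6 := by
  have h : 1 ≤ n := NeZero.one_le
  exact ⟨h, Nat.le_self_pow two_ne_zero n, Nat.pow_le_pow_right h (by norm_num),
    Nat.pow_le_pow_right h (by norm_num), Nat.pow_le_pow_right h (by norm_num),
    Nat.pow_le_pow_right h (by norm_num)⟩

instance (A : Ty.den n .set) : CostLe g wt (components (rep := Ty.den n) A) (60 * n ^ 3) := by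
  obtain ⟨h₁, h₂, h₃, -⟩ := pow_le_pow_chain n
  unfold components
  exact CostLe.mono (by linarith)

instance (A : Ty.den n .set) (C : Ty.den n .mat) :
    CostLe g wt (universalVerts (rep := Ty.den n) A C) (60 * n ^ 2) := by
  obtain ⟨h₁, h₂, h₃, -⟩ := pow_le_pow_chain n
  unfold universalVerts
  exact CostLe.mono (by linarith)

instance (A : Ty.den n .set) (C : Ty.den n .mat) :
    CostLe g wt (cliqueComponents (rep := Ty.den n) A C) (100 * n ^ 3) := by
  obtain ⟨h₁, h₂, h₃, -⟩ := pow_le_pow_chain n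
  unfold cliqueComponents
  exact CostLe.mono (by linarith)

instance (S D : Ty.den n .set) : CostLe g wt (isED (rep := Ty.den n) S D) (100 * n ^ 2) := by
  obtain ⟨h₁, h₂, h₃, -⟩ := pow_le_pow_chain n
  unfold isED
  exact CostLe.mono (by linarith)

instance (w : Ty.den n .wts) (D : Ty.den n .set) :
    CostLe g wt (weightOf (rep := Ty.den n) w D) (30 * n) := by
  obtain ⟨h₁, h₂, h₃, -⟩ := pow_le_pow_chain n
  unfold weightOf
  exact CostLe.mono (by linarith)

instance (S D : Ty.den n .set) (w : Ty.den n .wts) (best : Ty.den n (.opt (.prod .num .set))) :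
    CostLe g wt (improve (rep := Ty.den n) S w D best) (200 * n ^ 2) := by
  obtain ⟨h₁, h₂, h₃, -⟩ := pow_le_pow_chain n
  unfold improve
  exact CostLe.mono (by linarith)

set_option synthInstance.maxSize 1000 in
instance (A B : Ty.den n .set) (w : Ty.den n .wts) :
    CostLe g wt (joinReduction (rep := Ty.den n) A B w) (500 * n ^ 3) := by
  obtain ⟨h₁, h₂, h₃, -⟩ := pow_le_pow_chain n
  unfold joinReduction
  exact CostLe.mono (by linarith)

set_option synthInstance.maxSize 1000 in
instance (A : Ty.den n .set) (w : Ty.den n .wts) (C : Ty.den n .mat) (K : Ty.den n .set)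
    (b q : Ty.den n .vert) :
    CostLe g wt (componentReduction (rep := Ty.den n) A w C K b q) (500 * n ^ 3) := by
  obtain ⟨h₁, h₂, h₃, -⟩ := pow_le_pow_chain n
  unfold componentReduction
  exact CostLe.mono (by linarith)

omit [NeZero n] in
theorem length_representatives_le (P : Fin n → Bool) (C : Fin n → Fin n → Bool) :
    ((representatives (rep := Ty.den n) P C).val g wt).length ≤ n := by
  unfold representatives
  rw [Tm.val]
  refine (foldl_measure_le (k := 1) List.length (fun s x => ?_) (List.finRange n) _).trans (by simp)
  refine Spec.ite (Q := fun r : Ty.den n (.list .vert) => r.length ≤ s.length + 1) (fun _ => ?_)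
    fun _ => ?_
  · exact (List.length_cons).le
  · exact Nat.le_succ _

instance (P : Ty.den n .set) (C : Ty.den n .mat) :
    CostLe g wt (representatives (rep := Ty.den n) P C) (60 * n ^ 2) := by
  obtain ⟨h₁, h₂, h₃, -⟩ := pow_le_pow_chain n
  refine ⟨?_⟩
  unfold representatives
  rw [Tm.cost]
  -- Each test runs through the list of representatives found so far, which has at most `n` entries.
  have key := loopCost_le_of_measure (M := n) (b := 40 * n)
    (step := fun x (s : Ty.den n (.list .vert)) => Tm.val g wt (Tm.ite
      (mem P x &ₜ ∼ₜ (.each ♯s .ff fun r s => ♯s |ₜ entry C r x)) (.cons ♯x ♯s) ♯s))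
    (c := fun x (s : Ty.den n (.list .vert)) => Tm.cost g wt (Tm.ite
      (mem P x &ₜ ∼ₜ (.each ♯s .ff fun r s => ♯s |ₜ entry C r x)) (.cons ♯x ♯s) ♯s))
    List.length (fun x s => ?_) (fun x s hs => ?_) (List.finRange n) ([] : List (Fin n))
    (by simp)
  · rw [List.length_finRange] at key
    refine (Nat.add_le_add_left key _).trans ?_
    rw [Tm.cost]
    linarith
  · refine Spec.ite (Q := fun r : Ty.den n (.list .vert) => r.length ≤ s.length + 1) (fun _ => ?_)
      fun _ => ?_
    · exact (List.length_cons).le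
    · exact Nat.le_succ _
  · have h := cost_each_le (g := g) (wt := wt) (l := .var (τ := .list .vert) s)
      (i := (.ff : Tm (Ty.den n) .bool)) (k := fun r s => ♯s |ₜ entry C r x) (m := n) hs
      (CostLe.le) (CostLe.le) (fun x s => CostLe.le)
    have : CostLe g wt (.each (.var (τ := .list .vert) s) (.ff : Tm (Ty.den n) .bool)
      (fun r s => ♯s |ₜ entry C r x)) _ := ⟨h⟩
    exact (CostLe.mono (by linarith) : CostLe g wt _ _).le

instance (A : Ty.den n .set) (C : Ty.den n .mat) (b b' : Ty.den n .vert) :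
    CostLe g wt (arrow (rep := Ty.den n) A C b b') (300 * n ^ 2) := by
  obtain ⟨h₁, h₂, h₃, -⟩ := pow_le_pow_chain n
  unfold arrow
  have key : ∀ P : Ty.den n .set, CostLe g wt (.each (representatives P C) (.const 0)
      fun _ s => .add ♯s (.const 1)) _ := fun P =>
    ⟨cost_each_le (length_representatives_le P C) CostLe.le CostLe.le fun x s => CostLe.le⟩
  exact CostLe.mono (by linarith)

end Cost

end

/-! ### At most two distinguished components -/

section

variable {n : ℕ} {G : SimpleGraph (Fin n)} {A B : Fin n → Bool} {w : Fin n → ℕ∞}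

/-- After a neighbour `a` of a good vertex `b` has been fixed, at most two components are
distinguished. -/
theorem JoinReduced.not_three_distinguished (hA : CliqueComps G A) (hN : NoMutualOvertaking G A B)
    {a b : Fin n} (hgood : ∀ b', B b' = true → b' ≠ b → ¬ Arrow G A b b') (ha : A a = true) (hba : G.Adj b a)
    {A' : Fin n → Bool}
    (hA' : ∀ x, A' x = true ↔ x = a ∨ A x = true ∧ ¬ Conn G A a x ∧ ¬ G.Adj b x)
    {I : (Fin n → Bool) × (Fin n → Bool) × (Fin n → ℕ∞)} (hI : JoinReduced G A' B w I)
    (x : Fin 3 → Fin n) (hx : ∀ i, IsDistinguished G A' I.2.1 (x i)) :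
    ∃ i j, i ≠ j ∧ Conn G A' (x i) (x j) := by
  by_contra! hconn
  have hsub : ∀ x, A' x = true → A x = true := fun x hx => by
    rcases (hA' x).1 hx with rfl | hx
    · exact ha
    · exact hx.1
  have hmono : ∀ {x y}, Conn G A' x y → Conn G A x y := fun hxy =>
    hxy.mono fun z hz => hsub z hz.right
  have hconn' : ∀ {x y}, A' x = true → A' y = true → Conn G A x y → Conn G A' x y := by
    intro x y hx hy hxy
    rcases hA x y hxy with rfl | hadj
    · exact .refl hx
    · exact .of_adj hx hy hadj
  have haA' : A' a = true := (hA' a).2 (.inl rfl)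
  have hcomp : ∀ y, Conn G A' a y → y = a := fun y hy =>
    ((hA' y).1 hy.right).resolve_right fun h => h.2.1 (hmono hy)
  have hB' : ∀ b', I.2.1 b' = true → B b' = true ∧ ∀ y, ¬ Joins G A' b' y := fun b' hb' =>
    (hI.memB b').1 hb'
  -- The component of `a` is now `{a}`, so `b` has a join to it and is deleted by join-reduction.
  have hbB : ¬ I.2.1 b = true := fun h =>
    (hB' b h).2 a ⟨haA', fun y hy => hcomp y hy ▸ hba⟩
  -- no component of the `x i` has a neighbour of `b`
  have hnb : ∀ i y, Conn G A' (x i) y → ¬ G.Adj b y := by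
    intro i y hy
    -- The single vertex `a` cannot be distinguished, and all other vertices of `A'` are
    -- non-neighbours of `b` by construction.
    rcases (hA' y).1 hy.right with rfl | h
    · obtain ⟨-, b', -, ⟨u, hu, hbu⟩, v, hv, hbv⟩ := hx i
      exact absurd (hcomp u (hy.symm.trans hu) ▸ hbu) (hcomp v (hy.symm.trans hv) ▸ hbv)
    · exact h.2.2
  have hmiss : ∀ b', I.2.1 b' = true → ∀ i, ∃ z, Conn G A' (x i) z ∧ ¬ G.Adj b' z := by
    intro b' hb' i
    by_contra! h
    exact (hB' b' hb').2 (x i) ⟨(hx i).1, h⟩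
  set S : Fin n → Set (Fin 3) := fun b' => {i | ∃ y, Conn G A' (x i) y ∧ G.Adj b' y} with hS
  -- If `b'` contacts a component missed by `b''` and vice versa, each overtakes the other, as
  -- neither has a join; the two components would then coincide.
  have hchain : ∀ b' b'', I.2.1 b' = true → I.2.1 b'' = true → S b' ⊆ S b'' ∨ S b'' ⊆ S b' := by
    intro b' b'' hb' hb''
    by_contra! h
    obtain ⟨⟨i, hi', hi''⟩, ⟨j, hj'', hj'⟩⟩ := h.imp Set.not_subset.1 Set.not_subset.1
    obtain ⟨y, hy, hby⟩ := hi'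
    obtain ⟨z, hz, hbz⟩ := hmiss b' hb' i
    obtain ⟨y', hy', hby'⟩ := hj''
    obtain ⟨z', hz', hbz'⟩ := hmiss b'' hb'' j
    have h₁ : Overtakes G A b'' b' y := overtakes_of_cliqueComps hA (hmono (hy.symm.trans hz))
      (fun h => hi'' ⟨y, hy, h⟩) (fun h => hi'' ⟨z, hz, h⟩) hby hbz
    have h₂ : Overtakes G A b' b'' y' := overtakes_of_cliqueComps hA (hmono (hy'.symm.trans hz'))
      (fun h => hj' ⟨y', hy', h⟩) (fun h => hj' ⟨z', hz', h⟩) hby' hbz'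
    have h₃ := hconn' hy.right hy'.right (hN b'' b' y y' (hB' _ hb'').1 (hB' _ hb').1 h₁ h₂)
    refine hconn i j (fun hij => hj' (hij ▸ ⟨y, hy, hby⟩)) ((hy.trans h₃).trans hy'.symm)
  choose c hc hci using fun i => (show ∃ b', I.2.1 b' = true ∧ i ∈ S b' from
    let ⟨_, b', hb', h, _⟩ := hx i
    ⟨b', hb', h⟩)
  -- Each of the three components is contacted by some vertex, so the largest set of the chain
  -- contains all three.
  obtain ⟨b', hb', hall⟩ : ∃ b', I.2.1 b' = true ∧ ∀ i, i ∈ S b' := by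
    have h2 : ∃ b', I.2.1 b' = true ∧ 0 ∈ S b' ∧ 1 ∈ S b' := by
      rcases hchain _ _ (hc 0) (hc 1) with h | h
      · exact ⟨c 1, hc 1, h (hci 0), hci 1⟩
      · exact ⟨c 0, hc 0, hci 0, h (hci 1)⟩
    obtain ⟨d, hd, h0, h1⟩ := h2
    rcases hchain _ _ hd (hc 2) with h | h
    · exact ⟨c 2, hc 2, Fin.forall_fin_succ.2 ⟨h h0, Fin.forall_fin_two.2 ⟨h h1, hci 2⟩⟩⟩
    · exact ⟨d, hd, Fin.forall_fin_succ.2 ⟨h0, Fin.forall_fin_two.2 ⟨h1, h (hci 2)⟩⟩⟩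
  choose y hy hby using hall
  choose z hz hbz using hmiss b' hb'
  -- `b` misses all three components, so `b'` overtakes `b` in each and `b → b'`, contrary to the
  -- choice of `b`.
  have hov : ∀ i, Overtakes G A b b' (y i) := fun i =>
    overtakes_of_cliqueComps hA (hmono ((hy i).symm.trans (hz i))) (hnb i _ (hy i))
      (hnb i _ (hz i)) (hby i) (hbz i)
  have hne : ∀ i j, i ≠ j → ¬ Conn G A (y i) (y j) := fun i j hij h =>
    hconn i j hij (((hy i).trans (hconn' (hy i).right (hy j).right h)).trans (hy j).symm)
  exact hgood b' (hB' b' hb').1 (fun e => hbB (e ▸ hb'))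
    ⟨y 0, y 1, y 2, hov 0, hov 1, hov 2, hne _ _ (by decide), hne _ _ (by decide),
      hne _ _ (by decide)⟩

end

section

variable {n : ℕ} [NeZero n] {G : SimpleGraph (Fin n)} [DecidableRel G.Adj] {A B : Fin n → Bool}
  {w wt : Fin n → ℕ∞}

/-! ## Running times -/

/-- The candidate sets in the list `L`, extended by a vertex of the component of `r`. -/
def extendCandidates {rep : Ty → Type} (w : rep .wts) (C : rep .mat) (r : rep .vert)
    (L : rep (.list .set)) : Tm rep (.list .set) :=
  .each ♯L .nil fun D L₁ =>
    .loop ♯L₁ fun x L₂ =>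
      .ite (entry C r x &ₜ isFinite (.get ♯w ♯x)) (.cons (insertVert D x) ♯L₂) ♯L₂

section

variable {g : Fin n → Fin n → Bool}

omit [NeZero n] in
theorem length_extendCandidates_le (C : Ty.den n .mat) (r : Ty.den n .vert)
    (L : Ty.den n (.list .set)) :
    ((extendCandidates (rep := Ty.den n) w C r L).val g wt).length ≤ L.length * n := by
  unfold extendCandidates
  rw [Tm.val]
  refine (foldl_measure_le (k := n) List.length (fun s D => ?_) L []).trans (by simp)
  rw [Tm.val]
  refine (foldl_measure_le (k := 1) List.length (fun s x => ?_) (List.finRange n) s).trans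
    (by simp)
  refine Spec.ite (Q := fun r : Ty.den n (.list .set) => r.length ≤ s.length + 1) (fun _ => ?_)
    fun _ => ?_
  · exact (List.length_cons).le
  · exact Nat.le_succ _

theorem cost_extendCandidates_le (C : Ty.den n .mat) (r : Ty.den n .vert)
    {L : Ty.den n (.list .set)} {m : ℕ} (hL : L.length ≤ m) :
    (extendCandidates (rep := Ty.den n) w C r L).cost g wt ≤ 3 + m * (60 * n ^ 2) := by
  obtain ⟨h₁, h₂, h₃, -⟩ := pow_le_pow_chain n
  unfold extendCandidates
  refine (cost_each_le (l := .var L) (m := m) (c := 59 * n ^ 2) hL CostLe.le CostLe.le fun x s =>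
    (CostLe.mono (by linarith) : CostLe g wt _ _).le).trans ?_
  refine Nat.add_le_add_left (Nat.mul_le_mul_left m ?_) 3
  linarith

/-- Extending a list of candidate sets for at most two components. -/
theorem foldl_extendCandidates_le (C : Ty.den n .mat) {l : List (Fin n)} (hl : l.length ≤ 2)
    (D : Ty.den n .set) :
    (l.foldl (fun L r => (extendCandidates (rep := Ty.den n) w C r L).val g wt) [D]).length
        ≤ n ^ 2 ∧
      loopCost (fun r L => (extendCandidates (rep := Ty.den n) w C r L).val g wt)
        (fun r L => (extendCandidates (rep := Ty.den n) w C r L).cost g wt) l [D]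
          ≤ 200 * n ^ 3 := by
  obtain ⟨h₁, h₂, h₃, -⟩ := pow_le_pow_chain n
  have hD : ([D] : List (Ty.den n .set)).length ≤ 1 := le_rfl
  obtain _ | ⟨r, _ | ⟨s, _ | ⟨t, l⟩⟩⟩ := l
  · simp only [List.foldl_nil, loopCost]
    exact ⟨hD.trans (h₁.trans h₂), Nat.zero_le _⟩
  · have k₁ := length_extendCandidates_le (w := w) (wt := wt) (g := g) C r [D]
    have k₂ := cost_extendCandidates_le (w := w) (wt := wt) (g := g) C r hD
    simp only [List.foldl_cons, List.foldl_nil, loopCost]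
    rw [List.length_singleton] at k₁
    exact ⟨by linarith, by linarith⟩
  · have k₁ := length_extendCandidates_le (w := w) (wt := wt) (g := g) C r [D]
    have k₂ := cost_extendCandidates_le (w := w) (wt := wt) (g := g) C r hD
    rw [List.length_singleton, one_mul] at k₁
    have k₃ := length_extendCandidates_le (w := w) (wt := wt) (g := g) C s
      ((extendCandidates (rep := Ty.den n) w C r [D]).val g wt)
    have k₄ := cost_extendCandidates_le (w := w) (wt := wt) (g := g) C s k₁
    simp only [List.foldl_cons, List.foldl_nil, loopCost]
    refine ⟨k₃.trans ((Nat.mul_le_mul_right n k₁).trans_eq (sq n).symm), ?_⟩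
    have : n * (60 * n ^ 2) = 60 * n ^ 3 := by ring
    linarith
  · simp at hl

end

/-- Each distinguished component multiplies the length of the list by at most `n`, starting from one
set. -/
theorem candidates_le (h : ¬ ∃ x y z, IsDistinguished G A B x ∧ IsDistinguished G A B y ∧
      IsDistinguished G A B z ∧ ¬ Conn G A x y ∧ ¬ Conn G A x z ∧ ¬ Conn G A y z) :
    ((candidates (rep := Ty.den n) A B w).val (adjMat G) wt).length ≤ n ^ 2 ∧
      (candidates (rep := Ty.den n) A B w).cost (adjMat G) wt ≤ 1000 * n ^ 3 := by
  obtain ⟨h₁, h₂, h₃, -⟩ := pow_le_pow_chain n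
  have key : ∀ C : Ty.den n .mat, (∀ x y, @Eq Bool (C x y) true ↔ Conn G A x y) →
      ∀ C₂ : Ty.den n .set, (∀ a, @Eq Bool (C₂ a) true ↔ IsDistinguished G A B a) →
      ((representatives (rep := Ty.den n) C₂ C).val (adjMat G) wt).length ≤ 2 := by
    intro C hC C₂ hC₂
    by_contra hlt
    refine h ?_
    have := (three_le_length_representatives (g := adjMat G) (wt := wt) (P := C₂) hC
      fun x hx => ((hC₂ x).1 hx).1).1 (by omega)
    simpa only [hC₂] using this
  constructor
  · refine Spec.lett (P := fun C : Ty.den n .mat => ∀ x y, @Eq Bool (C x y) true ↔ Conn G A x y)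
      (Q := fun L : Ty.den n (.list .set) => L.length ≤ n ^ 2) (val_components A) fun C hC => ?_
    refine .lett (P := fun S : Ty.den n .set =>
      ∀ a, @Eq Bool (S a) true ↔ IsDistinguished G A B a) (val_distinguished hC) fun C₂ hC₂ => ?_
    refine .lett_eq (.lett_eq ?_)
    exact (foldl_extendCandidates_le C (key C hC C₂ hC₂) _).1
  · refine (cost_lett_le (b := 900 * n ^ 3) (P := fun C : Ty.den n .mat =>
      ∀ x y, @Eq Bool (C x y) true ↔ Conn G A x y) CostLe.le (val_components A)
      fun C hC => ?_).trans (by linarith)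
    refine (cost_lett_le (b := 800 * n ^ 3) (P := fun S : Ty.den n .set =>
      ∀ a, @Eq Bool (S a) true ↔ IsDistinguished G A B a) CostLe.le ?_
      fun C₂ hC₂ => ?_).trans (by linarith)
    · exact val_distinguished hC
    refine (cost_lett_eq_le (b := 700 * n ^ 3) CostLe.le ?_).trans (by linarith)
    refine (cost_lett_eq_le (b := 300 * n ^ 3) (cost_each_le (length_representatives_le _ C)
      CostLe.le CostLe.le fun _ _ => CostLe.le) ?_).trans (by linarith)
    rw [Tm.cost]
    have hrep : (representatives (rep := Ty.den n) C₂ C).cost (adjMat G) wt ≤ 60 * n ^ 2 :=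
      CostLe.le
    refine (Nat.add_le_add (Nat.add_le_add (Nat.add_le_add_left hrep 1) CostLe.le)
      (foldl_extendCandidates_le C (key C hC C₂ hC₂) _).2).trans ?_
    linarith

theorem cost_candidates_loop_le {S : Fin n → Bool} {w₁ : Fin n → ℕ∞}
    (h : ¬ ∃ x y z, IsDistinguished G A B x ∧ IsDistinguished G A B y ∧
      IsDistinguished G A B z ∧ ¬ Conn G A x y ∧ ¬ Conn G A x z ∧ ¬ Conn G A y z)
    {i : Tm (Ty.den n) (.opt (.prod .num .set))} (hi : i.cost (adjMat G) wt ≤ 1) :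
    (Tm.each (candidates (rep := Ty.den n) A B w) i fun D best => improve S w₁ D best).cost
      (adjMat G) wt ≤ 1300 * n ^ 4 := by
  obtain ⟨h₁, h₂, h₃, h₄, -⟩ := pow_le_pow_chain n
  obtain ⟨k₁, k₂⟩ := candidates_le (w := w) (wt := wt) h
  refine (cost_each_le k₁ k₂ hi fun _ _ => CostLe.le).trans ?_
  linarith

/-- The dominant term comes from `n` choices of `a`, at most `n ^ 2` candidates for each, and at
most `200 * n ^ 2` steps to test one. The bound needs no solution: if the search succeeds, the
vertex found is good by the test itself. -/
theorem cost_unipolarWED_le (hA : CliqueComps G A) (hN : NoMutualOvertaking G A B) :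
    (unipolarWED (rep := Ty.den n) A B w).cost (adjMat G) wt ≤ 5000 * n ^ 5 := by
  obtain ⟨h₁, h₂, h₃, h₄, h₅, -⟩ := pow_le_pow_chain n
  refine (cost_elim_le (c := 4400 * n ^ 5) CostLe.le (fun _ => CostLe.le)
    fun I hI => ?_).trans (by linarith)
  have hjoin := spec_joinReduction (G := G) (wt := wt) A B w
  rw [Spec, hI] at hjoin
  replace hjoin : JoinReduced G A B w I := hjoin
  refine (cost_lett_eq_le (b := 4300 * n ^ 5) CostLe.le ?_).trans (by linarith)
  refine (cost_lett_eq_le (b := 4200 * n ^ 5) CostLe.le ?_).trans (by linarith)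
  refine (cost_lett_eq_le (b := 4100 * n ^ 5) CostLe.le ?_).trans (by linarith)
  simp only [Tm.val]
  set A₁ := I.1 with hA₁
  set B₁ := I.2.1 with hB₁
  set w₁ := I.2.2 with hw₁
  have hA₁A : A₁ = A := hjoin.fst_eq_of_cliqueComps hA
  have hBsub : ∀ b, B₁ b = true → B b = true := fun b hb => ((hjoin.memB b).1 hb).1
  have hAcl : CliqueComps G A₁ := by rwa [hA₁A]
  have hN₁ : NoMutualOvertaking G A₁ B₁ := by
    rw [hA₁A]
    exact fun b b' y y' hb hb' => hN b b' y y' (hBsub b hb) (hBsub b' hb')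
  refine (cost_lett_eq_le (b := 4000 * n ^ 5) CostLe.le ?_).trans (by linarith)
  generalize Tm.val (adjMat G) wt (.tab _) = S
  refine (cost_lett_le (b := 3900 * n ^ 5) (P := fun C : Ty.den n .mat =>
    ∀ x y, @Eq Bool (C x y) true ↔ Conn G A₁ x y) CostLe.le (val_components A₁)
    fun C hC => ?_).trans (by linarith)
  refine (cost_lett_eq_le (a := 3800 * n ^ 5) ?_ CostLe.le).trans (by linarith)
  refine (cost_ite_le (b := 2300 * n ^ 5) (c := 1300 * n ^ 4) CostLe.le (fun hne => ?_)
    fun hempty => ?_).trans (by linarith)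
  · refine (cost_elim_le (c := 1900 * n ^ 5) CostLe.le (fun _ => CostLe.le)
      fun b hfind => ?_).trans (by linarith)
    have hgood : B₁ b = true ∧ ∀ b', B₁ b' = true → b' ≠ b → ¬ Arrow G A₁ b b' := by
      have := val_find_of_eq_some hfind
      simp only [Tm.val, val_mem, val_all, val_imp, Bool.and_eq_true, Bool.not_eq_true',
        ← Bool.not_eq_true, val_arrow hC] at this
      exact ⟨this.1, fun b' hb' hne => this.2 b' ⟨hb', fun e => hne (of_decide_eq_true e)⟩⟩
    refine (cost_loop_le (b := 1880 * n ^ 4) CostLe.le fun a s => ?_).trans (by linarith)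
    refine (cost_ite_le (b := 1860 * n ^ 4) CostLe.le (fun hif => ?_) fun _ => CostLe.le).trans
      (by linarith)
    simp only [Tm.val, val_mem, val_nb, Bool.and_eq_true, adjMat_eq_true] at hif
    refine (cost_lett_le (b := 1820 * n ^ 4) (P := fun A₂ : Ty.den n .set => ∀ x,
      @Eq Bool (A₂ x) true ↔ x = a ∨ A₁ x = true ∧ ¬ Conn G A₁ a x ∧ ¬ G.Adj b x)
      CostLe.le ?_ fun A₂ hA₂ => ?_).trans (by linarith)
    · intro x
      simp only [Tm.val, val_mem, val_entry, val_nb, Bool.and_eq_true,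
        Bool.or_eq_true, Bool.not_eq_true', ← Bool.not_eq_true, hC, adjMat_eq_true]
      exact or_congr decide_eq_true_iff Iff.rfl
    have hA₂cl : CliqueComps G A₂ := cliqueComps_fix_neighbor hAcl fun x hx => by
      rcases (hA₂ x).1 hx with rfl | hx
      · exact hif.1
      · exact hx.1
    refine (cost_elim_le (c := 1315 * n ^ 4) CostLe.le (fun _ => CostLe.le)
      fun I₃ hI₃ => ?_).trans (by linarith)
    have hjoin₃ := spec_joinReduction (G := G) (wt := wt) A₂ B₁ w₁
    rw [Spec, hI₃] at hjoin₃
    replace hjoin₃ : JoinReduced G A₂ B₁ w₁ I₃ := hjoin₃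
    refine (cost_lett_eq_le (b := 1310 * n ^ 4) CostLe.le ?_).trans (by linarith)
    refine (cost_lett_eq_le (b := 1305 * n ^ 4) CostLe.le ?_).trans (by linarith)
    refine (cost_lett_eq_le (b := 1300 * n ^ 4) CostLe.le ?_).trans (by linarith)
    refine cost_candidates_loop_le ?_ CostLe.le
    simp only [Tm.val]
    rw [hjoin₃.fst_eq_of_cliqueComps hA₂cl]
    rintro ⟨x, y, z, hx, hy, hz, hxy, hxz, hyz⟩
    obtain ⟨i, j, hij, hc⟩ := hjoin₃.not_three_distinguished hAcl hN₁ hgood.2 hif.1 hif.2.1 hA₂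
      ![x, y, z] (by simp [Fin.forall_fin_succ, hx, hy, hz])
    revert hij hc
    have := fun h : Conn G A₂ y x => hxy h.symm
    have := fun h : Conn G A₂ z x => hxz h.symm
    have := fun h : Conn G A₂ z y => hyz h.symm
    fin_cases i <;> fin_cases j <;> simp_all
  · refine cost_candidates_loop_le ?_ CostLe.le
    -- With no vertex left in `B₁`, no component is distinguished.
    rintro ⟨x, -, -, ⟨-, b, hb, -⟩, -⟩
    simp only [val_any, val_mem] at hempty
    exact hempty ⟨b, hb⟩

end

/-! ### Running time of a round and of the whole algorithm -/

section

variable {n : ℕ} {G : SimpleGraph (Fin n)} [DecidableRel G.Adj] {A B : Fin n → Bool}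
  {w wt : Fin n → ℕ∞}

theorem cost_solutions_le [NeZero n] (hG : P6Free G) {v : Fin n} {N : Fin n → Bool}
    (h : IsLevels G v N A) {w₀ : Fin n → ℕ∞}
    {I : (Fin n → Bool) × (Fin n → Bool) × (Fin n → ℕ∞)} (hI : JoinReduced G A N w₀ I)
    {C : Fin n → Fin n → Bool} {K : Fin n → Bool}
    (hC : ∀ x y, C x y = true ↔ Conn G I.1 x y)
    (hK : ∀ a, K a = true ↔ InCliqueComp G I.1 a) :
    (Tm.ite (any fun a => mem I.1 a &ₜ ∼ₜ (mem K a))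
      (.elim
        (find fun b => mem N b &ₜ all fun a =>
          imp (mem I.1 a &ₜ ∼ₜ (mem K a)) (any fun y => entry C a y &ₜ nb b y)) .nil fun b =>
        .loop .nil fun q L =>
          .ite (mem I.1 q &ₜ nb b q &ₜ isFinite (.get ♯I.2.2 ♯q))
            (.elim (componentReduction I.1 I.2.2 C K b q) ♯L fun R =>
              .lett (.fst ♯R) fun A₂ =>
              .lett (.snd ♯R) fun w₂ =>
              .elim (unipolarWED A₂ I.2.1 w₂) ♯L fun D => .cons ♯D ♯L)
            ♯L)
      (.elim (unipolarWED I.1 I.2.1 I.2.2) .nil fun D => .cons ♯D .nil) :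
        Tm (Ty.den n) (.list .set)).cost (adjMat G) wt ≤ 12000 * n ^ 6 := by
  obtain ⟨h₁, h₂, h₃, h₄, h₅, h₆⟩ := pow_le_pow_chain n
  have hsubA : ∀ x, I.1 x = true → A x = true := fun x hx => ((hI.memA x).1 hx).1
  have hsubN : ∀ x, I.2.1 x = true → N x = true := fun x hx => ((hI.memB x).1 hx).1
  refine (cost_ite_le (b := 6000 * n ^ 6) (c := 5010 * n ^ 5) CostLe.le (fun _ => ?_)
    fun hcl => ?_).trans (by linarith)
  · refine (cost_elim_le (c := 5600 * n ^ 6) CostLe.le (fun _ => CostLe.le)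
      fun b hsome => ?_).trans (by linarith)
    have hb := val_find_of_eq_some hsome
    simp only [Tm.val, val_mem, Bool.and_eq_true] at hb
    have hbN := hb.1
    refine (cost_loop_le (b := 5580 * n ^ 5) CostLe.le fun q L => ?_).trans (by linarith)
    refine (cost_ite_le (b := 5550 * n ^ 5) CostLe.le (fun hif => ?_) fun _ => CostLe.le).trans
      (by linarith)
    simp only [Tm.val, val_mem, val_nb, Bool.and_eq_true, adjMat_eq_true] at hif
    obtain ⟨hq, hbq, -⟩ := hif
    refine (cost_elim_le (c := 5030 * n ^ 5) CostLe.le (fun _ => CostLe.le)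
      fun R hR => ?_).trans (by linarith)
    obtain ⟨Y, hY, -, hR'⟩ := spec_componentReduction (wt := wt) (w := I.2.2) hC hK b q
    -- Time is spent on every `q`, also on one that belongs to no solution. So the cliques after
    -- reduction have to be derived without a solution, which is why `ReductionBase` does not
    -- mention `D`.
    have S : ReductionBase G I.1 b q Y := ⟨hY, hq, hbq, fun y z z' hy hz hz' =>
      h.no_path hG hbN (hsubA y hy) (hsubA z hz) (hsubA z' hz')⟩
    obtain ⟨-, hA₂, -, -⟩ := hR' R hR
    refine (cost_lett_eq_le (b := 5020 * n ^ 5) CostLe.le ?_).trans (by linarith)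
    refine (cost_lett_eq_le (b := 5010 * n ^ 5) CostLe.le ?_).trans (by linarith)
    simp only [Tm.val]
    refine (cost_elim_le (a := 5000 * n ^ 5) (cost_unipolarWED_le (S.cliqueComps hA₂)
      (h.noMutualOvertaking hG (fun x hx => hsubA x (S.subset hA₂ hx)) hsubN))
      (fun _ => CostLe.le) fun _ _ => CostLe.le).trans (by linarith)
  · simp only [Tm.val, val_any, val_mem, Bool.and_eq_true, Bool.not_eq_true',
      ← Bool.not_eq_true, hK] at hcl
    push Not at hcl
    have hcliques : CliqueComps G I.1 := fun x y hxy =>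
      (hcl x hxy.left).2 x y (.refl hxy.left) hxy
    refine (cost_elim_le (a := 5000 * n ^ 5) (cost_unipolarWED_le hcliques
      (h.noMutualOvertaking hG hsubA hsubN)) (fun _ => CostLe.le)
      fun _ _ => CostLe.le).trans (by linarith)

/-- Each `q` contributes at most one set, so the final tests of a round are at most `n` in number.
-/
theorem length_solutions_le [NeZero n] {g : Fin n → Fin n → Bool} {A₁ B₁ N K : Ty.den n .set}
    {w₁ : Ty.den n .wts} {C : Ty.den n .mat} {t : Tm (Ty.den n) .bool} :
    Spec g wt (Tm.ite t
      (.elim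
        (find fun b => mem N b &ₜ all fun a =>
          imp (mem A₁ a &ₜ ∼ₜ (mem K a)) (any fun y => entry C a y &ₜ nb b y)) .nil fun b =>
        .loop .nil fun q L =>
          .ite (mem A₁ q &ₜ nb b q &ₜ isFinite (.get ♯w₁ ♯q))
            (.elim (componentReduction A₁ w₁ C K b q) ♯L fun R =>
              .lett (.fst ♯R) fun A₂ =>
              .lett (.snd ♯R) fun w₂ =>
              .elim (unipolarWED A₂ B₁ w₂) ♯L fun D => .cons ♯D ♯L)
            ♯L)
      (.elim (unipolarWED A₁ B₁ w₁) .nil fun D => .cons ♯D .nil) :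
        Tm (Ty.den n) (.list .set)) (fun L => L.length ≤ n) := by
  refine .ite (fun _ => .elim (fun _ => Nat.zero_le n) fun b _ => ?_) fun _ =>
    .elim (fun _ => Nat.zero_le n) fun _ _ => NeZero.one_le
  rw [Spec, Tm.val]
  refine (foldl_measure_le (k := 1) List.length (fun s q => ?_) (List.finRange n) []).trans
    (by simp)
  refine Spec.ite (Q := fun L : Ty.den n (.list .set) => L.length ≤ s.length + 1)
    (fun _ => .elim (fun _ => Nat.le_succ _) fun R _ => .lett_eq (.lett_eq
      (.elim (fun _ => Nat.le_succ _) fun _ _ => ?_))) fun _ => Nat.le_succ _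
  exact (List.length_cons).le

theorem cost_wedRound_le [NeZero n] (hG : P6Free G) (hconn : G.Connected) (w : Fin n → ℕ∞)
    (v : Fin n) (best : Option (ℕ∞ × (Fin n → Bool))) :
    (wedRound (rep := Ty.den n) w v best).cost (adjMat G) wt ≤ 15000 * n ^ 6 := by
  obtain ⟨h₁, h₂, h₃, h₄, h₅, h₆⟩ := pow_le_pow_chain n
  refine (cost_lett_le (b := 14900 * n ^ 6) (P := fun S : Ty.den n .set =>
    ∀ u, @Eq Bool (S u) true ↔ G.Adj v u) CostLe.le (by intro u; simp) fun N₁ h₁' => ?_).trans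
    (by linarith)
  refine (cost_lett_le (b := 14800 * n ^ 6) (P := fun S : Ty.den n .set =>
    ∀ u, @Eq Bool (S u) true ↔ u ≠ v ∧ ¬ G.Adj v u ∧ ∃ x, G.Adj v x ∧ G.Adj x u) CostLe.le ?_
    fun N₂ h₂' => ?_).trans (by linarith)
  · intro u
    simp only [Tm.val, val_any, val_mem, val_nb, Bool.and_eq_true, Bool.not_eq_true',
      ← Bool.not_eq_true, h₁', adjMat_eq_true]
    exact and_congr (not_congr decide_eq_true_iff) Iff.rfl
  refine (cost_lett_le (b := 14700 * n ^ 6) (P := fun S : Ty.den n .set =>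
    ∀ u, @Eq Bool (S u) true ↔ ¬ G.Adj v u ∧ ¬ N₂ u = true ∧ ∃ x, N₂ x = true ∧ G.Adj x u)
    CostLe.le ?_ fun N₃ h₃' => ?_).trans (by linarith)
  · intro u
    simp only [Tm.val, val_any, val_mem, val_nb, Bool.and_eq_true, Bool.not_eq_true',
      ← Bool.not_eq_true, h₁', adjMat_eq_true]
  refine (cost_lett_le (b := 14600 * n ^ 6) (P := fun S : Ty.den n .set =>
    ∀ u, @Eq Bool (S u) true ↔ ¬ N₂ u = true ∧ ¬ N₃ u = true ∧ ∃ x, N₃ x = true ∧ G.Adj x u)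
    CostLe.le ?_ fun N₄ h₄' => ?_).trans (by linarith)
  · intro u
    simp only [Tm.val, val_any, val_mem, val_nb, Bool.and_eq_true, Bool.not_eq_true',
      ← Bool.not_eq_true, adjMat_eq_true]
  refine (cost_lett_le (b := 14500 * n ^ 6) (P := fun S : Ty.den n .set =>
    ∀ u, @Eq Bool (S u) true ↔ N₃ u = true ∨ N₄ u = true) CostLe.le (by intro u; simp)
    fun A hA => ?_).trans (by linarith)
  have hlev : IsLevels G v N₂ A := isLevels_of_connected hG hconn h₂' h₃' h₄' hA
  refine (cost_lett_eq_le (b := 14400 * n ^ 6) CostLe.le ?_).trans (by linarith)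
  generalize Tm.val (adjMat G) wt (.tab _) = w₀
  refine (cost_elim_le (c := 13800 * n ^ 6) CostLe.le (fun _ => CostLe.le)
    fun I hI => ?_).trans (by linarith)
  have hjoin := spec_joinReduction (G := G) (wt := wt) A N₂ w₀
  rw [Spec, hI] at hjoin
  replace hjoin : JoinReduced G A N₂ w₀ I := hjoin
  refine (cost_lett_eq_le (b := 13700 * n ^ 6) CostLe.le ?_).trans (by linarith)
  refine (cost_lett_eq_le (b := 13600 * n ^ 6) CostLe.le ?_).trans (by linarith)
  refine (cost_lett_eq_le (b := 13500 * n ^ 6) CostLe.le ?_).trans (by linarith)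
  simp only [Tm.val]
  refine (cost_lett_le (b := 13400 * n ^ 6) (P := fun C : Ty.den n .mat =>
    ∀ x y, @Eq Bool (C x y) true ↔ Conn G I.1 x y) CostLe.le (val_components _)
    fun C hC => ?_).trans (by linarith)
  refine (cost_lett_le (b := 13200 * n ^ 6) (P := fun K : Ty.den n .set =>
    ∀ a, @Eq Bool (K a) true ↔ InCliqueComp G I.1 a) CostLe.le (val_cliqueComponents hC)
    fun K hK => ?_).trans (by linarith)
  refine (cost_lett_le (b := 1000 * n ^ 6) (cost_solutions_le hG hlev hjoin hC hK)
    length_solutions_le fun L hL => ?_).trans (by linarith)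
  refine (cost_lett_eq_le (b := 900 * n ^ 6) CostLe.le ?_).trans (by linarith)
  refine (cost_each_le (l := .var L) hL CostLe.le CostLe.le fun _ _ => CostLe.le).trans ?_
  linarith

/-- The number of iterations over a closed neighbourhood. -/
theorem sum_closed_neighborhood (v₀ : Fin n) (a b : ℕ) :
    ((List.finRange n).map fun v => 1 + (a + if v = v₀ ∨ G.Adj v v₀ then b else 0)).sum =
      n * (1 + a) + (G.degree v₀ + 1) * b := by
  have : (Finset.univ.filter fun v => v = v₀ ∨ G.Adj v v₀).card = G.degree v₀ + 1 := by
    rw [← G.card_neighborFinset_eq_degree, ← Finset.card_insert_of_notMem (a := v₀) (by simp)]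
    congr 1
    ext v
    simp [G.adj_comm v v₀]
  rw [← Fin.sum_univ_def]
  simp only [← add_assoc]
  rw [Finset.sum_add_distrib, ← Finset.sum_filter, Finset.sum_const, Finset.sum_const, this]
  simp

/-- The loop runs over all vertices, but only those in the closed neighbourhood of `v₀` cost more
than a constant. The bound on an iteration therefore depends on the vertex. -/
theorem wedTime_le [NeZero n] (hG : P6Free G) (hconn : G.Connected) :
    wedTime G w ≤ 200 * n ^ 2 + (G.minDegree + 1) * (15000 * n ^ 6) := by
  obtain ⟨h₁, h₂, h₃, h₄, h₅, h₆⟩ := pow_le_pow_chain n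
  refine (cost_lett_eq_le (b := 190 * n ^ 2 + (G.minDegree + 1) * (15000 * n ^ 6)) CostLe.le
    ?_).trans (by linarith)
  refine (cost_lett_le (P := fun d : Ty.den n .wts => ∀ x, d x = (G.degree x : ℕ∞))
    (b := 160 * n ^ 2 + (G.minDegree + 1) * (15000 * n ^ 6)) CostLe.le (fun x => ?_)
    fun d hd => ?_).trans (by linarith)
  · refine (val_count _).trans ?_
    rw [← G.card_neighborFinset_eq_degree]
    congr 2
    ext y
    simp
  refine (cost_elim_le (c := 100 * n ^ 2 + (G.minDegree + 1) * (15000 * n ^ 6)) CostLe.le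
    (fun _ => CostLe.le) fun v₀ hv₀ => ?_).trans (by linarith)
  have hmin : ∀ x, G.degree v₀ ≤ G.degree x := by
    intro x₀
    suffices h : Spec (adjMat G) w (.loop .none fun x m => .elim ♯m (.some ♯x) fun y =>
        .ite (.le (.get ♯d ♯y) (.get ♯d ♯x)) ♯m (.some ♯x)) (fun m : Ty.den n (.opt .vert) =>
          ∃ y, m = some y ∧ G.degree y ≤ G.degree x₀) by
      obtain ⟨y, hy, hle⟩ := h
      rwa [Option.some.inj (hv₀.symm.trans hy)]
    refine .loop_reaches x₀ (fun x m hm => ?_) fun m => ?_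
    · obtain ⟨y, rfl, hy⟩ := hm
      refine .elim (fun h => by cases h) fun y' hy' => ?_
      obtain rfl : y = y' := Option.some.inj hy'
      refine .ite (fun _ => ?_) fun hlt => ?_
      · exact ⟨y, rfl, hy⟩
      refine ⟨x, rfl, ?_⟩
      simp only [Tm.val, hd] at hlt
      exact (Nat.le_of_lt (not_le.1 fun h => hlt (decide_eq_true (Nat.cast_le.2 h)))).trans hy
    · have hx₀ : ∃ y, some x₀ = some y ∧ G.degree y ≤ G.degree x₀ := ⟨x₀, rfl, le_rfl⟩
      refine .elim (fun _ => hx₀) fun y hy => .ite (fun hle => ?_) fun _ => hx₀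
      refine ⟨y, hy, ?_⟩
      simp only [Tm.val, hd] at hle
      exact Nat.cast_le.1 (of_decide_eq_true hle)
  have hdeg : G.degree v₀ ≤ G.minDegree := by
    have : Nonempty (Fin n) := ⟨v₀⟩
    obtain ⟨x, hx⟩ := G.exists_minimal_degree_vertex
    exact hx ▸ hmin x
  refine (cost_lett_eq_le (a := 30 * n + (G.minDegree + 1) * (15000 * n ^ 6)) ?_
    CostLe.le).trans (by linarith)
  rw [Tm.cost]
  refine (Nat.add_le_add_left (loopCost_le_sum (f := fun v =>
    10 + if v = v₀ ∨ G.Adj v v₀ then 15000 * n ^ 6 else 0) (fun v s => ?_) _ _) _).trans ?_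
  · split_ifs with hv
    · refine (cost_ite_le (b := 15000 * n ^ 6) CostLe.le (fun _ => cost_wedRound_le hG hconn _ v s)
        fun _ => CostLe.le).trans (by omega)
    · refine (cost_ite_le (b := 0) (c := 1) CostLe.le (fun h => absurd ?_ hv)
        fun _ => CostLe.le).trans (by omega)
      simpa using h
  · rw [sum_closed_neighborhood]
    have := Nat.mul_le_mul_right (15000 * n ^ 6) (Nat.add_le_add_right hdeg 1)
    have h1 : (Tm.none : Tm (Ty.den n) (.opt (.prod .num .set))).cost (adjMat G) w = 1 := rfl
    rw [h1]
    linarith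

theorem wedTime_le_mul (hn : 2 ≤ n) (hG : P6Free G) (hconn : G.Connected) :
    wedTime G w ≤ 70000 * (G.minDegree * n ^ 5 * G.edgeFinset.card) := by
  have : NeZero n := ⟨by omega⟩
  obtain ⟨h₁, h₂, h₃, h₄, h₅, h₆⟩ := pow_le_pow_chain n
  have : Nontrivial (Fin n) := Fin.nontrivial_iff_two_le.2 hn
  have hδ : 1 ≤ G.minDegree := hconn.preconnected.minDegree_pos_of_nontrivial
  -- Connectedness gives `n ≤ m + 1`, and `n ≥ 2` forces `m ≥ 1`.
  have hm : n ≤ 2 * G.edgeFinset.card := by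
    have := hconn.card_vert_le_card_edgeSet_add_one
    rw [Nat.card_eq_fintype_card, Nat.card_eq_fintype_card, Fintype.card_fin,
      ← SimpleGraph.edgeFinset_card] at this
    omega
  have key : G.minDegree * n ^ 6 ≤ 2 * (G.minDegree * n ^ 5 * G.edgeFinset.card) := by
    calc G.minDegree * n ^ 6 = G.minDegree * n ^ 5 * n := by ring
      _ ≤ G.minDegree * n ^ 5 * (2 * G.edgeFinset.card) := Nat.mul_le_mul_left _ hm
      _ = _ := by ring
  have h₇ : n ^ 6 ≤ G.minDegree * n ^ 6 := Nat.le_mul_of_pos_left _ hδ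
  have := wedTime_le (w := w) hG hconn
  -- With `δ ≥ 1` the time is at most `(200 + 2 * 15000) * δ * n ^ 6`, and replacing one factor `n`
  -- by `2 * m` gives `60400`, which is below `70000`.
  linarith

end

end WED

theorem mainTheorem1 :
    (∀ (n : ℕ) (G : SimpleGraph (Fin n)) [DecidableRel G.Adj] (w : Fin n → ℕ∞),
      G.Connected → WED.P6Free G → WED.IsWEDAnswer G w (WED.wedOutput G w)) ∧
    ∃ c : ℕ, ∀ (n : ℕ) (G : SimpleGraph (Fin n)) [DecidableRel G.Adj] (w : Fin n → ℕ∞),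
      2 ≤ n → G.Connected → WED.P6Free G →
        WED.wedTime G w ≤ c * (G.minDegree * n ^ 5 * G.edgeFinset.card) ∧
        WED.wedTime G w ≤ c * (n ^ 6 * G.edgeFinset.card) := by
  refine ⟨fun n G _ w hc hG => WED.isWEDAnswer_wedOutput hG hc w,
    70000, fun n G _ w hn hc hG => ?_⟩
  have h := WED.wedTime_le_mul (w := w) hn hG hc
  have : Nonempty (Fin n) := hc.nonempty
  have hδ : G.minDegree ≤ n := by simpa using G.minDegree_lt_card.le
  refine ⟨h, h.trans (Nat.mul_le_mul_left _ (Nat.mul_le_mul_right _ ?_))⟩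
  calc G.minDegree * n ^ 5 ≤ n * n ^ 5 := Nat.mul_le_mul_right _ hδ
    _ = n ^ 6 := by ring
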